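/- Let $R\subset\mathfrak a^*$ be a crystallographic root system (finite, spanning, not necessarily reduced) in the dual of a finite-dimensional real vector space $\mathfrak a$, with Weyl group $W$, positive roots $R^+$, simple roots $\Pi$, weight lattice $P=\{\lambda:\lambda(\alpha^\vee)\in\mathbb Z\ \forall\alpha\in R\}$, coroot lattice $Q^\vee$ and $Q^+=\sum_{\alpha\in\Pi}\mathbb Z_{\ge0}\alpha$. Let $k:R\to\mathbb R_{\ge0}$ be $W$-invariant, let $I$ be a set of simple reflections, $W_I\subset W$ the subgroup that it generates, $R_I^+$ the set of positive roots whose reflection lies in $W_I$, $P^+=\{\lambda\in P:\lambda(\alpha^\vee)\ge0\ \forall\alpha\in R^+\}$ and $P_I^+=\{\lambda\in P:\lambda(\alpha^\vee)\ge0\ \forall\alpha\in R_I^+\}$. On $\mathbb C[P]$, viewed as functions on the torus $T=i\mathfrak a/2\pi iQ^\vee$, put $$(f,g)_k=\int_T\overline{f(t)}\,g(t)\prod_{\alpha\in R}\bigl|e^{\alpha/2}(t)-e^{-\alpha/2}(t)\bigr|^{k_\alpha}dt .$$ For $\lambda\in P$ let $\lambda_+$ be the element of $W\lambda\cap P^+$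 and $\overline v(\lambda)$ the shortest $w\in W$ with $w\lambda_+=\lambda$. For $\lambda,\mu\in P_I^+$ write $\mu\le_I\lambda$ if $\lambda_+-\mu_+\in Q^+$ and, in case $\lambda_+=\mu_+$, moreover $\overline v(\mu)\le\overline v(\lambda)$ in the Bruhat order. Let $m_I(\mu)=\sum_{\nu\in W_I\mu}e^\nu$. The Jacobi polynomial $p_I(\lambda,k)$, $\lambda\in P_I^+$, is the element of $\mathbb C[P]^{W_I}$ of the form $\sum_{\mu\le_I\lambda}c_\mu m_I(\mu)$, $c_\lambda=1$, with $(p_I(\lambda,k),m_I(\mu))_k=0$ for all $\mu<_I\lambda$. Let $\mathfrak h=\mathfrak a\otimes\mathbb C$, $\rho(k)=\frac12\sum_{\alpha\in R^+}k_\alpha\alpha$, and for $\xi\in\mathfrak h$ let $$D_\xi=\partial_\xi+\sum_{\alpha\in R^+}k_\alpha\,\alpha(\xi)\,\frac{1}{1-e^{-\alpha}}(1-s_\alpha)-\rho(k)(\xi)$$ act on $\mathbb C[P]$. For $\lambda\in P$ put $\widetilde\lambda=\lambda+\frac12\sum_{\alpha\in R^+}k_\alpha\,\varepsilon(\lambda(\alpha^\vee))\,\alpha$,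 where $\varepsilon(x)=x/|x|$ for $x\neq0$ and $\varepsilon(0)=-1$. Then the following hold. 1. For each $\lambda\in P_I^+$ the polynomial $p_I(\lambda,k)$ exists and is unique. 2. $(p_I(\lambda,k),p_I(\mu,k))_k=0$ for all $\lambda\ne\mu$ in $P_I^+$, whether or not $\lambda$ and $\mu$ are comparable for $\le_I$. 3. The $p_I(\lambda,k)$, $\lambda\in P_I^+$, have non-zero norm and form an orthogonal basis of the vector space $\mathbb C[P]^{W_I}$. 4. $\xi\mapsto D_\xi$ extends to an algebra homomorphism $q\mapsto q(D)$ from $S(\mathfrak h)$ to $\operatorname{End}(\mathbb C[P])$. For $q\in S(\mathfrak h)^{W_I}$ the operator $q(D)$ preserves $\mathbb C[P]^{W_I}$; call its restriction $D_{I,q}$. The adjoint of $D_{I,q}$ for $(\cdot,\cdot)_k$ is $D_{I,\bar q}$, where $\bar q$ is the complex conjugate of $q$ with respect to $\mathfrak a$; in particular $D_{I,q}$ is symmetric if $q$ is real. Moreover $D_{I,q}\,p_I(\lambda,k)=q(\widetilde\lambda)\,p_I(\lambda,k)$ for all $\lambda\in P_I^+$, and for $\lambda\neq\mu$ in $P_I^+$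 there is $q\in S(\mathfrak h)^{W_I}$ with $q(\widetilde\lambda)\ne q(\widetilde\mu)$. -/

import Mathlib

noncomputable section

namespace ParabolicJacobi

open RootPairing TensorProduct

section RootData

variable {ι M N : Type*} [AddCommGroup M] [Module ℝ M] [AddCommGroup N] [Module ℝ N]

/-- A set of simple roots of a (possibly non-reduced) root system: a linearly independent set of
roots such that each root or its negative is a sum of simple roots. (`RootPairing.Base` also imposes
the dual condition on the coroots, which excludes non-reduced root systems.) -/
structure SimpleSystem (R : RootPairing ι ℝ M N) where
  /-- The indices of the simple roots. -/
  support : Finset ι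
  linearIndepOn_root : LinearIndepOn ℝ R.root support
  root_mem_or_neg_mem (i : ι) : R.root i ∈ AddSubmonoid.closure (R.root '' support) ∨
    -R.root i ∈ AddSubmonoid.closure (R.root '' support)

/-- The cone `Q⁺` of sums of simple roots. -/
def SimpleSystem.posCone {R : RootPairing ι ℝ M N} (Δ : SimpleSystem R) : AddSubmonoid M :=
  AddSubmonoid.closure (R.root '' Δ.support)

/-- The root with index `i` is positive. -/
def SimpleSystem.IsPos {R : RootPairing ι ℝ M N} (Δ : SimpleSystem R) (i : ι) : Prop :=
  R.root i ∈ Δ.posCone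

/-- The weight lattice `P`: the elements which take integral values on all coroots. -/
def weightLattice (R : RootPairing ι ℝ M N) : AddSubgroup M where
  carrier := {m | ∀ i, ∃ n : ℤ, R.coroot' i m = n}
  add_mem' {a b} ha hb i := by
    obtain ⟨x, hx⟩ := ha i
    obtain ⟨y, hy⟩ := hb i
    exact ⟨x + y, by rw [map_add, hx, hy]; push_cast; rfl⟩
  zero_mem' i := ⟨0, by simp⟩
  neg_mem' {a} ha i := by
    obtain ⟨x, hx⟩ := ha i
    exact ⟨-x, by rw [map_neg, hx]; push_cast; rfl⟩

/-- The integer `⟨μ, αᵢ^∨⟩` for a weight `μ`. -/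
def pairInt (R : RootPairing ι ℝ M N) (μ : weightLattice R) (i : ι) : ℤ := (μ.2 i).choose

lemma pairInt_spec (R : RootPairing ι ℝ M N) (μ : weightLattice R) (i : ι) :
    R.coroot' i (μ : M) = pairInt R μ i := (μ.2 i).choose_spec

lemma root_mem_weightLattice (R : RootPairing ι ℝ M N) [R.IsCrystallographic] (i : ι) :
    R.root i ∈ weightLattice R := fun j => by
  obtain ⟨n, hn⟩ := RootPairing.IsValuedIn.exists_value (P := R) (S := ℤ) i j
  exact ⟨n, by rw [R.root_coroot'_eq_pairing, ← hn]; simp⟩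

/-- The root with index `i`, as a weight. -/
def rootWt (R : RootPairing ι ℝ M N) [R.IsCrystallographic] (i : ι) : weightLattice R :=
  ⟨R.root i, root_mem_weightLattice R i⟩

lemma reflection_mem_weightLattice (R : RootPairing ι ℝ M N) [R.IsCrystallographic] (i : ι)
    {m : M} (hm : m ∈ weightLattice R) : R.reflection i m ∈ weightLattice R := by
  obtain ⟨n, hn⟩ := hm i
  rw [R.reflection_apply, hn, Int.cast_smul_eq_zsmul]
  exact sub_mem hm (zsmul_mem (root_mem_weightLattice R i) n)

lemma smul_mem_weightLattice (R : RootPairing ι ℝ M N) [R.IsCrystallographic] (w : R.weylGroup)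
    {m : M} (hm : m ∈ weightLattice R) : w • m ∈ weightLattice R := by
  obtain ⟨w, hw⟩ := w
  change w • m ∈ weightLattice R
  induction hw using weylGroup.induction generalizing m with
  | mem i => exact reflection_mem_weightLattice R i hm
  | one => rwa [one_smul]
  | mul x y _ _ hx hy => rw [mul_smul]; exact hx (hy hm)

/-- The Weyl group `W` acts on the weight lattice. -/
instance weylAction (R : RootPairing ι ℝ M N) [R.IsCrystallographic] :
    MulAction R.weylGroup (weightLattice R) where
  smul w μ := ⟨w • (μ : M), smul_mem_weightLattice R w μ.2⟩
  one_smul μ := Subtype.ext (one_smul R.weylGroup (μ : M))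
  mul_smul v w μ := Subtype.ext (mul_smul v w (μ : M))

lemma coe_smul_weight (R : RootPairing ι ℝ M N) [R.IsCrystallographic] (w : R.weylGroup)
    (μ : weightLattice R) : ((w • μ : weightLattice R) : M) = w • (μ : M) := rfl

/-- The parabolic subgroup `W_I` generated by the reflections in the roots with index in `I`. -/
def parabolic (R : RootPairing ι ℝ M N) (I : Set ι) : Subgroup R.weylGroup :=
  Subgroup.closure (weylGroup.ofIdx R '' I)

/-- Length with respect to the simple reflections. -/
def SimpleSystem.length {R : RootPairing ι ℝ M N} (Δ : SimpleSystem R) (w : R.weylGroup) : ℕ :=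
  sInf {n | ∃ l : List ι, (∀ i ∈ l, i ∈ Δ.support) ∧ l.length = n ∧
    (l.map (weylGroup.ofIdx R)).prod = w}

/-- The Bruhat ordering `≤_W`: the reflexive transitive closure of the relation
`u → u t`, where `t` is a reflection with `ℓ(u) < ℓ(u t)`. -/
def SimpleSystem.bruhatLE {R : RootPairing ι ℝ M N} (Δ : SimpleSystem R) :
    R.weylGroup → R.weylGroup → Prop :=
  Relation.ReflTransGen
    (fun u v => ∃ i : ι, v = u * weylGroup.ofIdx R i ∧ Δ.length u < Δ.length v)

/-- `P⁺`: the weights which are dominant for all positive roots. -/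
def dominant {R : RootPairing ι ℝ M N} (Δ : SimpleSystem R) : Set (weightLattice R) :=
  {μ | ∀ i, Δ.IsPos i → 0 ≤ R.coroot' i (μ : M)}

/-- `P_I⁺`: the weights which are dominant for all roots in `R_I⁺`, i.e. for all positive roots
whose reflection is in `W_I`. -/
def dominantI {R : RootPairing ι ℝ M N} (Δ : SimpleSystem R) (I : Set ι) :
    Set (weightLattice R) :=
  {μ | ∀ i, Δ.IsPos i → weylGroup.ofIdx R i ∈ parabolic R I → 0 ≤ R.coroot' i (μ : M)}

/-- `v` is of minimal length among the elements of `W` that send `μ` to `μ'`. -/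
def IsShortest {R : RootPairing ι ℝ M N} [R.IsCrystallographic] (Δ : SimpleSystem R)
    (v : R.weylGroup) (μ μ' : weightLattice R) : Prop :=
  v • μ = μ' ∧ ∀ w : R.weylGroup, w • μ = μ' → Δ.length v ≤ Δ.length w

/-- The ordering `μ ≤_∅ lam` on `P`: here `μd`, `lamd` are the dominant weights in the `W`-orbits of
`μ`, `lam`, and `v`, `u` are the shortest elements of `W` with `v μd = μ`, `u lamd = lam`.
One demands `lamd - μd ∈ Q⁺` and, if `μd = lamd`, that `v ≤_W u`. -/
def weightLE {R : RootPairing ι ℝ M N} [R.IsCrystallographic] (Δ : SimpleSystem R)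
    (μ lam : weightLattice R) : Prop :=
  ∃ μd ∈ dominant Δ, ∃ lamd ∈ dominant Δ, ∃ v u : R.weylGroup,
    IsShortest Δ v μd μ ∧ IsShortest Δ u lamd lam ∧
    (lamd : M) - (μd : M) ∈ Δ.posCone ∧ (μd = lamd → Δ.bruhatLE v u)

lemma indexEquiv_injective (R : RootPairing ι ℝ M N) [R.IsRootSystem] :
    Function.Injective fun w : R.weylGroup => (w : R.Aut).indexEquiv := by
  intro v w h
  have hr : ∀ i, v • R.root i = w • R.root i := fun i => by
    change (v : R.Aut) • R.root i = (w : R.Aut) • R.root i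
    rw [← Equiv.root_indexEquiv_eq_smul, ← Equiv.root_indexEquiv_eq_smul]
    exact congrArg (fun e : ι ≃ ι => R.root (e i)) h
  apply Subtype.ext
  apply Equiv.weightHom_injective R
  apply LinearEquiv.toLinearMap_injective
  apply LinearMap.ext_on_range (v := R.root) (IsRootSystem.span_root_eq_top (P := R))
  exact hr

instance finite_weylGroup (R : RootPairing ι ℝ M N) [R.IsRootSystem] [Finite ι] :
    Finite R.weylGroup :=
  Finite.of_injective _ (indexEquiv_injective R)

end RootData

section LaurentPolynomials

variable {ι M N : Type*} [AddCommGroup M] [Module ℝ M] [AddCommGroup N] [Module ℝ N]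

/-- The group algebra `ℂ[P]` of Laurent polynomials. -/
abbrev Laurent (R : RootPairing ι ℝ M N) : Type _ := AddMonoidAlgebra ℂ (weightLattice R)

/-- The monomial `e^μ`. -/
def mono {R : RootPairing ι ℝ M N} (μ : weightLattice R) : Laurent R := AddMonoidAlgebra.single μ 1

/-- The action of `w ∈ W` on `ℂ[P]`, `w e^μ = e^{w μ}`. -/
def weylAct (R : RootPairing ι ℝ M N) [R.IsCrystallographic] (w : R.weylGroup) :
    Laurent R →ₗ[ℂ] Laurent R :=
  AddMonoidAlgebra.mapDomainLinearMap ℂ ℂ fun μ => w • μ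

/-- The space `ℂ[P]^{W_I}` of `W_I`-invariants. -/
def invariants (R : RootPairing ι ℝ M N) [R.IsCrystallographic] (I : Set ι) :
    Submodule ℂ (Laurent R) :=
  ⨅ w ∈ parabolic R I, LinearMap.eqLocus (weylAct R w) LinearMap.id

/-- The orbit `W_I μ`. -/
def orbitI (R : RootPairing ι ℝ M N) [R.IsCrystallographic] (I : Set ι) (μ : weightLattice R) :
    Set (weightLattice R) :=
  {ν | ∃ w ∈ parabolic R I, w • μ = ν}

lemma orbitI_finite (R : RootPairing ι ℝ M N) [R.IsCrystallographic] [R.IsRootSystem] [Finite ι]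
    (I : Set ι) (μ : weightLattice R) : (orbitI R I μ).Finite :=
  (Set.finite_range fun w : R.weylGroup => w • μ).subset fun _ ⟨w, _, h⟩ => ⟨w, h⟩

/-- The orbit sum `m_I(μ) = ∑_{ν ∈ W_I μ} e^ν`. -/
def orbitSum (R : RootPairing ι ℝ M N) [R.IsCrystallographic] [R.IsRootSystem] [Finite ι]
    (I : Set ι) (μ : weightLattice R) : Laurent R :=
  ∑ ν ∈ (orbitI_finite R I μ).toFinset, mono ν

/-- The linear map `ℂ[P] → ℂ[P]` with prescribed values on the monomials. -/
def linExt (R : RootPairing ι ℝ M N) (g : weightLattice R → Laurent R) :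
    Laurent R →ₗ[ℂ] Laurent R :=
  Finsupp.linearCombination ℂ g ∘ₗ (AddMonoidAlgebra.coeffLinearEquiv ℂ).toLinearMap

lemma linExt_mono (R : RootPairing ι ℝ M N) (g : weightLattice R → Laurent R)
    (μ : weightLattice R) : linExt R g (mono μ) = g μ := by
  simp [linExt, mono]

end LaurentPolynomials

section Torus

variable {ι M N : Type*} [AddCommGroup M] [Module ℝ M] [NormedAddCommGroup N] [NormedSpace ℝ N]

/-- The lattice `2π Q^∨`, where `Q^∨` is the coroot lattice. -/
def torusLattice (R : RootPairing ι ℝ M N) : AddSubgroup N :=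
  AddSubgroup.closure (Set.range fun i => (2 * Real.pi) • R.coroot i)

/-- The compact torus `i𝔞 / 2πi Q^∨`, written as `𝔞 / 2π Q^∨`. -/
def Torus (R : RootPairing ι ℝ M N) : Type _ := N ⧸ torusLattice R

instance (R : RootPairing ι ℝ M N) : AddCommGroup (Torus R) :=
  inferInstanceAs (AddCommGroup (N ⧸ torusLattice R))

instance (R : RootPairing ι ℝ M N) : TopologicalSpace (Torus R) :=
  inferInstanceAs (TopologicalSpace (N ⧸ torusLattice R))

instance (R : RootPairing ι ℝ M N) : IsTopologicalAddGroup (Torus R) :=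
  inferInstanceAs (IsTopologicalAddGroup (N ⧸ torusLattice R))

instance (R : RootPairing ι ℝ M N) [FiniteDimensional ℝ N] : LocallyCompactSpace (Torus R) :=
  haveI : ProperSpace N := FiniteDimensional.proper_real N
  inferInstanceAs (LocallyCompactSpace (N ⧸ torusLattice R))

instance (R : RootPairing ι ℝ M N) : MeasurableSpace (Torus R) := borel _

instance (R : RootPairing ι ℝ M N) : BorelSpace (Torus R) := ⟨rfl⟩

/-- The character of the torus attached to a weight, `t = i x ↦ exp(i ⟨μ, x⟩)`. -/
def torusChar (R : RootPairing ι ℝ M N) (μ : weightLattice R) : Torus R →+ Additive Circle :=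
  QuotientAddGroup.lift (torusLattice R)
    (Circle.expHom.comp (R.toLinearMap (μ : M)).toAddMonoidHom) <| by
      rw [torusLattice, AddSubgroup.closure_le]
      rintro _ ⟨i, rfl⟩
      have h : R.toLinearMap (μ : M) ((2 * Real.pi) • R.coroot i)
          = pairInt R μ i * (2 * Real.pi) := by
        rw [map_smul, smul_eq_mul, mul_comm, ← pairInt_spec]; rfl
      change Additive.ofMul (Circle.exp (R.toLinearMap (μ : M) ((2 * Real.pi) • R.coroot i))) = 0
      rw [h, Circle.exp_int_mul_two_pi]
      rfl

/-- The function `e^μ` on the torus. -/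
def expFun (R : RootPairing ι ℝ M N) (μ : weightLattice R) (t : Torus R) : ℂ :=
  ((torusChar R μ t).toMul : Circle)

/-- The function on the torus defined by a Laurent polynomial. -/
def evalTorus {R : RootPairing ι ℝ M N} (f : Laurent R) (t : Torus R) : ℂ :=
  f.coeff.sum fun μ c => c * expFun R μ t

/-- The weight function `δ_k = ∏_{α ∈ R} |e^{α/2} - e^{-α/2}|^{k_α}`, the product being over all
roots. Note that `|e^{α/2} - e^{-α/2}| = |1 - e^{-α}|` on the torus. -/
def weightFun (R : RootPairing ι ℝ M N) [R.IsCrystallographic] [Fintype ι] (k : ι → ℝ)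
    (t : Torus R) : ℝ :=
  ∏ i, ‖1 - expFun R (-rootWt R i) t‖ ^ k i

/-- The Hermitian inner product `(f, g)_k = ∫ conj(f(t)) g(t) δ_k(t) dt`, with `dt` a Haar measure
of the torus. -/
def innerK (R : RootPairing ι ℝ M N) [R.IsCrystallographic] [Fintype ι] [FiniteDimensional ℝ N]
    (k : ι → ℝ) (f g : Laurent R) : ℂ :=
  ∫ t : Torus R, (starRingEnd ℂ) (evalTorus f t) * evalTorus g t * (weightFun R k t : ℂ)
    ∂MeasureTheory.Measure.addHaar

/-- `p` is the Jacobi polynomial `p_I(lam, k)`: it is of the form `∑_{μ ≤_I lam} c_μ m_I(μ)` with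
`c_lam = 1`, and it is orthogonal to `m_I(μ)` for all `μ <_I lam`. -/
def IsJacobi {R : RootPairing ι ℝ M N} [R.IsCrystallographic] [R.IsRootSystem] [Fintype ι]
    [FiniteDimensional ℝ N] (Δ : SimpleSystem R) (I : Set ι) (k : ι → ℝ)
    (lam : dominantI Δ I) (p : Laurent R) : Prop :=
  (∃ c : dominantI Δ I →₀ ℂ, c lam = 1 ∧ (∀ μ, c μ ≠ 0 → weightLE Δ μ.1 lam.1) ∧
    p = c.sum fun μ a => a • orbitSum R I μ.1) ∧
  ∀ μ : dominantI Δ I, weightLE Δ μ.1 lam.1 → μ ≠ lam → innerK R k p (orbitSum R I μ.1) = 0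

end Torus

section Cherednik

variable {ι M N : Type*} [AddCommGroup M] [Module ℝ M] [AddCommGroup N] [Module ℝ N]

/-- The complex linear extension of `m ∈ 𝔞*` to `𝔥 = ℂ ⊗ 𝔞`. -/
def evalC (R : RootPairing ι ℝ M N) (m : M) : ℂ ⊗[ℝ] N →ₗ[ℂ] ℂ :=
  LinearMap.liftBaseChange ℂ (Complex.ofRealCLM.toLinearMap ∘ₗ R.toLinearMap m)

/-- The value `q(m)` at `m ∈ 𝔞*` of `q ∈ S(𝔥)`, regarded as a polynomial on the dual of `𝔥`. -/
def polyEval (R : RootPairing ι ℝ M N) (m : M) : SymmetricAlgebra ℂ (ℂ ⊗[ℝ] N) →ₐ[ℂ] ℂ :=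
  SymmetricAlgebra.lift (evalC R m)

/-- The action of `w ∈ W` on `S(𝔥)`; it extends the action on `𝔞` with
`⟨m, w x⟩ = ⟨w⁻¹ m, x⟩`. -/
def polyAct (R : RootPairing ι ℝ M N) (w : R.weylGroup) :
    SymmetricAlgebra ℂ (ℂ ⊗[ℝ] N) →ₐ[ℂ] SymmetricAlgebra ℂ (ℂ ⊗[ℝ] N) :=
  SymmetricAlgebra.lift (SymmetricAlgebra.ι ℂ (ℂ ⊗[ℝ] N) ∘ₗ
    LinearMap.baseChange ℂ ((w⁻¹ : R.weylGroup) : R.Aut).toHom.coweightMap)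

/-- The invariants `S(𝔥)^{W_I}`. -/
def polyInvariants (R : RootPairing ι ℝ M N) (I : Set ι) :
    Set (SymmetricAlgebra ℂ (ℂ ⊗[ℝ] N)) :=
  {q | ∀ w ∈ parabolic R I, polyAct R w q = q}

/-- `ρ(k) = ½ ∑_{α > 0} k_α α`. -/
def rho {R : RootPairing ι ℝ M N} [Fintype ι] (Δ : SimpleSystem R) (k : ι → ℝ) : M :=
  (1 / 2 : ℝ) • ∑ i, open Classical in if Δ.IsPos i then k i • R.root i else 0

/-- The operator `(1 - e^{-α})⁻¹ (1 - s_α)` on `ℂ[P]`, given on a monomial `e^μ` with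
`n = ⟨μ, α^∨⟩` by `∑_{0 ≤ j < n} e^{μ - jα}` if `n ≥ 0` and by `-∑_{1 ≤ j ≤ -n} e^{μ + jα}`
if `n < 0`. -/
def divDiff (R : RootPairing ι ℝ M N) [R.IsCrystallographic] (i : ι) :
    Laurent R →ₗ[ℂ] Laurent R :=
  linExt R fun μ =>
    ∑ j ∈ Finset.range (pairInt R μ i).toNat, mono (μ - j • rootWt R i) -
    ∑ j ∈ Finset.range (-pairInt R μ i).toNat, mono (μ + (j + 1) • rootWt R i)

lemma mono_mul_mono {R : RootPairing ι ℝ M N} (μ ν : weightLattice R) :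
    mono μ * mono ν = mono (μ + ν) := by
  simp [mono, AddMonoidAlgebra.single_mul_single]

lemma divDiff_spec (R : RootPairing ι ℝ M N) [R.IsCrystallographic] (i : ι) (f : Laurent R) :
    (1 - mono (-rootWt R i)) * divDiff R i f = f - weylAct R (weylGroup.ofIdx R i) f := by
  have key : LinearMap.mulLeft ℂ (1 - mono (-rootWt R i)) ∘ₗ divDiff R i =
      LinearMap.id - weylAct R (weylGroup.ofIdx R i) := by
    refine AddMonoidAlgebra.lhom_ext' fun μ => LinearMap.ext_ring ?_
    change (1 - mono (-rootWt R i)) * divDiff R i (mono μ) =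
      mono μ - weylAct R (weylGroup.ofIdx R i) (mono μ)
    have hs : weylAct R (weylGroup.ofIdx R i) (mono μ) = mono (weylGroup.ofIdx R i • μ) := by
      simp [weylAct, mono]
    have hw : weylGroup.ofIdx R i • μ = μ - pairInt R μ i • rootWt R i := by
      apply Subtype.ext
      change R.reflection i (μ : M) = (μ : M) - pairInt R μ i • R.root i
      rw [R.reflection_apply, pairInt_spec, Int.cast_smul_eq_zsmul]
    rw [hs, hw, divDiff, linExt_mono, mul_sub, Finset.mul_sum, Finset.mul_sum]
    simp only [sub_mul, one_mul, mono_mul_mono]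
    have e1 : ∀ j : ℕ, -rootWt R i + (μ - j • rootWt R i) = μ - (j + 1) • rootWt R i := fun j => by
      rw [succ_nsmul]; abel
    have e2 : ∀ j : ℕ, -rootWt R i + (μ + (j + 1) • rootWt R i) = μ + j • rootWt R i := fun j => by
      rw [succ_nsmul]; abel
    simp only [e1, e2]
    rw [Finset.sum_range_sub' (fun j : ℕ => mono (μ - j • rootWt R i)),
      Finset.sum_range_sub (fun j : ℕ => mono (μ + j • rootWt R i))]
    rcases le_total 0 (pairInt R μ i) with h | h
    · obtain ⟨n, hn⟩ := Int.eq_ofNat_of_zero_le h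
      simp [hn]
    · obtain ⟨n, hn⟩ := Int.eq_ofNat_of_zero_le (neg_nonneg.mpr h)
      have hn' : pairInt R μ i = -(n : ℤ) := by omega
      simp [hn']
  exact LinearMap.congr_fun key f

/-- The derivation `∂_ξ e^μ = μ(ξ) e^μ`. -/
def partialXi (R : RootPairing ι ℝ M N) (ξ : ℂ ⊗[ℝ] N) : Laurent R →ₗ[ℂ] Laurent R :=
  linExt R fun μ => evalC R (μ : M) ξ • mono μ

/-- The Cherednik operator
`D_ξ(k) = ∂_ξ + ∑_{α > 0} k_α α(ξ) (1 - e^{-α})⁻¹ (1 - s_α) - ρ(k)(ξ)`. -/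
def cherednik {R : RootPairing ι ℝ M N} [R.IsCrystallographic] [Fintype ι] (Δ : SimpleSystem R)
    (k : ι → ℝ) (ξ : ℂ ⊗[ℝ] N) : Laurent R →ₗ[ℂ] Laurent R :=
  partialXi R ξ + (∑ i, open Classical in
    if Δ.IsPos i then ((k i : ℂ) * evalC R (R.root i) ξ) • divDiff R i else 0)
    - evalC R (rho Δ k) ξ • LinearMap.id

/-- The spectral parameter `μ̃ = μ + ½ ∑_{α > 0} k_α ε(⟨μ, α^∨⟩) α`, where `ε(x)` is the sign of `x`
if `x ≠ 0` and `ε(0) = -1`. -/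
def spectral {R : RootPairing ι ℝ M N} [Fintype ι] (Δ : SimpleSystem R) (k : ι → ℝ)
    (μ : weightLattice R) : M :=
  (μ : M) + (1 / 2 : ℝ) • ∑ i, open Classical in if Δ.IsPos i then
    (k i * if 0 < pairInt R μ i then 1 else -1) • R.root i else 0

end Cherednik

end ParabolicJacobi

end

/-!
The parabolic Jacobi polynomials are treated as symmetric combinations of nonsymmetric ones, and
both are Gram-Schmidt families for the form `(·,·)_k` (`IsGramSchmidt`): the nonsymmetric
polynomials `E_μ` come from the monomials `e^μ` and the ordering `≤_∅` of the weight lattice, and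
the `p_I(lam)` come from the orbit sums `m_I(lam)`. Both orderings have finite lower sets
(`finite_setOf_weightLE`) and the form is positive definite (`isAnisotropic_formK`), so both
families exist and are unique. The real content is orthogonality for labels that are not comparable.

*Spectral theory.* The Cherednik operators are triangular with respect to the monomials, with
diagonal entries the spectral parameters (`cherednik_mono_sub_mem`); the point is that the weights
inside an `α`-string are smaller than its ends (`weightLE_string`, `weightLE_reflection`). For real
vectors the operators are symmetric (`formK_cherednik`). A symmetric triangular operator is diagonal
in the Gram-Schmidt family, whence `D_ξ E_μ = μ̃(ξ) E_μ`. Since `μ ↦ μ̃` is injective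
(`spectral_injective`), the `E_μ` are pairwise orthogonal. Having a common eigenbasis, the
operators commute, and `q(D)` is the operator which is diagonal in this basis with eigenvalues
`q(μ̃)` (`exists_dunklHom`).

*Symmetry.* The formal adjoint of `∂_ξ` involves the logarithmic derivative of the weight function,
which is unbounded near the zeros of that function. Integration by parts is therefore carried out
for the smooth weight `∏_α (|1 - e^{-α}|² + ε)^{k_α/2}`; after symmetrising each logarithmic
derivative by the reflection `s_α` the integrands stay bounded, and `ε → 0` gives the identity
`haarInt_partialXi`. The additional terms in it cancel the failure of the divided differences to be
symmetric (`haarInt_divDiff`).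

*Parabolic polynomials.* Passing to the `I`-dominant weight in a `W_I`-orbit is monotone
(`weightLE_domRepI`), because minimal representatives of double cosets respect the Bruhat order.
By invariance `p_I(lam)` is orthogonal to every `e^τ` for which the `I`-dominant weight in `W_I τ`
is smaller than `lam`, so `p_I(lam)` is a combination of the `E_κ` with `κ ∈ W_I lam`
(`parabolic_mem_span_nonsymmetric`). Orthogonality follows, since distinct labels have disjoint
orbits. The spectral parameters of the `κ ∈ W_I lam` are in the `W_I`-orbit of that of `lam`
(`exists_spectral_smul`), so an invariant `q` takes the same value at all of them, and `p_I(lam)`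
is an eigenvector of `q(D)`.

*Separation.* The spectral parameter of `μ` is the image of `μ₊ + ρ(k)` under a longest element that
maps `μ₊` to `μ` (`spectral_eq`). As `ρ(k)` is dominant, spectral parameters are conjugate under
some `w` only if `w` maps the one weight to the other (`smul_eq_of_smul_spectral_eq`). Distinct
`I`-dominant weights are not conjugate under `W_I`, and points in distinct orbits of a finite group
are separated by an invariant polynomial (`exists_polyInvariants_polyEval_ne`).
-/

namespace ParabolicJacobi

/-! ### Roots and the Weyl group -/

section WeylGroup

variable {ι M N : Type*} [AddCommGroup M] [Module ℝ M] [AddCommGroup N] [Module ℝ N]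
  {R : RootPairing ι ℝ M N}

open RootPairing

lemma root_smul_idx (w : R.weylGroup) (i : ι) : R.root (w • i) = w • R.root i :=
  RootPairing.Equiv.root_indexEquiv_eq_smul R i (w : R.Aut)

lemma coroot'_smul_smul (w : R.weylGroup) (i : ι) (m : M) :
    R.coroot' (w • i) (w • m) = R.coroot' i m := by
  obtain ⟨w, hw⟩ := w
  change R.coroot' (w • i) (w • m) = _
  induction hw using weylGroup.induction generalizing i m with
  | mem j =>
    change R.coroot' (R.reflectionPerm j i) (R.reflection j m) = _
    rw [coroot'_reflection, reflectionPerm_self]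
  | one => rfl
  | mul x y _ _ hx hy => rw [mul_smul, mul_smul, hx, hy]

lemma coroot'_smul_right (w : R.weylGroup) (i : ι) (m : M) :
    R.coroot' i (w • m) = R.coroot' (w⁻¹ • i) m := by
  rw [← coroot'_smul_smul w (w⁻¹ • i), smul_inv_smul]

lemma weyl_smul_add (w : R.weylGroup) (x y : M) : w • (x + y) = w • x + w • y :=
  smul_add (w : R.Aut) x y

lemma weyl_smul_sub (w : R.weylGroup) (x y : M) : w • (x - y) = w • x - w • y :=
  smul_sub (w : R.Aut) x y

lemma weyl_smul_neg (w : R.weylGroup) (x : M) : w • (-x) = -(w • x) :=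
  smul_neg (w : R.Aut) x

lemma weyl_smul_real (w : R.weylGroup) (c : ℝ) (x : M) : w • (c • x) = c • (w • x) :=
  smul_comm (w : R.Aut) c x

lemma ofIdx_smul_vec (i : ι) (m : M) :
    weylGroup.ofIdx R i • m = m - R.coroot' i m • R.root i := rfl

lemma weyl_ext {v w : R.weylGroup} (h : ∀ m : M, v • m = w • m) : v = w :=
  Subtype.ext (Equiv.weightHom_injective R (LinearEquiv.ext h))

lemma ofIdx_smul_idx (w : R.weylGroup) (i : ι) :
    weylGroup.ofIdx R (w • i) = w * weylGroup.ofIdx R i * w⁻¹ := by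
  refine weyl_ext fun m => ?_
  rw [mul_smul, mul_smul, ofIdx_smul_vec, ofIdx_smul_vec, weyl_smul_sub, smul_inv_smul,
    weyl_smul_real, root_smul_idx, coroot'_smul_right, inv_inv]

lemma ofIdx_smul_idx' (w : R.weylGroup) (i : ι) :
    weylGroup.ofIdx R (w • i) * w = w * weylGroup.ofIdx R i := by
  rw [ofIdx_smul_idx]; group

@[simp] lemma ofIdx_mul_self (i : ι) : weylGroup.ofIdx R i * weylGroup.ofIdx R i = 1 := by
  refine weyl_ext fun m => ?_
  rw [mul_smul, one_smul]
  exact R.reflection_same i m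

@[simp] lemma ofIdx_inv (i : ι) : (weylGroup.ofIdx R i)⁻¹ = weylGroup.ofIdx R i :=
  inv_eq_of_mul_eq_one_right (ofIdx_mul_self i)

@[simp] lemma ofIdx_mul_cancel_left (i : ι) (w : R.weylGroup) :
    weylGroup.ofIdx R i * (weylGroup.ofIdx R i * w) = w := by
  rw [← mul_assoc, ofIdx_mul_self, one_mul]

@[simp] lemma ofIdx_mul_cancel_right (i : ι) (w : R.weylGroup) :
    w * weylGroup.ofIdx R i * weylGroup.ofIdx R i = w := by
  rw [mul_assoc, ofIdx_mul_self, mul_one]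

/-- The index of the root `-α`, as the image of that of `α` under its own reflection. -/
noncomputable def negIdx (R : RootPairing ι ℝ M N) (i : ι) : ι := weylGroup.ofIdx R i • i

@[simp] lemma root_negIdx (i : ι) : R.root (negIdx R i) = -R.root i := by
  rw [negIdx, root_smul_idx]; exact R.reflection_apply_self i

@[simp] lemma coroot'_negIdx (i : ι) (m : M) : R.coroot' (negIdx R i) m = -R.coroot' i m := by
  rw [negIdx, ← inv_inv (weylGroup.ofIdx R i), ← coroot'_smul_right, ofIdx_inv, ofIdx_smul_vec,
    map_sub, map_smul]
  simp
  ring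

@[simp] lemma negIdx_negIdx (i : ι) : negIdx R (negIdx R i) = i :=
  R.root.injective (by simp)

lemma smul_negIdx (w : R.weylGroup) (i : ι) : w • negIdx R i = negIdx R (w • i) :=
  R.root.injective (by rw [root_smul_idx, root_negIdx, root_negIdx, root_smul_idx, weyl_smul_neg])

@[simp] lemma ofIdx_negIdx (i : ι) : weylGroup.ofIdx R (negIdx R i) = weylGroup.ofIdx R i := by
  rw [negIdx, ofIdx_smul_idx]; simp

lemma ofIdx_ne_one (i : ι) : weylGroup.ofIdx R i ≠ 1 := by
  intro h
  have h1 : R.root (negIdx R i) = R.root i := by rw [negIdx, h, one_smul]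
  rw [root_negIdx] at h1
  have := congrArg (R.coroot' i) h1
  simp at this
  norm_num at this

lemma ofIdx_smul_eq_self {i : ι} {m : M} (h : R.coroot' i m = 0) : weylGroup.ofIdx R i • m = m := by
  rw [ofIdx_smul_vec, h, zero_smul, sub_zero]

variable (R) in
/-- Proportional roots, which occur if the root system is not reduced, have the same reflection. -/
lemma ofIdx_eq_of_root_eq_smul [Finite ι] {i j : ι} {c : ℝ} (h : R.root j = c • R.root i) :
    weylGroup.ofIdx R j = weylGroup.ofIdx R i := by
  have : IsAddTorsionFree N := .of_isTorsionFree ℝ N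
  have hc := RootPairing.smul_coroot_eq_of_root_eq_smul i j c h
  refine weyl_ext fun m => ?_
  rw [ofIdx_smul_vec, ofIdx_smul_vec, h, smul_smul]
  congr 2
  change R.toLinearMap m (R.coroot j) * c = R.toLinearMap m (R.coroot i)
  rw [← hc, map_smul, smul_eq_mul, mul_comm]

variable (Δ : SimpleSystem R)

lemma root_mem_posCone {i : ι} (hi : i ∈ Δ.support) : R.root i ∈ Δ.posCone :=
  AddSubmonoid.subset_closure ⟨i, hi, rfl⟩

lemma isPos_of_mem {i : ι} (hi : i ∈ Δ.support) : Δ.IsPos i := root_mem_posCone Δ hi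

section Basis

variable [R.IsRootSystem]

lemma span_simple : Submodule.span ℝ (Set.range fun i : Δ.support => R.root i) = ⊤ := by
  rw [eq_top_iff, ← IsRootSystem.span_root_eq_top (P := R), Submodule.span_le]
  have h : ∀ x ∈ Δ.posCone, x ∈ Submodule.span ℝ (Set.range fun i : Δ.support => R.root i) := by
    intro x hx
    induction hx using AddSubmonoid.closure_induction with
    | mem x hx => obtain ⟨i, hi, rfl⟩ := hx; exact Submodule.subset_span ⟨⟨i, hi⟩, rfl⟩
    | zero => exact zero_mem _
    | add x y _ _ hx hy => exact add_mem hx hy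
  rintro _ ⟨i, rfl⟩
  rcases Δ.root_mem_or_neg_mem i with hi | hi
  · exact h _ hi
  · simpa using neg_mem (h _ hi)

/-- The simple roots as a basis. -/
noncomputable def simpleBasis : Module.Basis Δ.support ℝ M :=
  Module.Basis.mk (v := fun i : Δ.support => R.root i) Δ.linearIndepOn_root (span_simple Δ).ge

lemma simpleBasis_apply (i : Δ.support) : simpleBasis Δ i = R.root i := by
  exact Module.Basis.mk_apply _ _ i

lemma coord_nonneg {x : M} (hx : x ∈ Δ.posCone) (j : Δ.support) :
    0 ≤ (simpleBasis Δ).repr x j := by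
  induction hx using AddSubmonoid.closure_induction with
  | mem x hx =>
    obtain ⟨i, hi, rfl⟩ := hx
    rw [← simpleBasis_apply Δ ⟨i, hi⟩, Module.Basis.repr_self]
    exact Finsupp.single_nonneg.mpr zero_le_one j
  | zero => simp
  | add x y _ _ hx hy => simpa using add_nonneg hx hy

/-- The height, i.e. the linear form with value `1` on each simple root. -/
noncomputable def height : M →ₗ[ℝ] ℝ := (simpleBasis Δ).constr ℝ fun _ => (1 : ℝ)

lemma height_root {i : ι} (hi : i ∈ Δ.support) : height Δ (R.root i) = 1 := by
  rw [← simpleBasis_apply Δ ⟨i, hi⟩, height, Module.Basis.constr_basis]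

lemma height_eq (x : M) : height Δ x = ∑ j, (simpleBasis Δ).repr x j := by
  rw [height, Module.Basis.constr_apply_fintype]; simp

lemma eq_zero_of_height_eq_zero {x : M} (hx : x ∈ Δ.posCone) (h : height Δ x = 0) : x = 0 := by
  rw [height_eq, Finset.sum_eq_zero_iff_of_nonneg fun j _ => coord_nonneg Δ hx j] at h
  refine (simpleBasis Δ).ext_elem fun j => ?_
  simpa using h j (Finset.mem_univ _)

lemma height_nonneg {x : M} (hx : x ∈ Δ.posCone) : 0 ≤ height Δ x := by
  rw [height_eq]; exact Finset.sum_nonneg fun j _ => coord_nonneg Δ hx j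

lemma posCone_antisymm {x : M} (hx : x ∈ Δ.posCone) (hx' : -x ∈ Δ.posCone) : x = 0 := by
  refine eq_zero_of_height_eq_zero Δ hx (le_antisymm ?_ (height_nonneg Δ hx))
  simpa using height_nonneg Δ hx'

variable {Δ}

lemma isPos_negIdx {i : ι} : Δ.IsPos (negIdx R i) ↔ ¬ Δ.IsPos i := by
  unfold SimpleSystem.IsPos
  rw [root_negIdx]
  constructor
  · intro h h'
    exact R.ne_zero i (posCone_antisymm Δ h' h)
  · exact (Δ.root_mem_or_neg_mem i).resolve_left

lemma height_pos {i : ι} (hi : Δ.IsPos i) : 0 < height Δ (R.root i) :=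
  lt_of_le_of_ne (height_nonneg Δ hi) fun h => R.ne_zero i (eq_zero_of_height_eq_zero Δ hi h.symm)

/-- A simple reflection permutes the positive roots that are not proportional to the simple
root. -/
lemma isPos_simple_smul [Finite ι] {i j : ι} (hi : i ∈ Δ.support) (hj : Δ.IsPos j)
    (hij : weylGroup.ofIdx R j ≠ weylGroup.ofIdx R i) : Δ.IsPos (weylGroup.ofIdx R i • j) := by
  have hex : ∃ l : Δ.support, l ≠ ⟨i, hi⟩ ∧ (simpleBasis Δ).repr (R.root j) l ≠ 0 := by
    by_contra! hcon
    refine hij (ofIdx_eq_of_root_eq_smul R (c := (simpleBasis Δ).repr (R.root j) ⟨i, hi⟩) ?_)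
    refine (simpleBasis Δ).ext_elem fun l => ?_
    rw [← simpleBasis_apply Δ ⟨i, hi⟩, map_smul, Module.Basis.repr_self]
    by_cases hl : l = ⟨i, hi⟩
    · subst hl; simp
    · simp [hcon l hl, hl]
  obtain ⟨l, hl, hl0⟩ := hex
  -- the reflection leaves the coefficient of another simple root unchanged
  by_contra hneg
  rw [← isPos_negIdx] at hneg
  have h1 := coord_nonneg Δ hneg l
  have h2 := coord_nonneg Δ hj l
  rw [root_negIdx, root_smul_idx, ofIdx_smul_vec, ← simpleBasis_apply Δ ⟨i, hi⟩, map_neg, map_sub,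
    map_smul, Module.Basis.repr_self] at h1
  simp [Ne.symm hl] at h1
  exact hl0 (le_antisymm h1 h2)

/-- Induction on the height of positive roots: unless a positive root has the same reflection as a
simple root, some simple reflection maps it to a positive root of smaller height. -/
lemma isPos_induction [Finite ι] [R.IsCrystallographic] {p : ι → Prop}
    (simple : ∀ j, Δ.IsPos j → ∀ i ∈ Δ.support, weylGroup.ofIdx R j = weylGroup.ofIdx R i → p j)
    (step : ∀ j, Δ.IsPos j → ∀ i ∈ Δ.support, 0 < R.coroot' j (R.root i) →
      Δ.IsPos (weylGroup.ofIdx R i • j) → p (weylGroup.ofIdx R i • j) → p j)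
    (j : ι) (hj : Δ.IsPos j) : p j := by
  have wf : WellFounded fun a b : ι => height Δ (R.root a) < height Δ (R.root b) :=
    @Finite.wellFounded_of_trans_of_irrefl _ _ _ ⟨fun _ _ _ h h' => lt_trans h h'⟩
      ⟨fun _ => lt_irrefl _⟩
  induction j using wf.induction with
  | _ j ih =>
    -- otherwise the coroot of `j` would not be positive on the root `j`, a sum of simple roots
    obtain ⟨i, hi⟩ : ∃ i : Δ.support, 0 < R.coroot' j (R.root i) := by
      by_contra! hcon
      have h2 : R.coroot' j (R.root j) = 2 := by simp
      rw [← (simpleBasis Δ).sum_repr (R.root j), map_sum] at h2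
      have : ∑ l, R.coroot' j ((simpleBasis Δ).repr (R.root j) l • simpleBasis Δ l) ≤ 0 := by
        refine Finset.sum_nonpos fun l _ => ?_
        rw [map_smul, smul_eq_mul, simpleBasis_apply]
        exact mul_nonpos_of_nonneg_of_nonpos (coord_nonneg Δ hj l) (hcon l)
      linarith
    by_cases hij : weylGroup.ofIdx R j = weylGroup.ofIdx R i
    · exact simple j hj i i.2 hij
    have hpos := isPos_simple_smul i.2 hj hij
    refine step j hj i i.2 hi hpos (ih _ ?_ hpos)
    rw [root_smul_idx, ofIdx_smul_vec, map_sub, map_smul, height_root Δ i.2]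
    have : 0 < R.coroot' (i : ι) (R.root j) := by
      have h := RootPairing.zero_lt_pairingIn_iff' (P := R) (S := ℝ) (i := i) (j := j)
      simp only [R.root_coroot'_eq_pairing] at hi ⊢
      simp only [← R.algebraMap_pairingIn ℝ, Algebra.algebraMap_self, RingHom.id_apply] at hi ⊢
      exact h.mp hi
    simpa using this

end Basis

end WeylGroup

/-! ### Words in simple reflections and the exchange condition -/

section Words

variable {ι M N : Type*} [AddCommGroup M] [Module ℝ M] [AddCommGroup N] [Module ℝ N]
  {R : RootPairing ι ℝ M N}

open RootPairing

/-- The product of the reflections given by a word of indices. -/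
noncomputable def wordProd (R : RootPairing ι ℝ M N) (l : List ι) : R.weylGroup :=
  (l.map (weylGroup.ofIdx R)).prod

@[simp] lemma wordProd_nil : wordProd R [] = 1 := rfl

@[simp] lemma wordProd_cons (i : ι) (l : List ι) :
    wordProd R (i :: l) = weylGroup.ofIdx R i * wordProd R l := by
  simp [wordProd]

lemma wordProd_append (l l' : List ι) : wordProd R (l ++ l') = wordProd R l * wordProd R l' := by
  simp [wordProd]

lemma exists_word_of_mem_parabolic {I : Set ι} {w : R.weylGroup} (hw : w ∈ parabolic R I) :
    ∃ l : List ι, (∀ i ∈ l, i ∈ I) ∧ wordProd R l = w := by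
  induction hw using Subgroup.closure_induction'' with
  | one => exact ⟨[], by simp⟩
  | mem x hx => obtain ⟨i, hi, rfl⟩ := hx; exact ⟨[i], by simpa using hi⟩
  | inv_mem x hx => obtain ⟨i, hi, rfl⟩ := hx; exact ⟨[i], by simpa using hi⟩
  | mul x y _ _ hx hy =>
    obtain ⟨l, hl, rfl⟩ := hx
    obtain ⟨l', hl', rfl⟩ := hy
    refine ⟨l ++ l', ?_, wordProd_append l l'⟩
    simp only [List.mem_append]
    rintro i (hi | hi)
    exacts [hl i hi, hl' i hi]

lemma ofIdx_mem_parabolic {I : Set ι} {i : ι} (hi : i ∈ I) :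
    weylGroup.ofIdx R i ∈ parabolic R I := Subgroup.subset_closure ⟨i, hi, rfl⟩

lemma wordProd_mem_parabolic {I : Set ι} {l : List ι} (hl : ∀ i ∈ l, i ∈ I) :
    wordProd R l ∈ parabolic R I := by
  refine list_prod_mem fun x hx => ?_
  obtain ⟨i, hi, rfl⟩ := List.mem_map.mp hx
  exact ofIdx_mem_parabolic (hl i hi)

variable {Δ : SimpleSystem R}

lemma length_wordProd_le {l : List ι} (hl : ∀ i ∈ l, i ∈ Δ.support) :
    Δ.length (wordProd R l) ≤ l.length := Nat.sInf_le ⟨l, hl, rfl, rfl⟩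

variable [R.IsRootSystem] [Finite ι]

/-- A simple reflection changes the sign of a positive root only if it is the reflection in that
root. -/
lemma ofIdx_eq_of_not_isPos {i j : ι} (hi : i ∈ Δ.support) (hj : Δ.IsPos j)
    (h : ¬ Δ.IsPos (weylGroup.ofIdx R i • j)) : weylGroup.ofIdx R j = weylGroup.ofIdx R i :=
  not_not.mp fun h' => h (isPos_simple_smul hi hj h')

/-- The strong exchange condition: if the product of a word makes a positive root negative, then its
product with the reflection in that root is the product of a word that is shorter by one letter. -/
lemma exists_exchange {l : List ι} (hl : ∀ i ∈ l, i ∈ Δ.support) {j : ι} (hj : Δ.IsPos j)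
    (hneg : ¬ Δ.IsPos (wordProd R l • j)) :
    ∃ l' : List ι, (∀ i ∈ l', i ∈ l) ∧ l'.length + 1 = l.length ∧
      wordProd R l' = wordProd R l * weylGroup.ofIdx R j := by
  induction l with
  | nil => simp [hj] at hneg
  | cons a l ih =>
    by_cases h : Δ.IsPos (wordProd R l • j)
    · rw [wordProd_cons, mul_smul] at hneg
      have h' := ofIdx_eq_of_not_isPos (hl a (by simp)) h hneg
      refine ⟨l, fun i hi => List.mem_cons_of_mem _ hi, rfl, ?_⟩
      rw [wordProd_cons, ← h', mul_assoc, ← ofIdx_smul_idx', ofIdx_mul_cancel_left]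
    · obtain ⟨l', h1, h2, h3⟩ := ih (fun i hi => hl i (List.mem_cons_of_mem _ hi)) h
      refine ⟨a :: l', ?_, by simp [h2], by simp [h3, mul_assoc]⟩
      simp only [List.mem_cons]
      rintro i (rfl | hi)
      exacts [Or.inl rfl, Or.inr (h1 i hi)]

/-- Elements of `W_I` permute the positive roots whose reflection is not in `W_I`. -/
lemma isPos_smul_of_notMem {I : Set ι} (hI : I ⊆ Δ.support) {w : R.weylGroup}
    (hw : w ∈ parabolic R I) {j : ι} (hj : Δ.IsPos j)
    (hjI : weylGroup.ofIdx R j ∉ parabolic R I) : Δ.IsPos (w • j) := by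
  obtain ⟨l, hl, rfl⟩ := exists_word_of_mem_parabolic hw
  clear hw
  induction l with
  | nil => simpa using hj
  | cons a l ih =>
    have hl' : ∀ i ∈ l, i ∈ I := fun i hi => hl i (List.mem_cons_of_mem _ hi)
    have ha : a ∈ I := hl a (by simp)
    rw [wordProd_cons, mul_smul]
    refine isPos_simple_smul (hI ha) (ih hl') fun h => hjI ?_
    have h1 := ofIdx_smul_idx (R := R) (wordProd R l) j
    rw [h] at h1
    have hm := wordProd_mem_parabolic (R := R) hl'
    have : weylGroup.ofIdx R j = (wordProd R l)⁻¹ * weylGroup.ofIdx R a * wordProd R l := by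
      rw [h1]; group
    rw [this]
    exact mul_mem (mul_mem (inv_mem hm) (ofIdx_mem_parabolic ha)) hm

variable [R.IsCrystallographic]

/-- The Weyl group is generated by the simple reflections. -/
lemma parabolic_support (Δ : SimpleSystem R) : parabolic R (Δ.support : Set ι) = ⊤ := by
  have key : ∀ j, Δ.IsPos j → weylGroup.ofIdx R j ∈ parabolic R (Δ.support : Set ι) := by
    refine isPos_induction ?_ ?_
    · intro j _ i hi h
      rw [h]; exact ofIdx_mem_parabolic hi
    · intro j _ i hi _ _ h
      have h' := ofIdx_mem_parabolic (R := R) (I := (Δ.support : Set ι)) hi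
      rw [ofIdx_smul_idx] at h
      have := mul_mem (mul_mem h' h) h'
      simpa [mul_assoc] using this
  rw [eq_top_iff]
  rintro ⟨w, hw⟩ -
  induction hw using weylGroup.induction with
  | mem i =>
    change weylGroup.ofIdx R i ∈ _
    by_cases hi : Δ.IsPos i
    · exact key i hi
    · rw [← ofIdx_negIdx]; exact key _ (isPos_negIdx.mpr hi)
  | one => exact one_mem _
  | mul x y hx hy ihx ihy => exact mul_mem (ihx) (ihy)

lemma exists_word (Δ : SimpleSystem R) (w : R.weylGroup) :
    ∃ l : List ι, (∀ i ∈ l, i ∈ Δ.support) ∧ wordProd R l = w :=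
  exists_word_of_mem_parabolic (I := (Δ.support : Set ι)) (by rw [parabolic_support]; trivial)

lemma exists_reduced_word (Δ : SimpleSystem R) (w : R.weylGroup) :
    ∃ l : List ι, (∀ i ∈ l, i ∈ Δ.support) ∧ l.length = Δ.length w ∧ wordProd R l = w := by
  obtain ⟨l, hl, hw⟩ := exists_word Δ w
  exact Nat.sInf_mem (s := {n | ∃ l : List ι, (∀ i ∈ l, i ∈ Δ.support) ∧ l.length = n ∧
    (l.map (weylGroup.ofIdx R)).prod = w}) ⟨_, l, hl, rfl, hw⟩

lemma length_mul_ofIdx_lt {u : R.weylGroup} {j : ι} (hj : Δ.IsPos j) (h : ¬ Δ.IsPos (u • j)) :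
    Δ.length (u * weylGroup.ofIdx R j) < Δ.length u := by
  obtain ⟨l, hl, hlen, rfl⟩ := exists_reduced_word Δ u
  obtain ⟨l', h1, h2, h3⟩ := exists_exchange hl hj h
  rw [← h3]
  have := length_wordProd_le (R := R) (Δ := Δ) fun i hi => hl i (h1 i hi)
  omega

lemma lt_length_mul_ofIdx {u : R.weylGroup} {j : ι} (hj : Δ.IsPos j) (h : Δ.IsPos (u • j)) :
    Δ.length u < Δ.length (u * weylGroup.ofIdx R j) := by
  have := length_mul_ofIdx_lt (u := u * weylGroup.ofIdx R j) hj (by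
    rw [mul_smul]
    change ¬ Δ.IsPos (u • negIdx R j)
    rwa [smul_negIdx, isPos_negIdx, not_not])
  simpa [mul_assoc] using this

/-- Only the identity maps all positive roots to positive roots. -/
lemma eq_one_of_forall_isPos {w : R.weylGroup} (h : ∀ j, Δ.IsPos j → Δ.IsPos (w • j)) : w = 1 := by
  obtain ⟨l, hl, hlen, rfl⟩ := exists_reduced_word Δ w
  rcases List.eq_nil_or_concat l with rfl | ⟨l', a, rfl⟩
  · rfl
  exfalso
  have ha : a ∈ Δ.support := hl a (by simp)
  have h1 := lt_length_mul_ofIdx (isPos_of_mem Δ ha) (h a (isPos_of_mem Δ ha))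
  have h2 : wordProd R (l'.concat a) * weylGroup.ofIdx R a = wordProd R l' := by
    simp [wordProd]
  rw [h2] at h1
  have h3 := length_wordProd_le (R := R) (Δ := Δ) (l := l') fun i hi => hl i (by simp [hi])
  rw [List.length_concat] at hlen
  omega

end Words

/-! ### Dominant elements -/

section Dominance

variable {ι M N : Type*} [AddCommGroup M] [Module ℝ M] [AddCommGroup N] [Module ℝ N]
  {R : RootPairing ι ℝ M N}

open RootPairing

/-- `x ∈ 𝔞*` is dominant for all roots in `R_I⁺`. -/
def IsDomI (Δ : SimpleSystem R) (I : Set ι) (x : M) : Prop :=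
  ∀ i, Δ.IsPos i → weylGroup.ofIdx R i ∈ parabolic R I → 0 ≤ R.coroot' i x

/-- `x ∈ 𝔞*` is dominant. -/
def IsDom (Δ : SimpleSystem R) (x : M) : Prop := ∀ i, Δ.IsPos i → 0 ≤ R.coroot' i x

variable {Δ : SimpleSystem R}

lemma IsDom.add {x y : M} (hx : IsDom Δ x) (hy : IsDom Δ y) : IsDom Δ (x + y) := fun i hi => by
  rw [map_add]; exact add_nonneg (hx i hi) (hy i hi)

lemma IsDom.isDomI {x : M} (hx : IsDom Δ x) (I : Set ι) : IsDomI Δ I x := fun i hi _ => hx i hi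

lemma isDomI_zero (I : Set ι) : IsDomI Δ I (0 : M) := fun i _ _ => by simp

lemma isDomI_empty (x : M) : IsDomI Δ ∅ x := fun i _ h => by
  simp only [parabolic, Set.image_empty, Subgroup.closure_empty, Subgroup.mem_bot] at h
  exact absurd h (ofIdx_ne_one i)

variable [R.IsRootSystem] [Finite ι]

/-- The fundamental domain property of dominant elements, with control over the group element: if
`w` maps `x + y` to `x' + y`, all three being dominant, then it maps `x` to `x'`, and `x' = x`. The
proof shortens a word for `w`: a last letter that makes the word longer must fix `x` and `y`, and
one that makes it shorter can be cancelled. -/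
lemma eq_of_smul_add_eq {I : Set ι} (hI : I ⊆ Δ.support) {w : R.weylGroup} (hw : w ∈ parabolic R I)
    {x x' y : M} (hx : IsDomI Δ I x) (hx' : IsDomI Δ I x') (hy : IsDomI Δ I y)
    (h : w • (x + y) = x' + y) : x = x' ∧ w • x = x' := by
  have key : ∀ n : ℕ, ∀ l : List ι, l.length = n → (∀ i ∈ l, i ∈ I) →
      wordProd R l • (x + y) = x' + y → x = x' ∧ wordProd R l • x = x' := by
    intro n
    induction n using Nat.strong_induction_on with
    | _ n ih =>
      intro l hn hl hxy
      rcases List.eq_nil_or_concat l with rfl | ⟨l', a, rfl⟩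
      · simpa using hxy
      have ha : a ∈ I := hl a (by simp)
      have hl' : ∀ i ∈ l', i ∈ I := fun i hi => hl i (by simp [hi])
      have hlen : l'.length + 1 = n := by simpa using hn
      have hprod : wordProd R (l'.concat a) = wordProd R l' * weylGroup.ofIdx R a := by
        simp [wordProd]
      rw [hprod] at hxy ⊢
      by_cases hpos : Δ.IsPos (wordProd R l' • a)
      · set b := wordProd R l' • a with hb
        have hbI : weylGroup.ofIdx R b ∈ parabolic R I := by
          have hm := wordProd_mem_parabolic (R := R) hl'
          rw [hb, ofIdx_smul_idx]
          exact mul_mem (mul_mem hm (ofIdx_mem_parabolic ha)) (inv_mem hm)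
        have h1 : 0 ≤ R.coroot' b (x' + y) := by
          rw [map_add]; exact add_nonneg (hx' b hpos hbI) (hy b hpos hbI)
        have hap := isPos_of_mem Δ (hI ha)
        have haI := ofIdx_mem_parabolic (R := R) ha
        rw [← hxy, mul_smul, hb, coroot'_smul_smul, ← ofIdx_inv, coroot'_smul_right, inv_inv] at h1
        change 0 ≤ R.coroot' (negIdx R a) (x + y) at h1
        rw [coroot'_negIdx, map_add] at h1
        have hxa := hx a hap haI
        have hya := hy a hap haI
        have hx0 : R.coroot' a x = 0 := by linarith
        have hxy0 : R.coroot' a (x + y) = 0 := by rw [map_add]; linarith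
        rw [mul_smul, ofIdx_smul_eq_self hxy0] at hxy
        rw [mul_smul, ofIdx_smul_eq_self hx0]
        exact ih _ (by omega) l' rfl hl' hxy
      · obtain ⟨l'', h1, h2, h3⟩ := exists_exchange (fun i hi => hI (hl' i hi))
          (isPos_of_mem Δ (hI ha)) hpos
        rw [← h3] at hxy ⊢
        exact ih _ (by omega) l'' rfl (fun i hi => hl' i (h1 i hi)) hxy
  obtain ⟨l, hl, rfl⟩ := exists_word_of_mem_parabolic hw
  exact key _ l rfl hl h

lemma eq_of_smul_eq_of_isDomI {I : Set ι} (hI : I ⊆ Δ.support) {w : R.weylGroup}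
    (hw : w ∈ parabolic R I) {x x' : M} (hx : IsDomI Δ I x) (hx' : IsDomI Δ I x')
    (h : w • x = x') : x = x' :=
  (eq_of_smul_add_eq hI hw hx hx' (isDomI_zero I) (by simpa using h)).1

/-- Each `W_I`-orbit in `𝔞*` contains an `I`-dominant element. -/
lemma exists_isDomI (Δ : SimpleSystem R) (I : Set ι) (x : M) :
    ∃ w ∈ parabolic R I, IsDomI Δ I (w • x) := by
  -- in the orbit, an element of maximal height is dominant
  obtain ⟨w, hw⟩ := Finite.exists_max fun w : parabolic R I => height Δ ((w : R.weylGroup) • x)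
  refine ⟨w, w.2, fun i hi hiI => ?_⟩
  have h := hw (⟨weylGroup.ofIdx R i, hiI⟩ * w)
  change height Δ ((weylGroup.ofIdx R i * (w : R.weylGroup)) • x) ≤ _ at h
  rw [mul_smul, ofIdx_smul_vec, map_sub, (height Δ).map_smul, smul_eq_mul] at h
  by_contra hcon
  have := mul_neg_of_neg_of_pos (not_le.mp hcon) (height_pos hi)
  linarith

variable [R.IsCrystallographic]

lemma isDom_of_isDomI_support {x : M} (h : IsDomI Δ Δ.support x) : IsDom Δ x := fun i hi =>
  h i hi (by rw [parabolic_support]; trivial)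

/-- Dominance only has to be tested on simple roots. -/
lemma isDom_of_forall_simple {x : M} (h : ∀ i ∈ Δ.support, 0 ≤ R.coroot' i x) : IsDom Δ x := by
  refine isPos_induction ?_ ?_
  · intro j hj i hi hij
    have h1 := congrArg (fun w : R.weylGroup => w • x) hij
    simp only [ofIdx_smul_vec, sub_right_inj] at h1
    have h2 := congrArg (height Δ) h1
    rw [map_smul, map_smul, height_root Δ hi, smul_eq_mul, smul_eq_mul, mul_one] at h2
    by_contra hcon
    have := mul_neg_of_neg_of_pos (not_le.mp hcon) (height_pos hj)
    linarith [h i hi]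
  · intro j _ i hi hpos _ hstep
    have h0 : R.coroot' j x = R.coroot' (weylGroup.ofIdx R i • j) (weylGroup.ofIdx R i • x) :=
      (coroot'_smul_smul _ _ _).symm
    have h1 : R.coroot' (weylGroup.ofIdx R i • j) (R.root i) = - R.coroot' j (R.root i) := by
      rw [← ofIdx_inv, ← coroot'_smul_right, ← root_smul_idx]
      change R.coroot' j (R.root (negIdx R i)) = _
      rw [root_negIdx, map_neg]
    rw [h0, ofIdx_smul_vec, map_sub, map_smul, h1, smul_eq_mul]
    nlinarith [h i hi]

lemma exists_isDom (Δ : SimpleSystem R) (x : M) : ∃ w : R.weylGroup, IsDom Δ (w • x) := by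
  obtain ⟨w, -, hw⟩ := exists_isDomI Δ Δ.support x
  exact ⟨w, isDom_of_isDomI_support hw⟩

lemma eq_of_smul_eq_of_isDom {w : R.weylGroup} {x x' : M} (hx : IsDom Δ x) (hx' : IsDom Δ x')
    (h : w • x = x') : x = x' :=
  eq_of_smul_eq_of_isDomI (I := Δ.support) subset_rfl (by rw [parabolic_support]; trivial)
    (hx.isDomI _) (hx'.isDomI _) h

/-- A dominant weight is the largest element of its orbit. -/
lemma sub_smul_mem_posCone {x : M} (hx : IsDom Δ x) (hxP : x ∈ weightLattice R)
    (w : R.weylGroup) : x - w • x ∈ Δ.posCone := by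
  have key : ∀ n : ℕ, ∀ l : List ι, l.length = n → (∀ i ∈ l, i ∈ Δ.support) →
      x - wordProd R l • x ∈ Δ.posCone := by
    intro n
    induction n using Nat.strong_induction_on with
    | _ n ih =>
      intro l hn hl
      rcases List.eq_nil_or_concat l with rfl | ⟨l', a, rfl⟩
      · simp
      have ha : a ∈ Δ.support := hl a (by simp)
      have hl' : ∀ i ∈ l', i ∈ Δ.support := fun i hi => hl i (by simp [hi])
      have hlen : l'.length + 1 = n := by simpa using hn
      have hprod : wordProd R (l'.concat a) = wordProd R l' * weylGroup.ofIdx R a := by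
        simp [wordProd]
      rw [hprod]
      by_cases hpos : Δ.IsPos (wordProd R l' • a)
      · obtain ⟨m, hm⟩ := hxP a
        have hm0 : 0 ≤ m := by
          have := hx a (isPos_of_mem Δ ha)
          rw [hm] at this
          exact_mod_cast this
        obtain ⟨m, rfl⟩ := Int.eq_ofNat_of_zero_le hm0
        have : x - (wordProd R l' * weylGroup.ofIdx R a) • x =
            (x - wordProd R l' • x) + m • R.root (wordProd R l' • a) := by
          rw [mul_smul, ofIdx_smul_vec, hm, weyl_smul_sub, weyl_smul_real, root_smul_idx]
          simp only [Int.cast_natCast, Nat.cast_smul_eq_nsmul]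
          abel
        rw [this]
        exact add_mem (ih _ (by omega) l' rfl hl') (nsmul_mem hpos m)
      · obtain ⟨l'', h1, h2, h3⟩ := exists_exchange hl' (isPos_of_mem Δ ha) hpos
        rw [← h3]
        exact ih _ (by omega) l'' rfl (fun i hi => hl' i (h1 i hi))
  obtain ⟨l, hl, rfl⟩ := exists_word Δ w
  exact key _ l rfl hl

end Dominance

/-! ### The Bruhat order and minimal coset representatives -/

section Bruhat

variable {ι M N : Type*} [AddCommGroup M] [Module ℝ M] [AddCommGroup N] [Module ℝ N]
  {R : RootPairing ι ℝ M N} {Δ : SimpleSystem R}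

open RootPairing

lemma bruhatLE_refl (u : R.weylGroup) : Δ.bruhatLE u u := Relation.ReflTransGen.refl

lemma bruhatLE_trans {u v w : R.weylGroup} (h : Δ.bruhatLE u v) (h' : Δ.bruhatLE v w) :
    Δ.bruhatLE u w := Relation.ReflTransGen.trans h h'

lemma bruhatLE_length {u v : R.weylGroup} (h : Δ.bruhatLE u v) :
    u = v ∨ Δ.length u < Δ.length v := by
  induction h with
  | refl => exact Or.inl rfl
  | tail _ h ih =>
    obtain ⟨i, rfl, h⟩ := h
    rcases ih with rfl | ih
    exacts [Or.inr h, Or.inr (ih.trans h)]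

lemma bruhatLE_antisymm {u v : R.weylGroup} (h : Δ.bruhatLE u v) (h' : Δ.bruhatLE v u) :
    u = v := by
  rcases bruhatLE_length h with h1 | h1
  · exact h1
  · rcases bruhatLE_length h' with h2 | h2
    · exact h2.symm
    · exact absurd h1 h2.asymm

lemma ofIdx_mul_eq (z : R.weylGroup) (j : ι) :
    weylGroup.ofIdx R j * z = z * weylGroup.ofIdx R (negIdx R (z⁻¹ • j)) := by
  rw [ofIdx_negIdx, ofIdx_smul_idx, inv_inv]; group

variable [R.IsRootSystem]

lemma isPos_of_coroot'_pos {x : M} (hx : IsDom Δ x) {j : ι} (h : 0 < R.coroot' j x) :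
    Δ.IsPos j := by
  by_contra hcon
  have := hx _ (isPos_negIdx.mpr hcon)
  rw [coroot'_negIdx] at this
  linarith

variable [R.IsCrystallographic] [Finite ι]

lemma bruhatLE_mul_ofIdx {u : R.weylGroup} {j : ι} (hj : Δ.IsPos j) (h : Δ.IsPos (u • j)) :
    Δ.bruhatLE u (u * weylGroup.ofIdx R j) :=
  Relation.ReflTransGen.single ⟨j, rfl, lt_length_mul_ofIdx hj h⟩

lemma mul_ofIdx_bruhatLE {u : R.weylGroup} {j : ι} (hj : Δ.IsPos j) (h : ¬ Δ.IsPos (u • j)) :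
    Δ.bruhatLE (u * weylGroup.ofIdx R j) u :=
  Relation.ReflTransGen.single ⟨j, by simp, length_mul_ofIdx_lt hj h⟩

lemma length_ofIdx_mul_lt {z : R.weylGroup} {j : ι} (hj : Δ.IsPos j) (h : ¬ Δ.IsPos (z⁻¹ • j)) :
    Δ.length (weylGroup.ofIdx R j * z) < Δ.length z := by
  rw [ofIdx_mul_eq]
  refine length_mul_ofIdx_lt (isPos_negIdx.mpr h) ?_
  rwa [smul_negIdx, smul_inv_smul, isPos_negIdx, not_not]

lemma ofIdx_mul_bruhatLE {z : R.weylGroup} {j : ι} (hj : Δ.IsPos j) (h : ¬ Δ.IsPos (z⁻¹ • j)) :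
    Δ.bruhatLE (weylGroup.ofIdx R j * z) z := by
  rw [ofIdx_mul_eq]
  refine mul_ofIdx_bruhatLE (isPos_negIdx.mpr h) ?_
  rwa [smul_negIdx, smul_inv_smul, isPos_negIdx, not_not]

/-- An element of the Weyl group which maps the positive roots of the stabilizer of `x` to positive
roots. These are the minimal representatives of the cosets of the stabilizer of a dominant `x`. -/
def IsMinFor (Δ : SimpleSystem R) (x : M) (v : R.weylGroup) : Prop :=
  ∀ j, Δ.IsPos j → R.coroot' j x = 0 → Δ.IsPos (v • j)

/-- Uniqueness of the minimal representative: the quotient of two of them maps all positive roots to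
positive roots. -/
lemma IsMinFor.eq {x : M} (hx : IsDom Δ x) {u v : R.weylGroup} (hu : IsMinFor Δ x u)
    (hv : IsMinFor Δ x v) (h : u • x = v • x) : u = v := by
  have hfix : (v⁻¹ * u) • x = x := by rw [mul_smul, h, inv_smul_smul]
  have hcor : ∀ j, R.coroot' ((v⁻¹ * u) • j) x = R.coroot' j x := fun j => by
    conv_lhs => rw [← hfix, coroot'_smul_smul]
  have h1 : v⁻¹ * u = 1 := by
    refine eq_one_of_forall_isPos (Δ := Δ) fun j hj => ?_
    rcases (hx j hj).eq_or_lt with h0 | h0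
    · by_contra hcon
      have h2 := hv _ (isPos_negIdx.mpr hcon) (by rw [coroot'_negIdx, hcor, ← h0, neg_zero])
      rw [smul_negIdx, isPos_negIdx, ← mul_smul, mul_inv_cancel_left] at h2
      exact h2 (hu j hj h0.symm)
    · exact isPos_of_coroot'_pos hx (by rwa [hcor])
  exact (inv_mul_eq_one.mp h1).symm

/-- If `v` is minimal for the dominant element `x` and `v x` is `I`-dominant, then `v` is the Bruhat
smallest element of the double coset `W_I v Stab(x)`. -/
lemma IsMinFor.bruhatLE {I : Set ι} (hI : I ⊆ Δ.support) {x : M} (hx : IsDom Δ x) {v : R.weylGroup}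
    (hv : IsMinFor Δ x v) (hvI : IsDomI Δ I (v • x)) (z : R.weylGroup)
    (hz : ∃ w ∈ parabolic R I, w • v • x = z • x) : Δ.bruhatLE v z := by
  induction hn : Δ.length z using Nat.strong_induction_on generalizing z with
  | _ n ih =>
    obtain ⟨w, hw, hwz⟩ := hz
    by_cases hmin : IsMinFor Δ x z
    · by_cases hdom : IsDomI Δ I (z • x)
      · rw [hv.eq hx hmin (eq_of_smul_eq_of_isDomI hI hw hvI hdom hwz)]
        exact bruhatLE_refl z
      · unfold IsDomI at hdom
        push Not at hdom
        obtain ⟨j, hj, hjI, hneg⟩ := hdom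
        rw [coroot'_smul_right] at hneg
        have hnp : ¬ Δ.IsPos (z⁻¹ • j) := fun h => (hx _ h).not_gt hneg
        refine bruhatLE_trans (ih _ (hn ▸ length_ofIdx_mul_lt hj hnp) _
          ⟨_, mul_mem hjI hw, ?_⟩ rfl) (ofIdx_mul_bruhatLE hj hnp)
        rw [mul_smul, hwz, mul_smul]
    · unfold IsMinFor at hmin
      push Not at hmin
      obtain ⟨j, hj, hj0, hnp⟩ := hmin
      refine bruhatLE_trans (ih _ (hn ▸ length_mul_ofIdx_lt hj hnp) _ ⟨w, hw, ?_⟩ rfl)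
        (mul_ofIdx_bruhatLE hj hnp)
      rw [hwz, mul_smul, ofIdx_smul_eq_self hj0]

lemma IsShortest.isMinFor {v : R.weylGroup} {d μ : weightLattice R} (h : IsShortest Δ v d μ) :
    IsMinFor Δ (d : M) v := by
  intro j hj hj0
  by_contra hcon
  refine (h.2 (v * weylGroup.ofIdx R j) ?_).not_gt (length_mul_ofIdx_lt hj hcon)
  rw [mul_smul]
  have : weylGroup.ofIdx R j • d = d := Subtype.ext (ofIdx_smul_eq_self hj0)
  rw [this, h.1]

end Bruhat

/-! ### The ordering of the weight lattice -/

section WeightOrder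

variable {ι M N : Type*} [AddCommGroup M] [Module ℝ M] [AddCommGroup N] [Module ℝ N]
  {R : RootPairing ι ℝ M N} [R.IsRootSystem] [R.IsCrystallographic] [Finite ι]
  (Δ : SimpleSystem R)

open RootPairing

lemma exists_dominant_isShortest (μ : weightLattice R) :
    ∃ d : weightLattice R, ∃ v : R.weylGroup, IsDom Δ (d : M) ∧ IsShortest Δ v d μ := by
  obtain ⟨w, hw⟩ := exists_isDom Δ (μ : M)
  have : Nonempty {v : R.weylGroup // v • (w • μ) = μ} := ⟨⟨w⁻¹, inv_smul_smul w μ⟩⟩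
  obtain ⟨v, hv⟩ := Finite.exists_min
    fun v : {v : R.weylGroup // v • (w • μ) = μ} => Δ.length (v : R.weylGroup)
  exact ⟨w • μ, v, hw, v.2, fun u hu => hv ⟨u, hu⟩⟩

/-- The dominant weight in the orbit of `μ`. -/
noncomputable def domRep (μ : weightLattice R) : weightLattice R :=
  (exists_dominant_isShortest Δ μ).choose

/-- The shortest element of the Weyl group that maps the dominant weight in the orbit of `μ`
to `μ`. -/
noncomputable def shortRep (μ : weightLattice R) : R.weylGroup :=
  (exists_dominant_isShortest Δ μ).choose_spec.choose

lemma domRep_isDom (μ : weightLattice R) : IsDom Δ (domRep Δ μ : M) :=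
  (exists_dominant_isShortest Δ μ).choose_spec.choose_spec.1

lemma shortRep_isShortest (μ : weightLattice R) : IsShortest Δ (shortRep Δ μ) (domRep Δ μ) μ :=
  (exists_dominant_isShortest Δ μ).choose_spec.choose_spec.2

lemma shortRep_smul (μ : weightLattice R) : shortRep Δ μ • domRep Δ μ = μ :=
  (shortRep_isShortest Δ μ).1

variable {Δ}

lemma domRep_eq {w : R.weylGroup} {d μ : weightLattice R} (hd : IsDom Δ (d : M)) (h : w • d = μ) :
    domRep Δ μ = d := by
  refine Subtype.ext (eq_of_smul_eq_of_isDom (w := w⁻¹ * shortRep Δ μ) (domRep_isDom Δ μ) hd ?_)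
  rw [← coe_smul_weight, mul_smul, shortRep_smul, ← h, inv_smul_smul]

@[simp] lemma domRep_smul (w : R.weylGroup) (μ : weightLattice R) :
    domRep Δ (w • μ) = domRep Δ μ :=
  domRep_eq (w := w * shortRep Δ μ) (domRep_isDom Δ μ) (by rw [mul_smul, shortRep_smul])

lemma shortRep_eq {v : R.weylGroup} {d μ : weightLattice R} (hd : IsDom Δ (d : M))
    (h : IsShortest Δ v d μ) : shortRep Δ μ = v := by
  have hdd := domRep_eq hd h.1
  have hs := shortRep_isShortest Δ μ
  rw [hdd] at hs
  refine hs.isMinFor.eq hd h.isMinFor ?_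
  rw [← coe_smul_weight, ← coe_smul_weight, hs.1, h.1]

lemma weightLE_iff {μ lam : weightLattice R} : weightLE Δ μ lam ↔
    (domRep Δ lam : M) - (domRep Δ μ : M) ∈ Δ.posCone ∧
      (domRep Δ μ = domRep Δ lam → Δ.bruhatLE (shortRep Δ μ) (shortRep Δ lam)) := by
  constructor
  · rintro ⟨μd, hμd, lamd, hlamd, v, u, hv, hu, h1, h2⟩
    rw [domRep_eq hμd hv.1, domRep_eq hlamd hu.1, shortRep_eq hμd hv, shortRep_eq hlamd hu]
    exact ⟨h1, h2⟩
  · rintro ⟨h1, h2⟩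
    exact ⟨_, domRep_isDom Δ μ, _, domRep_isDom Δ lam, _, _, shortRep_isShortest Δ μ,
      shortRep_isShortest Δ lam, h1, h2⟩

lemma weightLE_refl (μ : weightLattice R) : weightLE Δ μ μ :=
  weightLE_iff.mpr ⟨by rw [sub_self]; exact zero_mem _, fun _ => bruhatLE_refl _⟩

lemma domRep_eq_of_posCone {μ ν : weightLattice R}
    (h : (domRep Δ ν : M) - (domRep Δ μ : M) ∈ Δ.posCone)
    (h' : (domRep Δ μ : M) - (domRep Δ ν : M) ∈ Δ.posCone) : domRep Δ μ = domRep Δ ν := by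
  have := posCone_antisymm Δ h (by rwa [neg_sub])
  exact Subtype.ext (sub_eq_zero.mp this).symm

lemma weightLE_trans {μ ν κ : weightLattice R} (h : weightLE Δ μ ν) (h' : weightLE Δ ν κ) :
    weightLE Δ μ κ := by
  rw [weightLE_iff] at h h' ⊢
  refine ⟨by simpa using add_mem h'.1 h.1, fun heq => ?_⟩
  have hμν : domRep Δ μ = domRep Δ ν := domRep_eq_of_posCone h.1 (heq ▸ h'.1)
  exact bruhatLE_trans (h.2 hμν) (h'.2 (hμν ▸ heq))

lemma weightLE_antisymm {μ ν : weightLattice R} (h : weightLE Δ μ ν) (h' : weightLE Δ ν μ) :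
    μ = ν := by
  rw [weightLE_iff] at h h'
  have hd := domRep_eq_of_posCone h.1 h'.1
  rw [← shortRep_smul Δ μ, ← shortRep_smul Δ ν, hd, bruhatLE_antisymm (h.2 hd) (h'.2 hd.symm)]

lemma weightLE_of_domRep_ne {μ ν : weightLattice R}
    (h : (domRep Δ ν : M) - (domRep Δ μ : M) ∈ Δ.posCone) (hne : domRep Δ μ ≠ domRep Δ ν) :
    weightLE Δ μ ν := weightLE_iff.mpr ⟨h, fun h => absurd h hne⟩

/-- Reflecting a weight towards the dominant chamber makes it smaller. -/
lemma weightLE_reflection {μ : weightLattice R} {j : ι} (hj : Δ.IsPos j)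
    (h : R.coroot' j (μ : M) ≤ 0) : weightLE Δ (weylGroup.ofIdx R j • μ) μ := by
  rcases h.eq_or_lt with h | h
  · have : weylGroup.ofIdx R j • μ = μ := Subtype.ext (ofIdx_smul_eq_self h)
    rw [this]; exact weightLE_refl μ
  refine weightLE_iff.mpr ⟨by simp, fun _ => ?_⟩
  have hs := shortRep_isShortest Δ (weylGroup.ofIdx R j • μ)
  have hz : ¬ Δ.IsPos ((shortRep Δ μ)⁻¹ • j) := fun hp => by
    have := domRep_isDom Δ μ _ hp
    rw [← coroot'_smul_right, ← coe_smul_weight, shortRep_smul] at this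
    linarith
  refine bruhatLE_trans ?_ (ofIdx_mul_bruhatLE hj hz)
  rw [domRep_smul] at hs
  refine hs.isMinFor.bruhatLE (I := ∅) (by simp) (domRep_isDom Δ μ) (isDomI_empty _) _
    ⟨1, one_mem _, ?_⟩
  rw [one_smul, ← coe_smul_weight, hs.1, ← coe_smul_weight, mul_smul, shortRep_smul]

/-- If the dominant weight in the orbit of `ν` is obtained from an element of the orbit of `μ` by
subtracting a positive multiple of a positive root, then `ν < μ`. -/
lemma weightLE_and_ne_of_domRep_eq {μ ν : weightLattice R} {y : R.weylGroup} {j : ι}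
    (hj : Δ.IsPos j) {c : ℕ} (hc : c ≠ 0)
    (h : (domRep Δ ν : M) = y • (μ : M) - c • R.root j) : weightLE Δ ν μ ∧ ν ≠ μ := by
  have h1 : (domRep Δ μ : M) - y • (μ : M) ∈ Δ.posCone := by
    have := sub_smul_mem_posCone (domRep_isDom Δ μ) (domRep Δ μ).2 (y * shortRep Δ μ)
    rwa [← coe_smul_weight, mul_smul, shortRep_smul] at this
  have h2 : (domRep Δ μ : M) - (domRep Δ ν : M)
      = ((domRep Δ μ : M) - y • (μ : M)) + c • R.root j := by rw [h]; abel
  have hne : domRep Δ ν ≠ domRep Δ μ := fun heq => by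
    rw [heq, sub_self] at h2
    have h3 := congrArg (height Δ) h2
    rw [map_zero, map_add, map_nsmul, nsmul_eq_mul] at h3
    have h4 : 0 < (c : ℝ) * height Δ (R.root j) :=
      mul_pos (by exact_mod_cast Nat.pos_of_ne_zero hc) (height_pos hj)
    linarith [height_nonneg Δ h1]
  refine ⟨weightLE_of_domRep_ne ?_ hne, fun h => hne (h ▸ rfl)⟩
  rw [h2]
  exact add_mem h1 (nsmul_mem hj c)

/-- The weights strictly between `μ` and `s_α μ` on the `α`-string are smaller than `μ`. -/
lemma weightLE_string {μ ν : weightLattice R} {j : ι} {a b : ℕ} (ha : a ≠ 0) (hb : b ≠ 0)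
    (h1 : (ν : M) = (μ : M) - a • R.root j) (h2 : R.coroot' j (μ : M) = a + b) :
    weightLE Δ ν μ ∧ ν ≠ μ := by
  set x := (shortRep Δ ν)⁻¹ with hx
  have hxν : (domRep Δ ν : M) = x • (ν : M) := by
    rw [← coe_smul_weight, hx]; congr 1; rw [eq_inv_smul_iff, shortRep_smul]
  by_cases hj : Δ.IsPos (x • j)
  · refine weightLE_and_ne_of_domRep_eq (y := x) hj ha ?_
    rw [hxν, h1, weyl_smul_sub, root_smul_idx]
    congr 1
    exact smul_comm (x : R.Aut) a (R.root j)
  · refine weightLE_and_ne_of_domRep_eq (y := x * weylGroup.ofIdx R j) (isPos_negIdx.mpr hj) hb ?_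
    have h3 : (ν : M) = weylGroup.ofIdx R j • (μ : M) + b • R.root j := by
      rw [ofIdx_smul_vec, h1, h2, add_smul, Nat.cast_smul_eq_nsmul, Nat.cast_smul_eq_nsmul]; abel
    rw [hxν, h3, weyl_smul_add, root_negIdx, mul_smul, smul_neg, sub_neg_eq_add, root_smul_idx]
    congr 1
    exact smul_comm (x : R.Aut) b (R.root j)

variable (Δ) in
lemma exists_isDomI_weight (I : Set ι) (μ : weightLattice R) :
    ∃ ν : weightLattice R, IsDomI Δ I (ν : M) ∧ ∃ w ∈ parabolic R I, w • ν = μ := by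
  obtain ⟨w, hw, h⟩ := exists_isDomI Δ I (μ : M)
  exact ⟨w • μ, h, w⁻¹, inv_mem hw, inv_smul_smul w μ⟩

variable (Δ) in
/-- The `I`-dominant weight in the `W_I`-orbit of `μ`. -/
noncomputable def domRepI (I : Set ι) (μ : weightLattice R) : weightLattice R :=
  (exists_isDomI_weight Δ I μ).choose

variable (Δ) in
lemma domRepI_isDomI (I : Set ι) (μ : weightLattice R) : IsDomI Δ I (domRepI Δ I μ : M) :=
  (exists_isDomI_weight Δ I μ).choose_spec.1

variable (Δ) in
lemma exists_smul_domRepI (I : Set ι) (μ : weightLattice R) :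
    ∃ w ∈ parabolic R I, w • domRepI Δ I μ = μ :=
  (exists_isDomI_weight Δ I μ).choose_spec.2

variable {I : Set ι}

lemma domRepI_eq (hI : I ⊆ Δ.support) {w : R.weylGroup} (hw : w ∈ parabolic R I)
    {ν μ : weightLattice R} (hν : IsDomI Δ I (ν : M)) (h : w • ν = μ) : domRepI Δ I μ = ν := by
  obtain ⟨v, hv, hvμ⟩ := exists_smul_domRepI Δ I μ
  refine Subtype.ext (eq_of_smul_eq_of_isDomI hI (mul_mem (inv_mem hw) hv)
    (domRepI_isDomI Δ I μ) hν ?_)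
  rw [← coe_smul_weight, mul_smul, hvμ, ← h, inv_smul_smul]

lemma domRepI_smul (hI : I ⊆ Δ.support) {w : R.weylGroup} (hw : w ∈ parabolic R I)
    (μ : weightLattice R) : domRepI Δ I (w • μ) = domRepI Δ I μ := by
  obtain ⟨v, hv, hvμ⟩ := exists_smul_domRepI Δ I μ
  exact domRepI_eq hI (mul_mem hw hv) (domRepI_isDomI Δ I μ) (by rw [mul_smul, hvμ])

@[simp] lemma domRep_domRepI (μ : weightLattice R) : domRep Δ (domRepI Δ I μ) = domRep Δ μ := by
  obtain ⟨v, hv, hvμ⟩ := exists_smul_domRepI Δ I μ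
  conv_rhs => rw [← hvμ, domRep_smul]

/-- Passing to minimal representatives of double cosets `W_I w Stab(d)` preserves the Bruhat
order. -/
lemma bruhatLE_shortRep_domRepI (hI : I ⊆ Δ.support) {d : weightLattice R} (hd : IsDom Δ (d : M))
    {u v : R.weylGroup} (h : Δ.bruhatLE u v) :
    Δ.bruhatLE (shortRep Δ (domRepI Δ I (u • d))) (shortRep Δ (domRepI Δ I (v • d))) := by
  induction h with
  | refl => exact bruhatLE_refl _
  | @tail u v _ h ih =>
    refine bruhatLE_trans ih ?_
    obtain ⟨i, rfl, hlt⟩ := h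
    -- the reflection is the one in a positive root `j` with `u j > 0`
    obtain ⟨j, hj, hij⟩ : ∃ j, Δ.IsPos j ∧ weylGroup.ofIdx R i = weylGroup.ofIdx R j := by
      by_cases hi : Δ.IsPos i
      · exact ⟨i, hi, rfl⟩
      · exact ⟨negIdx R i, isPos_negIdx.mpr hi, (ofIdx_negIdx i).symm⟩
    rw [hij] at hlt ⊢
    have huj : Δ.IsPos (u • j) := by
      by_contra hcon
      exact (length_mul_ofIdx_lt hj hcon).asymm hlt
    by_cases hmem : weylGroup.ofIdx R (u • j) ∈ parabolic R I
    · rw [← ofIdx_smul_idx', mul_smul, domRepI_smul hI hmem]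
      exact bruhatLE_refl _
    by_cases hfix : R.coroot' j (d : M) = 0
    · have : weylGroup.ofIdx R j • d = d := Subtype.ext (ofIdx_smul_eq_self hfix)
      rw [mul_smul, this]
      exact bruhatLE_refl _
    have hpos : 0 < R.coroot' j (d : M) := lt_of_le_of_ne (hd j hj) (Ne.symm hfix)
    set κ := (u * weylGroup.ofIdx R j) • d with hκ
    set z := shortRep Δ (domRepI Δ I κ) with hz
    have hdκ : domRep Δ (domRepI Δ I κ) = d := by
      rw [domRep_domRepI]; exact domRep_eq hd hκ.symm
    have hzd : z • d = domRepI Δ I κ := by rw [← hdκ]; exact shortRep_smul Δ _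
    obtain ⟨y, hy, hyκ⟩ := exists_smul_domRepI Δ I κ
    -- `z = y⁻¹ u s_j c` for some `c` in the stabilizer of `d`
    set c := weylGroup.ofIdx R j * u⁻¹ * y * z with hc
    have hcd : c • d = d := by
      rw [hc, mul_smul, hzd, mul_smul, hyκ, hκ, ← mul_smul]
      simp
    have hcinv : c⁻¹ • (d : M) = d := by
      rw [inv_smul_eq_iff]; exact congrArg Subtype.val hcd.symm
    have hj' : Δ.IsPos (c⁻¹ • j) := by
      refine isPos_of_coroot'_pos hd ?_
      conv_rhs => rw [← hcinv, coroot'_smul_smul]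
      exact hpos
    have hzeq : z = (y⁻¹ * u * c) * weylGroup.ofIdx R (c⁻¹ • j) := by
      rw [ofIdx_smul_idx, hc]
      simp [mul_assoc]
    have hraise : Δ.IsPos ((y⁻¹ * u * c) • c⁻¹ • j) := by
      rw [← mul_smul, mul_inv_cancel_right, mul_smul]
      exact isPos_smul_of_notMem hI (inv_mem hy) huj hmem
    have hle : Δ.bruhatLE (y⁻¹ * u * c) z := by
      rw [hzeq]; exact bruhatLE_mul_ofIdx hj' hraise
    refine bruhatLE_trans ?_ hle
    obtain ⟨x, hx, hxu⟩ := exists_smul_domRepI Δ I (u • d)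
    have hs := shortRep_isShortest Δ (domRepI Δ I (u • d))
    rw [domRep_domRepI, domRep_smul, domRep_eq (w := 1) hd (one_smul _ d)] at hs
    refine hs.isMinFor.bruhatLE hI hd ?_ _ ⟨y⁻¹ * x, mul_mem (inv_mem hy) hx, ?_⟩
    · rw [← coe_smul_weight, hs.1]; exact domRepI_isDomI Δ I _
    · rw [← coe_smul_weight, hs.1, ← coe_smul_weight, mul_smul, hxu, ← coe_smul_weight, mul_smul,
        hcd, mul_smul]

/-- The map to the `I`-dominant weights in the `W_I`-orbits is monotone. -/
lemma weightLE_domRepI (hI : I ⊆ Δ.support) {μ ν : weightLattice R} (h : weightLE Δ μ ν) :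
    weightLE Δ (domRepI Δ I μ) (domRepI Δ I ν) := by
  rw [weightLE_iff] at h ⊢
  rw [domRep_domRepI, domRep_domRepI]
  refine ⟨h.1, fun heq => ?_⟩
  have := bruhatLE_shortRep_domRepI hI (domRep_isDom Δ ν) (h.2 heq)
  rwa [shortRep_smul, ← heq, shortRep_smul] at this

end WeightOrder

/-! ### Finiteness of lower sets of weights -/

section Finiteness

variable {ι M N : Type*} [AddCommGroup M] [Module ℝ M] [AddCommGroup N] [Module ℝ N]
  {R : RootPairing ι ℝ M N}

open RootPairing

lemma pairInt_negIdx (μ : weightLattice R) (i : ι) :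
    pairInt R μ (negIdx R i) = -pairInt R μ i := by
  have := coroot'_negIdx (R := R) i (μ : M)
  rw [pairInt_spec, pairInt_spec] at this
  exact_mod_cast this

lemma coroot'_smul_simple (i j : ι) :
    R.coroot' (weylGroup.ofIdx R i • j) (R.root i) = -R.coroot' j (R.root i) := by
  rw [← ofIdx_inv, ← coroot'_smul_right, ← root_smul_idx]
  change R.coroot' j (R.root (negIdx R i)) = _
  rw [root_negIdx, map_neg]

variable [R.IsRootSystem] {Δ : SimpleSystem R}

lemma pairInt_injective : Function.Injective (pairInt R) := by
  intro μ ν h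
  have h1 : ∀ i, R.toLinearMap (μ : M) (R.coroot i) = R.toLinearMap (ν : M) (R.coroot i) :=
    fun i => by
      change R.coroot' i (μ : M) = R.coroot' i (ν : M)
      rw [pairInt_spec, pairInt_spec, h]
  have h2 : R.toLinearMap (μ : M) = R.toLinearMap (ν : M) :=
    LinearMap.ext_on_range (IsRootSystem.span_coroot_eq_top (P := R)) h1
  exact Subtype.ext (R.toPerfPair.injective h2)

lemma coroot'_simple_nonneg_of_ofIdx_eq {i j : ι} (hi : i ∈ Δ.support) (hj : Δ.IsPos j)
    (h : weylGroup.ofIdx R j = weylGroup.ofIdx R i) : 0 ≤ R.coroot' j (R.root i) := by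
  have h1 := congrArg (fun w : R.weylGroup => w • R.root i) h
  simp only [ofIdx_smul_vec, sub_right_inj] at h1
  have h2 := congrArg (height Δ) h1
  rw [map_smul, map_smul, height_root Δ hi] at h2
  simp at h2
  by_contra hcon
  have := mul_neg_of_neg_of_pos (not_le.mp hcon) (height_pos hj)
  simp at this
  linarith

variable [Fintype ι]

open Classical in
/-- If `f` is antisymmetric for a simple reflection, then its values on the positive roots cancel in
pairs, except for the roots proportional to the simple root. -/
lemma sum_isPos_nonneg {i : ι} (hi : i ∈ Δ.support) (f : ι → ℝ)
    (hf : ∀ j, f (weylGroup.ofIdx R i • j) = -f j)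
    (hpos : ∀ j, Δ.IsPos j → weylGroup.ofIdx R j = weylGroup.ofIdx R i → 0 ≤ f j) :
    0 ≤ ∑ j with Δ.IsPos j, f j := by
  rw [← Finset.sum_filter_add_sum_filter_not _
    (fun j => weylGroup.ofIdx R j = weylGroup.ofIdx R i)]
  refine add_nonneg (Finset.sum_nonneg fun j hj => ?_) (le_of_eq (Eq.symm ?_))
  · simp only [Finset.mem_filter, Finset.mem_univ, true_and] at hj
    exact hpos j hj.1 hj.2
  · refine Finset.sum_involution (fun j _ => weylGroup.ofIdx R i • j) ?_ ?_ ?_ ?_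
    · intro j _
      rw [hf, add_neg_cancel]
    · intro j _ hne heq
      have := hf j
      rw [heq] at this
      exact hne (by linarith)
    · intro j hj
      simp only [Finset.mem_filter, Finset.mem_univ, true_and] at hj ⊢
      refine ⟨isPos_simple_smul hi hj.1 hj.2, fun h => hj.2 ?_⟩
      rw [ofIdx_smul_idx] at h
      simpa using eq_inv_of_mul_eq_one_right (a := weylGroup.ofIdx R i) (by simpa using h)
    · intro j _
      rw [← mul_smul, ofIdx_mul_self, one_smul]

open Classical in
/-- The sum of the positive coroots is non-negative on `Q⁺`. -/
lemma sum_coroot'_nonneg {x : M} (hx : x ∈ Δ.posCone) :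
    0 ≤ ∑ j with Δ.IsPos j, R.coroot' j x := by
  induction hx using AddSubmonoid.closure_induction with
  | mem x hx =>
    obtain ⟨i, hi, rfl⟩ := hx
    exact sum_isPos_nonneg hi _ (coroot'_smul_simple i)
      fun j hj h => coroot'_simple_nonneg_of_ofIdx_eq hi hj h
  | zero => simp
  | add x y _ _ hx hy => simp only [map_add, Finset.sum_add_distrib]; exact add_nonneg hx hy

/-- A dominant weight `d ≤ x` is bounded, since its values on the positive coroots are non-negative
with sum at most that of `x`. -/
lemma finite_dominant_le (x : M) :
    {d : weightLattice R | IsDom Δ (d : M) ∧ x - (d : M) ∈ Δ.posCone}.Finite := by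
  classical
  set n := ⌈∑ j with Δ.IsPos j, R.coroot' j x⌉ with hn
  refine ((Set.Finite.pi' fun _ : ι => Set.finite_Icc (-n) n).preimage
    (pairInt_injective.injOn)).subset ?_
  rintro d ⟨hd, hx⟩ i
  have hpos : ∀ j, Δ.IsPos j → 0 ≤ pairInt R d j ∧ pairInt R d j ≤ n := by
    intro j hj
    have h0 : (0 : ℝ) ≤ pairInt R d j := by rw [← pairInt_spec]; exact hd j hj
    refine ⟨by exact_mod_cast h0, ?_⟩
    have h1 := sum_coroot'_nonneg hx
    simp only [map_sub, Finset.sum_sub_distrib] at h1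
    have h2 : R.coroot' j (d : M) ≤ ∑ j with Δ.IsPos j, R.coroot' j (d : M) :=
      Finset.single_le_sum (f := fun j => R.coroot' j (d : M))
        (fun k hk => hd k (by simpa using hk)) (by simpa using hj)
    rw [pairInt_spec] at h2
    have h3 : (pairInt R d j : ℝ) ≤ n := h2.trans ((sub_nonneg.mp h1).trans (Int.le_ceil _))
    exact_mod_cast h3
  by_cases hi : Δ.IsPos i
  · exact ⟨by linarith [hpos i hi], (hpos i hi).2⟩
  · have h1 := hpos _ (isPos_negIdx.mpr hi)
    rw [pairInt_negIdx] at h1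
    exact ⟨by linarith [h1.2], by linarith [h1.1]⟩

lemma finite_setOf_weightLE [R.IsCrystallographic] (lam : weightLattice R) :
    {μ | weightLE Δ μ lam}.Finite := by
  refine ((finite_dominant_le (Δ := Δ) (domRep Δ lam : M)).biUnion fun d _ =>
    Set.finite_range fun w : R.weylGroup => w • d).subset fun μ hμ => ?_
  simp only [Set.mem_iUnion]
  exact ⟨domRep Δ μ, ⟨domRep_isDom Δ μ, (weightLE_iff.mp hμ).1⟩, shortRep Δ μ, shortRep_smul Δ μ⟩

end Finiteness

/-! ### Spectral parameters -/

section Spectral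

open RootPairing

variable {ι M N : Type*} [AddCommGroup M] [Module ℝ M] [AddCommGroup N] [Module ℝ N]
  {R : RootPairing ι ℝ M N}

lemma multiplicity_smul {k : ι → ℝ} (hk : ∀ i j, k (R.reflectionPerm i j) = k j)
    (w : R.weylGroup) (j : ι) : k (w • j) = k j := by
  obtain ⟨w, hw⟩ := w
  change k (w • j) = k j
  induction hw using weylGroup.induction generalizing j with
  | mem i => exact hk i j
  | one => rfl
  | mul x y _ _ hx hy => rw [mul_smul, hx, hy]

variable [R.IsRootSystem] [Fintype ι] {Δ : SimpleSystem R} {k : ι → ℝ}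

open Classical in
lemma sum_isPos_eq_half {V : Type*} [AddCommGroup V] [Module ℝ V] (f : ι → V)
    (hf : ∀ i, f (negIdx R i) = f i) :
    ∑ i, (if Δ.IsPos i then f i else 0) = (1 / 2 : ℝ) • ∑ i, f i := by
  have h1 : ∑ i, (if Δ.IsPos i then 0 else f i) = ∑ i, (if Δ.IsPos i then f i else 0) := by
    refine Fintype.sum_bijective (negIdx R) (Function.Involutive.bijective negIdx_negIdx) _ _
      fun i => ?_
    by_cases h : Δ.IsPos i <;> simp [isPos_negIdx, h, hf]
  have h2 : ∑ i, f i =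
      ∑ i, (if Δ.IsPos i then f i else 0) + ∑ i, (if Δ.IsPos i then 0 else f i) := by
    rw [← Finset.sum_add_distrib]
    exact Finset.sum_congr rfl fun i _ => by split_ifs <;> simp
  rw [h2, h1]
  module

lemma rho_isDom [R.IsCrystallographic] (hk : ∀ i j, k (R.reflectionPerm i j) = k j)
    (hk0 : ∀ i, 0 ≤ k i) : IsDom Δ (rho Δ k) := by
  classical
  refine isDom_of_forall_simple fun i hi => ?_
  have h1 : R.coroot' i (rho Δ k) = 1 / 2 * ∑ j with Δ.IsPos j, k j * R.coroot' i (R.root j) := by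
    rw [rho, map_smul, map_sum, Finset.sum_filter, smul_eq_mul]
    congr 1
    refine Finset.sum_congr rfl fun j _ => ?_
    split_ifs <;> simp
  rw [h1]
  refine mul_nonneg (by norm_num) (sum_isPos_nonneg hi _ ?_ ?_)
  · intro j
    rw [multiplicity_smul hk, root_smul_idx, coroot'_smul_right, ofIdx_inv]
    change _ * R.coroot' (negIdx R i) _ = _
    rw [coroot'_negIdx]
    ring
  · intro j hj hij
    refine mul_nonneg (hk0 j) ?_
    have h2 := congrArg (fun w : R.weylGroup => w • R.root j) hij
    simp only [ofIdx_smul_vec, sub_right_inj] at h2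
    have h3 := congrArg (height Δ) h2
    rw [map_smul, map_smul, height_root Δ hi] at h3
    have := height_pos hj
    simp at h3 ⊢
    linarith

variable [R.IsCrystallographic]

/-- `x` is a longest element that maps the dominant weight in the orbit of `μ` to `μ`. -/
def IsLongestFor (Δ : SimpleSystem R) (μ : weightLattice R) (x : R.weylGroup) : Prop :=
  x • domRep Δ μ = μ ∧
    ∀ j, Δ.IsPos j → R.coroot' j (domRep Δ μ : M) = 0 → ¬ Δ.IsPos (x • j)

lemma exists_isLongestFor (Δ : SimpleSystem R) (μ : weightLattice R) :
    ∃ x, IsLongestFor Δ μ x := by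
  have : Nonempty {v : R.weylGroup // v • domRep Δ μ = μ} := ⟨⟨_, shortRep_smul Δ μ⟩⟩
  obtain ⟨v, hv⟩ := Finite.exists_max
    fun v : {v : R.weylGroup // v • domRep Δ μ = μ} => Δ.length (v : R.weylGroup)
  refine ⟨v, v.2, fun j hj hj0 hcon => ?_⟩
  refine (hv ⟨v * weylGroup.ofIdx R j, ?_⟩).not_gt (lt_length_mul_ofIdx hj hcon)
  rw [mul_smul]
  have : weylGroup.ofIdx R j • domRep Δ μ = domRep Δ μ := Subtype.ext (ofIdx_smul_eq_self hj0)
  rw [this, v.2]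

/-- The spectral parameter of `μ` is the image of `μ₊ + ρ(k)` under a longest element which maps
`μ₊` to `μ`. -/
lemma spectral_eq (hk : ∀ i j, k (R.reflectionPerm i j) = k j) {μ : weightLattice R}
    {x : R.weylGroup} (hx : IsLongestFor Δ μ x) :
    spectral Δ k μ = x • ((domRep Δ μ : M) + rho Δ k) := by
  classical
  -- the term of `α` in the spectral parameter; it is unchanged if `α` is replaced by `-α`, so that
  -- the sum over the positive roots is half the sum over all roots
  set g : ι → M := fun i => (k i * if Δ.IsPos (x⁻¹ • i) then 1 else -1) • R.root i with hg
  have hsum : ∑ i, (if Δ.IsPos i then (k i * if 0 < pairInt R μ i then 1 else -1) • R.root i else 0)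
      = ∑ i, (if Δ.IsPos i then g i else 0) := by
    refine Finset.sum_congr rfl fun i _ => ?_
    by_cases hi : Δ.IsPos i
    swap
    · rw [if_neg hi, if_neg hi]
    rw [if_pos hi, if_pos hi]
    have hiff : 0 < pairInt R μ i ↔ Δ.IsPos (x⁻¹ • i) := by
      have h1 : (pairInt R μ i : ℝ) = R.coroot' (x⁻¹ • i) (domRep Δ μ : M) := by
        rw [← pairInt_spec, ← coroot'_smul_right, ← coe_smul_weight, hx.1]
      constructor
      · intro h
        refine isPos_of_coroot'_pos (domRep_isDom Δ μ) ?_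
        rw [← h1]; exact_mod_cast h
      · intro h
        have h2 := domRep_isDom Δ μ _ h
        rcases h2.eq_or_lt with h3 | h3
        · exact absurd (by rwa [smul_inv_smul]) (hx.2 _ h h3.symm)
        · rw [← h1] at h3; exact_mod_cast h3
    simp only [hg, hiff]
  have hgneg : ∀ i, g (negIdx R i) = g i := fun i => by
    simp only [hg, smul_negIdx, isPos_negIdx, root_negIdx]
    rw [show k (negIdx R i) = k i from multiplicity_smul hk _ i]
    by_cases h : Δ.IsPos (x⁻¹ • i) <;> simp [h]
  have hgx : ∑ i, g i = ∑ i, x • ((k i * if Δ.IsPos i then 1 else -1) • R.root i) := by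
    refine (Fintype.sum_bijective (fun i => x • i) (MulAction.bijective x) _ _ fun i => ?_).symm
    simp only [hg, inv_smul_smul, multiplicity_smul hk, root_smul_idx, weyl_smul_real]
  have hlin : ∀ f : ι → M, x • ∑ i, f i = ∑ i, x • f i := fun f =>
    Finset.smul_sum (r := (x : R.Aut))
  have hρ : rho Δ k = (1 / 2 : ℝ) • ((1 / 2 : ℝ) •
      ∑ i, (k i * if Δ.IsPos i then 1 else -1) • R.root i) := by
    rw [rho, ← sum_isPos_eq_half (Δ := Δ) fun i => (k i * if Δ.IsPos i then 1 else -1) • R.root i]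
    · congr 1
      refine Finset.sum_congr rfl fun i _ => ?_
      split_ifs <;> simp
    · intro i
      rw [show k (negIdx R i) = k i from multiplicity_smul hk _ i, isPos_negIdx, root_negIdx]
      by_cases h : Δ.IsPos i <;> simp [h]
  rw [spectral, hsum, sum_isPos_eq_half g hgneg, hgx, weyl_smul_add, ← coe_smul_weight, hx.1, hρ,
    weyl_smul_real, weyl_smul_real, hlin]

/-- If the spectral parameters of two weights are conjugate, then so are the weights, by the same
element. -/
lemma smul_eq_of_smul_spectral_eq (hk : ∀ i j, k (R.reflectionPerm i j) = k j)
    (hk0 : ∀ i, 0 ≤ k i) {lam μ : weightLattice R} {w : R.weylGroup}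
    (h : w • spectral Δ k lam = spectral Δ k μ) : w • lam = μ := by
  obtain ⟨x, hx⟩ := exists_isLongestFor Δ lam
  obtain ⟨y, hy⟩ := exists_isLongestFor Δ μ
  rw [spectral_eq hk hx, spectral_eq hk hy, ← mul_smul, ← inv_smul_eq_iff, ← mul_smul] at h
  have hρ : IsDom Δ (rho Δ k) := rho_isDom hk hk0
  -- both sums are dominant, hence they agree, and then so do the dominant weights
  have hsum : (domRep Δ lam : M) + rho Δ k = domRep Δ μ + rho Δ k :=
    eq_of_smul_eq_of_isDom ((domRep_isDom Δ lam).add hρ) ((domRep_isDom Δ μ).add hρ) h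
  have h2 := (eq_of_smul_add_eq (Δ := Δ) (I := Δ.support) subset_rfl
    (by rw [parabolic_support]; trivial) ((domRep_isDom Δ lam).isDomI _)
    ((domRep_isDom Δ μ).isDomI _) (hρ.isDomI _) h).2
  have h3 : (y⁻¹ * (w * x)) • domRep Δ lam = domRep Δ μ := Subtype.ext h2
  rwa [mul_smul, inv_smul_eq_iff, hy.1, mul_smul, hx.1] at h3

lemma spectral_injective (hk : ∀ i j, k (R.reflectionPerm i j) = k j) (hk0 : ∀ i, 0 ≤ k i) :
    Function.Injective (spectral Δ k) := fun lam μ h => by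
  simpa using smul_eq_of_smul_spectral_eq (w := 1) hk hk0 (by rwa [one_smul])

/-- For a simple reflection that moves `μ`, the spectral parameter of `s μ` is the reflection of
that of `μ`. -/
lemma spectral_simple_smul (hk : ∀ i j, k (R.reflectionPerm i j) = k j) {μ : weightLattice R}
    {i : ι} (hi : i ∈ Δ.support) (hμ : R.coroot' i (μ : M) ≠ 0) :
    spectral Δ k (weylGroup.ofIdx R i • μ) = weylGroup.ofIdx R i • spectral Δ k μ := by
  obtain ⟨x, hx⟩ := exists_isLongestFor Δ μ
  have hx' : IsLongestFor Δ (weylGroup.ofIdx R i • μ) (weylGroup.ofIdx R i * x) := by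
    refine ⟨by rw [mul_smul, domRep_smul, hx.1], fun j hj hj0 hcon => ?_⟩
    rw [domRep_smul] at hj0
    have h1 := isPos_negIdx.mpr (hx.2 j hj hj0)
    rw [mul_smul, ← not_not (a := Δ.IsPos _), ← isPos_negIdx, ← smul_negIdx] at hcon
    have heq := ofIdx_eq_of_not_isPos hi h1 hcon
    -- the reflection in `x j` is the simple one, hence it fixes `μ`
    have hfix : weylGroup.ofIdx R i • (μ : M) = μ := by
      rw [← heq, ofIdx_negIdx, ofIdx_smul_idx, mul_smul, mul_smul]
      nth_rw 1 [← hx.1]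
      rw [coe_smul_weight, inv_smul_smul, ofIdx_smul_eq_self hj0, ← coe_smul_weight, hx.1]
    rw [ofIdx_smul_vec, sub_eq_self, smul_eq_zero] at hfix
    exact hμ (hfix.resolve_right (R.ne_zero i))
  rw [spectral_eq hk hx, spectral_eq hk hx', domRep_smul, mul_smul]

/-- The spectral parameters of the weights in a `W_I`-orbit are in one `W_I`-orbit. -/
lemma exists_spectral_smul (hk : ∀ i j, k (R.reflectionPerm i j) = k j) {I : Set ι}
    (hI : I ⊆ Δ.support) {w : R.weylGroup} (hw : w ∈ parabolic R I) (μ : weightLattice R) :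
    ∃ w' ∈ parabolic R I, spectral Δ k (w • μ) = w' • spectral Δ k μ := by
  obtain ⟨l, hl, rfl⟩ := exists_word_of_mem_parabolic hw
  clear hw
  induction l with
  | nil => exact ⟨1, one_mem _, by simp⟩
  | cons a l ih =>
    obtain ⟨w', hw', h⟩ := ih fun i hi => hl i (List.mem_cons_of_mem _ hi)
    have ha : a ∈ I := hl a (by simp)
    rw [wordProd_cons, mul_smul]
    by_cases h0 : R.coroot' a ((wordProd R l • μ : weightLattice R) : M) = 0
    · have : weylGroup.ofIdx R a • wordProd R l • μ = wordProd R l • μ :=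
        Subtype.ext (ofIdx_smul_eq_self h0)
      exact ⟨w', hw', by rw [this, h]⟩
    · exact ⟨weylGroup.ofIdx R a * w', mul_mem (ofIdx_mem_parabolic ha) hw', by
        rw [spectral_simple_smul hk (hI ha) h0, h, mul_smul]⟩

end Spectral

/-! ### Gram-Schmidt families for partial orderings -/

section GramSchmidt

open scoped ComplexConjugate

variable {V J : Type*} [AddCommGroup V] [Module ℂ V]

/-- A Hermitian form with `⟨x, x⟩ ≠ 0` for all `x ≠ 0`. -/
structure IsAnisotropic (B : V →ₗ⋆[ℂ] V →ₗ[ℂ] ℂ) : Prop where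
  conj_symm : ∀ x y, conj (B x y) = B y x
  eq_zero : ∀ x, B x x = 0 → x = 0

variable {B : V →ₗ⋆[ℂ] V →ₗ[ℂ] ℂ} (hB : IsAnisotropic B)

include hB in
lemma IsAnisotropic.symm_zero {x y : V} (h : B x y = 0) : B y x = 0 := by
  rw [← hB.conj_symm, h, map_zero]

lemma form_eq_zero_of_mem_span {s : Set V} {x y : V} (hx : x ∈ Submodule.span ℂ s)
    (h : ∀ z ∈ s, B z y = 0) : B x y = 0 := by
  induction hx using Submodule.span_induction with
  | mem x hx => exact h x hx
  | zero => simp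
  | add x z _ _ hx hz => simp [hx, hz]
  | smul c x _ hx => simp [hx]

include hB in
lemma exists_orthogonal_projection {s : Set V} (hs : s.Finite) (v : V) :
    ∃ u ∈ Submodule.span ℂ s, ∀ z ∈ s, B z (v - u) = 0 := by
  induction s, hs using Set.Finite.induction_on generalizing v with
  | empty => exact ⟨0, zero_mem _, by simp⟩
  | @insert a s _ _ ih =>
    obtain ⟨u, hu, huz⟩ := ih v
    obtain ⟨a', ha', haz⟩ := ih a
    have hle : Submodule.span ℂ s ≤ Submodule.span ℂ (insert a s) :=
      Submodule.span_mono (Set.subset_insert a s)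
    have haa : a - a' ∈ Submodule.span ℂ (insert a s) :=
      sub_mem (Submodule.subset_span (Set.mem_insert a s)) (hle ha')
    set e := a - a' with he
    set c := B e (v - u) / B e e with hc
    have horth : B e (v - (u + c • e)) = 0 := by
      rw [← sub_sub, map_sub, map_smul, smul_eq_mul]
      by_cases h0 : B e e = 0
      · rw [hB.eq_zero e h0]; simp
      · rw [hc, div_mul_cancel₀ _ h0, sub_self]
    have hs0 : ∀ z ∈ s, B z (v - (u + c • e)) = 0 := fun z hz => by
      rw [← sub_sub, map_sub, map_smul, huz z hz, haz z hz, smul_zero, sub_zero]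
    refine ⟨u + c • e, add_mem (hle hu) (Submodule.smul_mem _ c haa), ?_⟩
    rintro z (rfl | hz)
    · have : z = e + a' := by rw [he]; abel
      rw [this, map_add, LinearMap.add_apply, horth, form_eq_zero_of_mem_span ha' hs0, add_zero]
    · exact hs0 z hz

/-- `p` is obtained from `b` by the Gram-Schmidt process for a partial ordering `r`: the vector
`p j` differs from `b j` by a combination of the `b i` with `i < j`, to which it is orthogonal. -/
structure IsGramSchmidt (B : V →ₗ⋆[ℂ] V →ₗ[ℂ] ℂ) (r : J → J → Prop) (b p : J → V) : Prop where
  sub_mem : ∀ j, b j - p j ∈ Submodule.span ℂ (b '' {i | r i j ∧ i ≠ j})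
  orthogonal : ∀ i j, r i j → i ≠ j → B (b i) (p j) = 0

include hB in
lemma exists_isGramSchmidt {r : J → J → Prop} (hfin : ∀ j, {i | r i j}.Finite) (b : J → V) :
    ∃ p, IsGramSchmidt B r b p := by
  have hex := fun j => exists_orthogonal_projection hB
    (((hfin j).subset fun i (h : r i j ∧ i ≠ j) => h.1).image b) (b j)
  choose u hu huz using hex
  exact ⟨fun j => b j - u j, fun j => by rw [sub_sub_cancel]; exact hu j,
    fun i j h hne => huz j _ ⟨i, ⟨h, hne⟩, rfl⟩⟩

namespace IsGramSchmidt

variable {r : J → J → Prop} {b p : J → V} (hp : IsGramSchmidt B r b p)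

include hp

lemma mem_span_base (hrefl : ∀ i, r i i) (j : J) : p j ∈ Submodule.span ℂ (b '' {i | r i j}) := by
  have h1 : b j ∈ Submodule.span ℂ (b '' {i | r i j}) := Submodule.subset_span ⟨j, hrefl j, rfl⟩
  have h2 := Submodule.span_mono (Set.image_mono fun i (h : r i j ∧ i ≠ j) => h.1) (hp.sub_mem j)
  simpa using _root_.sub_mem h1 h2

lemma form_eq_zero {j : J} {x : V} (hx : x ∈ Submodule.span ℂ (b '' {i | r i j ∧ i ≠ j})) :
    B x (p j) = 0 :=
  form_eq_zero_of_mem_span hx (by rintro _ ⟨i, hi, rfl⟩; exact hp.orthogonal i j hi.1 hi.2)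

lemma ne_zero (hb : LinearIndependent ℂ b) (j : J) : p j ≠ 0 := fun h => by
  have h1 := hp.sub_mem j
  rw [h, sub_zero] at h1
  exact hb.notMem_span_image (s := {i | r i j ∧ i ≠ j}) (fun h => h.2 rfl) h1

lemma base_mem_span (hrefl : ∀ i, r i i) (htrans : ∀ i j l, r i j → r j l → r i l)
    (hanti : ∀ i j, r i j → r j i → i = j) (hfin : ∀ j, {i | r i j}.Finite) (j : J) :
    b j ∈ Submodule.span ℂ (p '' {i | r i j}) := by
  induction hn : {i | r i j}.ncard using Nat.strong_induction_on generalizing j with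
  | _ n ih =>
    have h1 : p j ∈ Submodule.span ℂ (p '' {i | r i j}) := Submodule.subset_span ⟨j, hrefl j, rfl⟩
    have h2 : b j - p j ∈ Submodule.span ℂ (p '' {i | r i j}) := by
      refine Submodule.span_le.mpr ?_ (hp.sub_mem j)
      rintro _ ⟨i, ⟨hij, hne⟩, rfl⟩
      have hsub : {l | r l i} ⊂ {l | r l j} := by
        refine ⟨fun l hl => htrans l i j hl hij, fun hcon => hne ?_⟩
        exact hanti i j hij (hcon (hrefl j))
      have h3 := ih _ (hn ▸ Set.ncard_lt_ncard hsub (hfin j)) i rfl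
      exact Submodule.span_mono (Set.image_mono hsub.subset) h3
    simpa using add_mem h2 h1

include hB in
/-- A symmetric operator that is triangular for `b` is diagonal for `p`. -/
lemma apply_eq_smul (htrans : ∀ i j l, r i j → r j l → r i l)
    (hanti : ∀ i j, r i j → r j i → i = j) {T : V →ₗ[ℂ] V} (hT : ∀ x y, B (T x) y = B x (T y))
    {c : J → ℂ} (htri : ∀ j, T (b j) - c j • b j ∈ Submodule.span ℂ (b '' {i | r i j ∧ i ≠ j}))
    (j : J) : T (p j) = c j • p j := by
  set L := Submodule.span ℂ (b '' {i | r i j ∧ i ≠ j}) with hL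
  have hTL : ∀ x ∈ L, T x ∈ L := by
    intro x hx
    induction hx using Submodule.span_induction with
    | mem x hx =>
      obtain ⟨i, ⟨hij, hne⟩, rfl⟩ := hx
      have h1 : b i ∈ L := Submodule.subset_span ⟨i, ⟨hij, hne⟩, rfl⟩
      have h2 : T (b i) - c i • b i ∈ L := by
        refine Submodule.span_mono (Set.image_mono ?_) (htri i)
        rintro l ⟨hl, hli⟩
        refine ⟨htrans l i j hl hij, fun h => hne ?_⟩
        exact hanti i j hij (h ▸ hl)
      simpa using add_mem h2 (L.smul_mem (c i) h1)
    | zero => simp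
    | add x y _ _ hx hy => rw [map_add]; exact add_mem hx hy
    | smul a x _ hx => rw [map_smul]; exact L.smul_mem a hx
  have hy : T (p j) - c j • p j ∈ L := by
    have h1 := htri j
    have h2 := hp.sub_mem j
    have h3 : T (p j) - c j • p j
        = (T (b j) - c j • b j) - T (b j - p j) + c j • (b j - p j) := by
      rw [map_sub]; module
    rw [h3]
    exact add_mem (_root_.sub_mem h1 (hTL _ h2)) (L.smul_mem _ h2)
  have h4 : ∀ y ∈ L, B y (T (p j) - c j • p j) = 0 := fun y hy => by
    rw [map_sub, map_smul, ← hT, hp.form_eq_zero (hTL _ hy), hp.form_eq_zero hy, smul_zero,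
      sub_zero]
  exact sub_eq_zero.mp (hB.eq_zero _ (h4 _ hy))

end IsGramSchmidt

/-- In an orthogonal expansion only the vectors that are not orthogonal to the sum contribute. -/
lemma mem_span_of_orthogonal {E : J → V} (horth : ∀ i j, i ≠ j → B (E i) (E j) = 0)
    (hne : ∀ i, B (E i) (E i) ≠ 0) {s t : Set J} {x : V} (hx : x ∈ Submodule.span ℂ (E '' s))
    (h : ∀ i ∈ s, i ∉ t → B (E i) x = 0) : x ∈ Submodule.span ℂ (E '' t) := by
  obtain ⟨c, hcs, rfl⟩ := (Finsupp.mem_span_image_iff_linearCombination ℂ).mp hx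
  refine (Finsupp.mem_span_image_iff_linearCombination ℂ).mpr ⟨c, ?_, rfl⟩
  rw [Finsupp.mem_supported] at hcs ⊢
  intro i hi
  by_contra hit
  have h1 := h i (hcs hi) hit
  rw [Finsupp.linearCombination_apply, Finsupp.sum, map_sum, Finset.sum_eq_single i] at h1
  · rw [map_smul, smul_eq_mul, mul_eq_zero] at h1
    exact Finsupp.mem_support_iff.mp hi (h1.resolve_right (hne i))
  · intro j _ hji
    rw [map_smul, horth i j (Ne.symm hji), smul_zero]
  · intro hi'
    exact absurd hi hi'

lemma linearIndependent_of_orthogonal {E : J → V} (horth : ∀ i j, i ≠ j → B (E i) (E j) = 0)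
    (hne : ∀ i, B (E i) (E i) ≠ 0) : LinearIndependent ℂ E := by
  rw [linearIndependent_iff]
  intro c hc
  ext i
  have h1 : B (E i) (Finsupp.linearCombination ℂ E c) = 0 := by rw [hc, map_zero]
  rw [Finsupp.linearCombination_apply, Finsupp.sum, map_sum, Finset.sum_eq_single i] at h1
  · rw [map_smul, smul_eq_mul, mul_eq_zero] at h1
    exact h1.resolve_right (hne i)
  · intro j _ hji
    rw [map_smul, horth i j (Ne.symm hji), smul_zero]
  · intro hi
    simp [Finsupp.notMem_support_iff.mp hi]

end GramSchmidt

/-! ### Triangularity of the Cherednik operators -/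

section Triangularity

open RootPairing TensorProduct

variable {ι M N : Type*} [AddCommGroup M] [Module ℝ M] [AddCommGroup N] [Module ℝ N]
  {R : RootPairing ι ℝ M N}

@[simp] lemma evalC_tmul (m : M) (z : ℂ) (x : N) :
    evalC R m (z ⊗ₜ x) = z * (R.toLinearMap m x : ℂ) := by
  simp [evalC]

/-- The real linear map `m ↦ m(ξ)` for `ξ ∈ 𝔥`. -/
noncomputable def evalCHom (R : RootPairing ι ℝ M N) (ξ : ℂ ⊗[ℝ] N) : M →ₗ[ℝ] ℂ where
  toFun m := evalC R m ξ
  map_add' a b := by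
    induction ξ with
    | zero => simp
    | tmul z x => simp; ring
    | add x y hx hy => rw [map_add, hx, hy, map_add, map_add]; ring
  map_smul' c a := by
    induction ξ with
    | zero => simp
    | tmul z x => simp; ring
    | add x y hx hy => rw [map_add, hx, hy, map_add, smul_add]

lemma evalCHom_apply (ξ : ℂ ⊗[ℝ] N) (m : M) : evalCHom R ξ m = evalC R m ξ := rfl

variable [R.IsCrystallographic] {Δ : SimpleSystem R}

/-- The span of the monomials `e^ν` with `ν < μ`. -/
noncomputable def lowerSpan (Δ : SimpleSystem R) (μ : weightLattice R) : Submodule ℂ (Laurent R) :=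
  Submodule.span ℂ (mono '' {ν | weightLE Δ ν μ ∧ ν ≠ μ})

lemma mono_mem_lowerSpan {μ ν : weightLattice R} (h : weightLE Δ ν μ ∧ ν ≠ μ) :
    mono ν ∈ lowerSpan Δ μ := Submodule.subset_span ⟨ν, h, rfl⟩

variable [R.IsRootSystem] [Fintype ι] {k : ι → ℝ}

/-- The divided difference of `e^μ` is a sum over part of the `α`-string of `μ`, in which `e^μ`
itself occurs if `⟨μ, α^∨⟩ > 0`, while all other weights are smaller than `μ`. -/
lemma divDiff_mono_sub_mem {i : ι} (hi : Δ.IsPos i) (μ : weightLattice R) :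
    divDiff R i (mono μ) - (if 0 < pairInt R μ i then (1 : ℂ) else 0) • mono μ
      ∈ lowerSpan Δ μ := by
  rw [divDiff, linExt_mono]
  rcases lt_or_ge 0 (pairInt R μ i) with h | h
  · obtain ⟨n, hn⟩ := Int.eq_ofNat_of_zero_le h.le
    obtain ⟨m, rfl⟩ : ∃ m, n = m + 1 := ⟨n - 1, by omega⟩
    have h1 : (-pairInt R μ i).toNat = 0 := by omega
    have h2 : (pairInt R μ i).toNat = m + 1 := by omega
    rw [h1, h2, if_pos h, Finset.sum_range_succ']
    simp only [Finset.range_zero, Finset.sum_empty, zero_smul, sub_zero, one_smul,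
      add_sub_cancel_right]
    refine sum_mem fun a ha => mono_mem_lowerSpan ?_
    have ha' := Finset.mem_range.mp ha
    refine weightLE_string (j := i) (a := a + 1) (b := m - a) (by omega) (by omega) rfl ?_
    rw [pairInt_spec, hn]
    push_cast [ha'.le]
    ring
  · obtain ⟨n, hn⟩ := Int.eq_ofNat_of_zero_le (neg_nonneg.mpr h)
    have h1 : (-pairInt R μ i).toNat = n := by omega
    have h2 : (pairInt R μ i).toNat = 0 := by omega
    rw [h1, h2, if_neg (not_lt.mpr h)]
    simp only [Finset.range_zero, Finset.sum_empty, zero_smul, sub_zero, zero_sub]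
    refine neg_mem (sum_mem fun a ha => mono_mem_lowerSpan ?_)
    have ha' := Finset.mem_range.mp ha
    by_cases han : a + 1 = n
    · -- the last term of the sum is the reflected weight
      have hneg : R.coroot' i (μ : M) < 0 := by
        rw [pairInt_spec]; exact_mod_cast (by omega : pairInt R μ i < 0)
      have hs : μ + (a + 1) • rootWt R i = weylGroup.ofIdx R i • μ := by
        apply Subtype.ext
        change (μ : M) + (a + 1) • R.root i = weylGroup.ofIdx R i • (μ : M)
        rw [ofIdx_smul_vec, pairInt_spec, show pairInt R μ i = -((a + 1 : ℕ) : ℤ) by omega]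
        rw [Int.cast_neg, neg_smul, sub_neg_eq_add, Int.cast_natCast, Nat.cast_smul_eq_nsmul]
      rw [hs]
      refine ⟨weightLE_reflection hi hneg.le, fun heq => ?_⟩
      have h3 := congrArg Subtype.val heq
      rw [coe_smul_weight, ofIdx_smul_vec, sub_eq_self, smul_eq_zero] at h3
      exact h3.elim hneg.ne (R.ne_zero i)
    · refine weightLE_string (j := negIdx R i) (a := a + 1) (b := n - (a + 1)) (by omega) (by omega)
        ?_ ?_
      · change (μ : M) + (a + 1) • R.root i = _
        rw [root_negIdx, smul_neg, sub_neg_eq_add]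
      · have h3 : (pairInt R μ (negIdx R i) : ℝ) = n := by rw [pairInt_negIdx, hn]; simp
        rw [pairInt_spec, h3, Nat.cast_sub (by omega)]
        ring

/-- The Cherednik operators are triangular with respect to the monomials, with the spectral
parameters on the diagonal. -/
lemma cherednik_mono_sub_mem (ξ : ℂ ⊗[ℝ] N) (μ : weightLattice R) :
    cherednik Δ k ξ (mono μ) - evalC R (spectral Δ k μ) ξ • mono μ ∈ lowerSpan Δ μ := by
  classical
  have hspec : evalC R (spectral Δ k μ) ξ = evalC R (μ : M) ξ + ∑ i, (if Δ.IsPos i then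
      ((k i : ℂ) * evalC R (R.root i) ξ) * (if 0 < pairInt R μ i then (1 : ℂ) else 0) else 0)
      - evalC R (rho Δ k) ξ := by
    simp only [← evalCHom_apply]
    rw [spectral, rho, map_add, map_smul, map_smul, map_sum, map_sum, add_sub_assoc,
      Finset.smul_sum, Finset.smul_sum, ← Finset.sum_sub_distrib]
    congr 1
    refine Finset.sum_congr rfl fun i _ => ?_
    split_ifs <;> simp; ring
  have hch : cherednik Δ k ξ (mono μ) - evalC R (spectral Δ k μ) ξ • mono μ
      = ∑ i, (if Δ.IsPos i then ((k i : ℂ) * evalC R (R.root i) ξ) •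
        (divDiff R i (mono μ) - (if 0 < pairInt R μ i then (1 : ℂ) else 0) • mono μ) else 0) := by
    rw [hspec, cherednik, LinearMap.sub_apply, LinearMap.add_apply, LinearMap.sum_apply,
      partialXi, linExt_mono, LinearMap.smul_apply, LinearMap.id_apply, sub_smul, add_smul,
      Finset.sum_smul, add_sub_assoc, add_sub_assoc]
    have : ∀ i, (if Δ.IsPos i then ((k i : ℂ) * evalC R (R.root i) ξ) •
        (divDiff R i (mono μ) - (if 0 < pairInt R μ i then (1 : ℂ) else 0) • mono μ) else 0)
        = (if Δ.IsPos i then ((k i : ℂ) * evalC R (R.root i) ξ) • divDiff R i else 0) (mono μ)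
          - (if Δ.IsPos i then ((k i : ℂ) * evalC R (R.root i) ξ) *
            (if 0 < pairInt R μ i then (1 : ℂ) else 0) else 0) • mono μ := fun i => by
      by_cases h : Δ.IsPos i
      · simp only [if_pos h, smul_sub, smul_smul, LinearMap.smul_apply]
      · simp [h]
    simp only [this, Finset.sum_sub_distrib]
    abel
  rw [hch]
  refine sum_mem fun i _ => ?_
  by_cases h : Δ.IsPos i
  · rw [if_pos h]
    exact Submodule.smul_mem _ _ (divDiff_mono_sub_mem h μ)
  · rw [if_neg h]
    exact zero_mem _

end Triangularity

/-! ### Laurent polynomials as functions on the torus -/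

section TorusFunctions

open RootPairing TensorProduct

open scoped ComplexConjugate

variable {ι M N : Type*} [AddCommGroup M] [Module ℝ M] [NormedAddCommGroup N] [NormedSpace ℝ N]
  {R : RootPairing ι ℝ M N}

/-- The projection from `𝔞` to the torus. -/
noncomputable def toTorus (R : RootPairing ι ℝ M N) : N →+ Torus R := QuotientAddGroup.mk' _

lemma toTorus_surjective : Function.Surjective (toTorus R) := QuotientAddGroup.mk'_surjective _

lemma continuous_toTorus : Continuous (toTorus R) :=
  continuous_quotient_mk'

lemma expFun_toTorus (μ : weightLattice R) (x : N) :
    expFun R μ (toTorus R x) = Complex.exp (R.toLinearMap (μ : M) x * Complex.I) :=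
  Circle.coe_exp _

lemma expFun_add (μ ν : weightLattice R) (t : Torus R) :
    expFun R (μ + ν) t = expFun R μ t * expFun R ν t := by
  obtain ⟨x, rfl⟩ := toTorus_surjective t
  simp only [expFun_toTorus, ← Complex.exp_add]
  congr 1
  simp [add_mul]

lemma expFun_zero (t : Torus R) : expFun R 0 t = 1 := by
  obtain ⟨x, rfl⟩ := toTorus_surjective t
  simp [expFun_toTorus]

lemma expFun_neg (μ : weightLattice R) (t : Torus R) : expFun R (-μ) t = conj (expFun R μ t) := by
  obtain ⟨x, rfl⟩ := toTorus_surjective t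
  simp only [expFun_toTorus, ← Complex.exp_conj]
  simp

lemma norm_expFun (μ : weightLattice R) (t : Torus R) : ‖expFun R μ t‖ = 1 :=
  Circle.norm_coe _

lemma expFun_add_torus (μ : weightLattice R) (s t : Torus R) :
    expFun R μ (s + t) = expFun R μ s * expFun R μ t := by
  rw [expFun, map_add]; rfl

lemma continuous_expFun (μ : weightLattice R) [FiniteDimensional ℝ N] :
    Continuous (expFun R μ) := by
  refine Continuous.comp (g := ((↑) : Circle → ℂ)) continuous_subtype_val ?_
  refine continuous_quot_lift _ ?_
  refine Circle.exp.continuous.comp ?_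
  exact LinearMap.continuous_of_finiteDimensional (R.toLinearMap (μ : M))

/-- Evaluation at a point of the torus, as an algebra homomorphism on `ℂ[P]`. -/
noncomputable def evalHom (t : Torus R) : Laurent R →ₐ[ℂ] ℂ :=
  AddMonoidAlgebra.lift ℂ ℂ _
    { toFun := fun μ => expFun R μ.toAdd t
      map_one' := expFun_zero t
      map_mul' := fun μ ν => expFun_add μ.toAdd ν.toAdd t }

lemma evalTorus_eq (f : Laurent R) (t : Torus R) : evalTorus f t = evalHom t f := by
  rw [evalHom, AddMonoidAlgebra.lift_apply, evalTorus]
  rfl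

@[simp] lemma evalHom_mono (μ : weightLattice R) (t : Torus R) :
    evalHom t (mono μ) = expFun R μ t := by
  simp [evalHom, mono]

/-- To prove a linear property of Laurent polynomials it suffices to consider monomials. -/
lemma laurent_induction {p : Laurent R → Prop} (f : Laurent R) (zero : p 0)
    (mono : ∀ μ, p (mono μ)) (add : ∀ f g, p f → p g → p (f + g))
    (smul : ∀ (c : ℂ) f, p f → p (c • f)) : p f := by
  induction f using AddMonoidAlgebra.induction_linear with
  | zero => exact zero
  | add f g hf hg => exact add f g hf hg
  | single μ c =>
    have : AddMonoidAlgebra.single μ c = c • ParabolicJacobi.mono μ := by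
      simp [ParabolicJacobi.mono]
    rw [this]
    exact smul c _ (mono μ)

lemma laurent_hom_ext {V : Type*} [AddCommGroup V] [Module ℂ V] {f g : Laurent R →ₗ[ℂ] V}
    (h : ∀ μ, f (mono μ) = g (mono μ)) : f = g := by
  refine LinearMap.ext fun x => ?_
  refine laurent_induction (p := fun x => f x = g x) x (by simp) h ?_ ?_
  · intro a b ha hb; rw [map_add, map_add, ha, hb]
  · intro c a ha; rw [map_smul, map_smul, ha]

lemma continuous_evalHom (f : Laurent R) [FiniteDimensional ℝ N] :
    Continuous fun t : Torus R => evalHom t f := by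
  refine laurent_induction (p := fun f => Continuous fun t : Torus R => evalHom t f) f ?_ ?_ ?_ ?_
  · simpa using continuous_const
  · intro μ; simpa using continuous_expFun μ
  · intro f g hf hg; exact (hf.add hg).congr fun t => (map_add _ f g).symm
  · intro c f hf; exact (hf.const_smul c).congr fun t => (map_smul _ c f).symm

/-- The conjugation `c e^μ ↦ c̄ e^{-μ}` of `ℂ[P]`, which is complex conjugation on the torus. -/
noncomputable def conjL (R : RootPairing ι ℝ M N) : Laurent R →+* Laurent R :=
  (AddMonoidAlgebra.mapDomainRingHom ℂ (-AddMonoidHom.id (weightLattice R))).comp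
    (AddMonoidAlgebra.mapRingHom _ (starRingEnd ℂ))

@[simp] lemma conjL_mono (μ : weightLattice R) : conjL R (mono μ) = mono (-μ) := by
  simp [conjL, mono]

@[simp] lemma conjL_smul (c : ℂ) (f : Laurent R) : conjL R (c • f) = conj c • conjL R f := by
  rw [Algebra.smul_def, map_mul, Algebra.smul_def]
  congr 1
  simp [conjL]

lemma evalHom_conjL (f : Laurent R) (t : Torus R) : evalHom t (conjL R f) = conj (evalHom t f) := by
  refine laurent_induction (p := fun f => evalHom t (conjL R f) = conj (evalHom t f)) f ?_ ?_ ?_ ?_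
  · simp
  · intro μ; simp [expFun_neg]
  · intro f g hf hg; simp [hf, hg]
  · intro c f hf; simp [hf]

lemma expFun_injective : Function.Injective (expFun R) := by
  intro μ ν h
  by_contra hne
  have h0 : (μ : M) - (ν : M) ≠ 0 := fun h => hne (Subtype.ext (sub_eq_zero.mp h))
  obtain ⟨x, hx⟩ : ∃ x : N, R.toLinearMap ((μ : M) - ν) x ≠ 0 := by
    by_contra! hcon
    exact h0 (R.toPerfPair.injective (LinearMap.ext fun x => by simpa using hcon x))
  set c := R.toLinearMap ((μ : M) - ν) x with hc
  have h1 := congrFun h (toTorus R ((Real.pi / c) • x))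
  have h2 : expFun R (μ - ν) (toTorus R ((Real.pi / c) • x)) = 1 := by
    rw [sub_eq_add_neg, expFun_add, h1, expFun_neg, Complex.mul_conj, Complex.normSq_eq_norm_sq,
      norm_expFun]
    simp
  rw [expFun_toTorus, map_smul, smul_eq_mul] at h2
  change Complex.exp (((Real.pi / c * c : ℝ) : ℂ) * Complex.I) = 1 at h2
  rw [div_mul_cancel₀ _ hx, Complex.exp_pi_mul_I] at h2
  norm_num at h2

/-- A non-zero Laurent polynomial does not vanish identically on the torus. -/
lemma exists_evalHom_ne_zero {f : Laurent R} (hf : f ≠ 0) : ∃ t : Torus R, evalHom t f ≠ 0 := by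
  by_contra! hcon
  let χ : weightLattice R → (Multiplicative (Torus R) →* ℂ) := fun μ =>
    { toFun := fun t => expFun R μ t.toAdd
      map_one' := by
        change expFun R μ 0 = 1
        rw [expFun, map_zero]; rfl
      map_mul' := fun s t => expFun_add_torus μ s.toAdd t.toAdd }
  have hχ : Function.Injective χ := fun μ ν h => expFun_injective (funext fun t =>
    DFunLike.congr_fun h (Multiplicative.ofAdd t))
  have hli := (linearIndependent_monoidHom (Multiplicative (Torus R)) ℂ).comp χ hχ
  rw [linearIndependent_iff] at hli
  refine hf (AddMonoidAlgebra.coeff_injective (hli f.coeff ?_))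
  funext t
  have := hcon t.toAdd
  rw [← evalTorus_eq, evalTorus] at this
  rw [Finsupp.linearCombination_apply, Finsupp.sum, Finset.sum_apply]
  exact this

instance : NoZeroDivisors (Laurent R) :=
  have : TwoUniqueSums (weightLattice R) :=
    letI : Module ℚ M := Module.compHom M (algebraMap ℚ ℝ)
    TwoUniqueSums.of_injective_addHom (weightLattice R).subtype.toAddHom
      Subtype.val_injective inferInstance
  inferInstance

end TorusFunctions

/-! ### Reflections and integration on the torus -/

section TorusIntegration

open RootPairing TensorProduct MeasureTheory

open scoped ComplexConjugate

variable {ι M N : Type*} [AddCommGroup M] [Module ℝ M] [NormedAddCommGroup N] [NormedSpace ℝ N]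
  {R : RootPairing ι ℝ M N}

lemma compactSpace_torus [Finite ι] [R.IsRootSystem] : CompactSpace (Torus R) := by
  have := Fintype.ofFinite ι
  -- the torus is the image of a cube spanned by the generators of the lattice
  let φ : (ι → ℝ) → Torus R := fun c => toTorus R (∑ i, c i • ((2 * Real.pi) • R.coroot i))
  have hφ : Continuous φ := continuous_toTorus.comp (by fun_prop)
  have hK : IsCompact (Set.Icc (0 : ι → ℝ) 1) := isCompact_Icc
  refine ⟨?_⟩
  convert hK.image hφ
  refine (Set.eq_univ_of_forall fun t => ?_).symm
  obtain ⟨x, rfl⟩ := toTorus_surjective t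
  have hx : x ∈ Submodule.span ℝ (Set.range R.coroot) := by
    rw [IsRootSystem.span_coroot_eq_top]; trivial
  obtain ⟨c, hc⟩ := (Submodule.mem_span_range_iff_exists_fun ℝ).mp hx
  refine ⟨fun i => Int.fract (c i / (2 * Real.pi)), ⟨fun i => Int.fract_nonneg _,
    fun i => (Int.fract_lt_one _).le⟩, ?_⟩
  have hpi : (2 * Real.pi) ≠ 0 := by positivity
  have h1 : x = ∑ i, Int.fract (c i / (2 * Real.pi)) • ((2 * Real.pi) • R.coroot i)
      + ∑ i, ⌊c i / (2 * Real.pi)⌋ • ((2 * Real.pi) • R.coroot i) := by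
    rw [← hc, ← Finset.sum_add_distrib]
    refine Finset.sum_congr rfl fun i _ => ?_
    rw [← Int.cast_smul_eq_zsmul ℝ, ← add_smul, Int.fract_add_floor, smul_smul,
      div_mul_cancel₀ _ hpi]
  have h2 : toTorus R (∑ i, ⌊c i / (2 * Real.pi)⌋ • ((2 * Real.pi) • R.coroot i)) = 0 := by
    refine (QuotientAddGroup.eq_zero_iff _).mpr (sum_mem fun i _ => zsmul_mem ?_ _)
    exact AddSubgroup.subset_closure ⟨i, rfl⟩
  conv_rhs => rw [h1, map_add, h2, add_zero]

/-- The action of a reflection on the torus. -/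
noncomputable def torusRefl (R : RootPairing ι ℝ M N) (i : ι) : Torus R →+ Torus R :=
  QuotientAddGroup.map (torusLattice R) (torusLattice R)
    (R.coreflection i).toLinearMap.toAddMonoidHom <| by
      rw [torusLattice, AddSubgroup.closure_le]
      rintro _ ⟨j, rfl⟩
      refine AddSubgroup.subset_closure ⟨R.reflectionPerm i j, ?_⟩
      simp

lemma torusRefl_toTorus (i : ι) (x : N) :
    torusRefl R i (toTorus R x) = toTorus R (R.coreflection i x) := rfl

lemma torusRefl_torusRefl (i : ι) (t : Torus R) : torusRefl R i (torusRefl R i t) = t := by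
  obtain ⟨x, rfl⟩ := toTorus_surjective t
  rw [torusRefl_toTorus, torusRefl_toTorus, coreflection_same]

lemma expFun_torusRefl [R.IsCrystallographic] (i : ι) (μ : weightLattice R) (t : Torus R) :
    expFun R μ (torusRefl R i t) = expFun R (weylGroup.ofIdx R i • μ) t := by
  obtain ⟨x, rfl⟩ := toTorus_surjective t
  rw [torusRefl_toTorus, expFun_toTorus, expFun_toTorus, coe_smul_weight, ofIdx_smul_vec,
    coreflection_apply]
  congr 3
  simp only [map_sub, map_smul, LinearMap.sub_apply, LinearMap.smul_apply, smul_eq_mul]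
  exact congrArg _ (mul_comm _ _)

lemma weylAct_mono [R.IsCrystallographic] (w : R.weylGroup) (μ : weightLattice R) :
    weylAct R w (mono μ) = mono (w • μ) := by
  simp [weylAct, mono]

lemma evalHom_torusRefl [R.IsCrystallographic] (i : ι) (f : Laurent R) (t : Torus R) :
    evalHom (torusRefl R i t) f = evalHom t (weylAct R (weylGroup.ofIdx R i) f) := by
  refine laurent_induction (p := fun f => evalHom (torusRefl R i t) f
    = evalHom t (weylAct R (weylGroup.ofIdx R i) f)) f ?_ ?_ ?_ ?_
  · simp
  · intro μ; rw [weylAct_mono, evalHom_mono, evalHom_mono, expFun_torusRefl]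
  · intro f g hf hg; simp only [map_add, hf, hg]
  · intro c f hf; simp only [map_smul, hf]

lemma continuous_torusRefl [FiniteDimensional ℝ N] (i : ι) : Continuous (torusRefl R i) := by
  refine continuous_quot_lift _ ?_
  exact continuous_toTorus.comp
    (LinearMap.continuous_of_finiteDimensional (R.coreflection i).toLinearMap)

variable [Fintype ι] [R.IsRootSystem]

lemma exists_norm_le_of_continuous {E : Type*} [NormedAddCommGroup E]
    {f : Torus R → E} (hf : Continuous f) : ∃ C, ∀ t, ‖f t‖ ≤ C := by
  have := compactSpace_torus (R := R)
  obtain ⟨C, hC⟩ := isCompact_univ.exists_bound_of_continuousOn hf.continuousOn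
  exact ⟨C, fun t => hC t trivial⟩

variable [FiniteDimensional ℝ N]

lemma integral_torusRefl {E : Type*} [NormedAddCommGroup E] [NormedSpace ℝ E] (i : ι)
    (f : Torus R → E) :
    ∫ t, f (torusRefl R i t) ∂Measure.addHaar = ∫ t : Torus R, f t ∂Measure.addHaar := by
  have := compactSpace_torus (R := R)
  have hsurj : Function.Surjective (torusRefl R i) := fun t => ⟨_, torusRefl_torusRefl i t⟩
  have hmp : MeasurePreserving (torusRefl R i) (Measure.addHaar : Measure (Torus R))
      Measure.addHaar :=
    AddMonoidHom.measurePreserving (continuous_torusRefl i) hsurj rfl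
  let e : Torus R ≃ₜ Torus R :=
    { toFun := torusRefl R i
      invFun := torusRefl R i
      left_inv := torusRefl_torusRefl i
      right_inv := torusRefl_torusRefl i
      continuous_toFun := continuous_torusRefl i
      continuous_invFun := continuous_torusRefl i }
  exact hmp.integral_comp e.measurableEmbedding f

lemma integrable_of_continuous {E : Type*} [NormedAddCommGroup E] [SecondCountableTopology E]
    {f : Torus R → E} (hf : Continuous f) : Integrable f Measure.addHaar := by
  have := compactSpace_torus (R := R)
  exact hf.integrable_of_hasCompactSupport (HasCompactSupport.of_compactSpace f)

/-- The integral of a derivative in the direction of `x` vanishes. -/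
lemma integral_eq_zero_of_hasDerivAt (x : N) {h h' : Torus R → ℂ} (hh : Continuous h)
    (hh' : Continuous h')
    (hd : ∀ (t : Torus R) (s : ℝ), HasDerivAt (fun s : ℝ => h (t + toTorus R (s • x)))
      (h' (t + toTorus R (s • x))) s) :
    ∫ t, h' t ∂Measure.addHaar = 0 := by
  obtain ⟨C, hC⟩ := exists_norm_le_of_continuous hh'
  have hadd : ∀ s : ℝ, Continuous fun t : Torus R => t + toTorus R (s • x) := fun s => by fun_prop
  have key := (hasDerivAt_integral_of_dominated_loc_of_deriv_le (μ := Measure.addHaar)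
    (F := fun (s : ℝ) (t : Torus R) => h (t + toTorus R (s • x)))
    (F' := fun (s : ℝ) (t : Torus R) => h' (t + toTorus R (s • x)))
    (x₀ := 0) (bound := fun _ => C) Filter.univ_mem
    (Filter.Eventually.of_forall fun s => (hh.comp (hadd s)).aestronglyMeasurable)
    (integrable_of_continuous (hh.comp (hadd 0)))
    (hh'.comp (hadd 0)).aestronglyMeasurable
    (Filter.Eventually.of_forall fun t s _ => hC _)
    (integrable_of_continuous continuous_const)
    (Filter.Eventually.of_forall fun t s _ => hd t s)).2
  have hconst : (fun s : ℝ => ∫ t, h (t + toTorus R (s • x)) ∂Measure.addHaar)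
      = fun _ => ∫ t : Torus R, h t ∂Measure.addHaar :=
    funext fun s => integral_add_right_eq_self h _
  rw [hconst] at key
  have := key.unique (hasDerivAt_const _ _)
  simpa using this

end TorusIntegration

/-! ### The regularised weight function -/

section IntegrationByParts

open RootPairing TensorProduct MeasureTheory Filter Topology

open scoped ComplexConjugate

variable {ι M N : Type*} [AddCommGroup M] [Module ℝ M] [NormedAddCommGroup N] [NormedSpace ℝ N]
  {R : RootPairing ι ℝ M N}

lemma hasDerivAt_expFun (μ : weightLattice R) (x : N) (t : Torus R) (s : ℝ) :
    HasDerivAt (fun s : ℝ => expFun R μ (t + toTorus R (s • x)))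
      (Complex.I * ((R.toLinearMap (μ : M) x : ℂ) * expFun R μ (t + toTorus R (s • x)))) s := by
  simp only [expFun_add_torus, expFun_toTorus, map_smul, smul_eq_mul, Complex.ofReal_mul]
  have h1 : HasDerivAt (fun s : ℝ => (s : ℂ) * (R.toLinearMap (μ : M) x : ℂ) * Complex.I)
      (1 * (R.toLinearMap (μ : M) x : ℂ) * Complex.I) s :=
    ((HasDerivAt.ofReal_comp (hasDerivAt_id s)).mul_const _).mul_const _
  exact (h1.cexp.const_mul (expFun R μ t)).congr_deriv (by ring)

lemma hasDerivAt_evalHom (f : Laurent R) (x : N) (t : Torus R) (s : ℝ) :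
    HasDerivAt (fun s : ℝ => evalHom (t + toTorus R (s • x)) f)
      (Complex.I * evalHom (t + toTorus R (s • x)) (partialXi R (1 ⊗ₜ x) f)) s := by
  refine laurent_induction (p := fun f => HasDerivAt
      (fun s : ℝ => evalHom (t + toTorus R (s • x)) f)
      (Complex.I * evalHom (t + toTorus R (s • x)) (partialXi R (1 ⊗ₜ x) f)) s) f ?_ ?_ ?_ ?_
  · simpa using hasDerivAt_const _ _
  · intro μ
    simpa only [partialXi, linExt_mono, evalC_tmul, one_mul, map_smul, smul_eq_mul, evalHom_mono]
      using hasDerivAt_expFun μ x t s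
  · intro f g hf hg
    simp only [map_add, mul_add]
    exact hf.add hg
  · intro c f hf
    simp only [map_smul, smul_eq_mul]
    rw [mul_left_comm]
    exact hf.const_mul c

variable [R.IsCrystallographic]

/-- The function `|e^{α/2} - e^{-α/2}|² = |1 - e^{-α}|²` on the torus. -/
noncomputable def rootNormSq (R : RootPairing ι ℝ M N) [R.IsCrystallographic] (i : ι)
    (t : Torus R) : ℝ := ‖1 - expFun R (-rootWt R i) t‖ ^ 2

lemma rootNormSq_nonneg (i : ι) (t : Torus R) : 0 ≤ rootNormSq R i t := sq_nonneg _

lemma rootNormSq_eq (i : ι) (t : Torus R) :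
    rootNormSq R i t = 2 - 2 * (expFun R (rootWt R i) t).re := by
  have h := norm_expFun (R := R) (rootWt R i) t
  rw [← sq_eq_sq₀ (norm_nonneg _) zero_le_one, ← Complex.normSq_eq_norm_sq,
    Complex.normSq_apply] at h
  rw [rootNormSq, expFun_neg, ← Complex.normSq_eq_norm_sq, Complex.normSq_apply]
  simp
  linarith

lemma rootNormSq_le (i : ι) (t : Torus R) : rootNormSq R i t ≤ 4 := by
  have h := norm_expFun (R := R) (rootWt R i) t
  have := Complex.abs_re_le_norm (expFun R (rootWt R i) t)
  rw [h] at this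
  rw [rootNormSq_eq]
  linarith [(abs_le.mp this).1]

/-- On the torus, `|1 - e^{-α}|² = (1 - e^{-α})(1 - e^α)`. -/
lemma rootNormSq_eq_mul (i : ι) (t : Torus R) : (rootNormSq R i t : ℂ) =
    (1 - expFun R (-rootWt R i) t) * (1 - expFun R (rootWt R i) t) := by
  have : 1 - expFun R (rootWt R i) t = conj (1 - expFun R (-rootWt R i) t) := by
    rw [expFun_neg]; simp
  rw [this, Complex.mul_conj, rootNormSq, Complex.normSq_eq_norm_sq]

lemma rootWt_smul (w : R.weylGroup) (i : ι) : rootWt R (w • i) = w • rootWt R i :=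
  Subtype.ext (root_smul_idx w i)

lemma weight_smul_neg (w : R.weylGroup) (μ : weightLattice R) : w • (-μ) = -(w • μ) :=
  Subtype.ext (weyl_smul_neg w μ)

lemma expFun_neg_rootWt_torusRefl (i j : ι) (t : Torus R) :
    expFun R (-rootWt R j) (torusRefl R i t)
      = expFun R (-rootWt R (weylGroup.ofIdx R i • j)) t := by
  rw [expFun_torusRefl, rootWt_smul, weight_smul_neg]

lemma continuous_rootNormSq [FiniteDimensional ℝ N] (i : ι) : Continuous (rootNormSq R i) :=
  ((continuous_const.sub (continuous_expFun _)).norm).pow 2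

lemma continuous_im_div [FiniteDimensional ℝ N] {ε : ℝ} (hε : 0 < ε) (i : ι) :
    Continuous fun t : Torus R => (expFun R (rootWt R i) t).im / (rootNormSq R i t + ε) := by
  refine (Complex.continuous_im.comp (continuous_expFun _)).div
    ((continuous_rootNormSq i).add continuous_const) fun t => ?_
  exact (by linarith [rootNormSq_nonneg (R := R) i t] : (0 : ℝ) < _).ne'

variable [Fintype ι] {k : ι → ℝ}

/-- The regularisation `∏_α (|1 - e^{-α}|² + ε)^{k_α/2}` of the weight function, which is smooth
for `ε > 0`; it is written as an exponential, whose derivative is the easiest to compute. -/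
noncomputable def weightReg (R : RootPairing ι ℝ M N) [R.IsCrystallographic] (k : ι → ℝ) (ε : ℝ)
    (t : Torus R) : ℝ := Real.exp (∑ i, k i / 2 * Real.log (rootNormSq R i t + ε))

lemma weightReg_eq_prod {ε : ℝ} (hε : 0 < ε) (t : Torus R) :
    weightReg R k ε t = ∏ i, (rootNormSq R i t + ε) ^ (k i / 2) := by
  rw [weightReg, Real.exp_sum]
  refine Finset.prod_congr rfl fun i _ => ?_
  rw [Real.rpow_def_of_pos (by linarith [rootNormSq_nonneg (R := R) i t]), mul_comm]

lemma weightFun_eq_prod (t : Torus R) :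
    weightFun R k t = ∏ i, (rootNormSq R i t) ^ (k i / 2) := by
  refine Finset.prod_congr rfl fun i _ => ?_
  rw [rootNormSq, ← Real.rpow_natCast, ← Real.rpow_mul (norm_nonneg _)]
  congr 1
  push_cast
  ring

lemma weightFun_nonneg (t : Torus R) : 0 ≤ weightFun R k t :=
  Finset.prod_nonneg fun _ _ => Real.rpow_nonneg (norm_nonneg _) _

lemma weightReg_pos (ε : ℝ) (t : Torus R) : 0 < weightReg R k ε t := Real.exp_pos _

lemma weightFun_torusRefl (hk : ∀ i j, k (R.reflectionPerm i j) = k j) (i : ι) (t : Torus R) :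
    weightFun R k (torusRefl R i t) = weightFun R k t := by
  refine Fintype.prod_bijective (fun j => weylGroup.ofIdx R i • j) (MulAction.bijective _) _ _
    fun j => ?_
  rw [expFun_neg_rootWt_torusRefl, multiplicity_smul hk]

lemma weightReg_torusRefl (hk : ∀ i j, k (R.reflectionPerm i j) = k j) (ε : ℝ) (i : ι)
    (t : Torus R) : weightReg R k ε (torusRefl R i t) = weightReg R k ε t := by
  refine congrArg Real.exp ?_
  refine Fintype.sum_bijective (fun j => weylGroup.ofIdx R i • j) (MulAction.bijective _) _ _
    fun j => ?_
  rw [rootNormSq, expFun_neg_rootWt_torusRefl, multiplicity_smul hk, rootNormSq]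

lemma tendsto_weightReg (hk0 : ∀ i, 0 ≤ k i) (t : Torus R) {e : ℕ → ℝ} (he : ∀ n, 0 < e n)
    (hlim : Tendsto e atTop (𝓝 0)) :
    Tendsto (fun n => weightReg R k (e n) t) atTop (𝓝 (weightFun R k t)) := by
  simp only [weightReg_eq_prod (he _), weightFun_eq_prod]
  refine tendsto_finsetProd _ fun i _ => ?_
  have h1 := (Real.continuous_rpow_const (q := k i / 2) (by linarith [hk0 i])).tendsto
    (rootNormSq R i t)
  refine h1.comp ?_
  simpa using hlim.const_add (rootNormSq R i t)

lemma weightReg_le (hk0 : ∀ i, 0 ≤ k i) {ε : ℝ} (hε : 0 < ε) (hε1 : ε ≤ 1) (t : Torus R) :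
    weightReg R k ε t ≤ ∏ i, (5 : ℝ) ^ (k i / 2) := by
  rw [weightReg_eq_prod hε]
  refine Finset.prod_le_prod (fun i _ => Real.rpow_nonneg
    (by linarith [rootNormSq_nonneg (R := R) i t]) _) fun i _ => ?_
  exact Real.rpow_le_rpow (by linarith [rootNormSq_nonneg (R := R) i t])
    (by linarith [rootNormSq_le (R := R) i t]) (by linarith [hk0 i])

lemma hasDerivAt_weightReg {ε : ℝ} (hε : 0 < ε) (x : N) (t : Torus R) (s : ℝ) :
    HasDerivAt (fun s : ℝ => weightReg R k ε (t + toTorus R (s • x)))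
      (weightReg R k ε (t + toTorus R (s • x)) *
        ∑ i, k i * (R.toLinearMap (R.root i) x * (expFun R (rootWt R i) (t + toTorus R (s • x))).im)
          / (rootNormSq R i (t + toTorus R (s • x)) + ε)) s := by
  refine HasDerivAt.exp ?_
  refine HasDerivAt.fun_sum fun i _ => ?_
  have h1 : HasDerivAt (fun s : ℝ => rootNormSq R i (t + toTorus R (s • x)))
      (2 * (R.toLinearMap (R.root i) x *
        (expFun R (rootWt R i) (t + toTorus R (s • x))).im)) s := by
    simp only [rootNormSq_eq]
    have h2 := hasDerivAt_expFun (rootWt R i) x t s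
    have h3 : HasDerivAt (fun s : ℝ => (expFun R (rootWt R i) (t + toTorus R (s • x))).re)
        (Complex.I * ((R.toLinearMap ((rootWt R i : weightLattice R) : M) x : ℂ) *
          expFun R (rootWt R i) (t + toTorus R (s • x)))).re s :=
      Complex.reCLM.hasFDerivAt.comp_hasDerivAt s h2
    refine ((h3.const_mul 2).const_sub 2).congr_deriv ?_
    have : ((rootWt R i : weightLattice R) : M) = R.root i := rfl
    rw [this]
    simp
  have h4 := (h1.add_const ε).log
    (by linarith [rootNormSq_nonneg (R := R) i (t + toTorus R (s • x))] : (0 : ℝ) < _).ne'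
  exact (h4.const_mul (k i / 2)).congr_deriv (by ring)

variable [FiniteDimensional ℝ N]

lemma continuous_weightReg {ε : ℝ} (hε : 0 < ε) : Continuous (weightReg R k ε) := by
  refine Real.continuous_exp.comp (continuous_finsetSum _ fun i _ => continuous_const.mul ?_)
  refine ((continuous_rootNormSq i).add continuous_const).log fun t => ?_
  exact (by linarith [rootNormSq_nonneg (R := R) i t] : (0 : ℝ) < rootNormSq R i t + ε).ne'

lemma continuous_weightFun (hk0 : ∀ i, 0 ≤ k i) : Continuous (weightFun R k) :=
  continuous_finsetProd _ fun i _ =>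
    (continuous_const.sub (continuous_expFun _)).norm.rpow_const fun _ => Or.inr (hk0 i)

variable [R.IsRootSystem]

/-- Integration by parts for the regularised weight. -/
lemma integral_weightReg {ε : ℝ} (hε : 0 < ε) (x : N) (f : Laurent R) :
    ∫ t, (Complex.I * evalHom t (partialXi R (1 ⊗ₜ x) f) * (weightReg R k ε t : ℂ) +
      ∑ i, ((k i * R.toLinearMap (R.root i) x : ℝ) : ℂ) * (evalHom t f *
        ((expFun R (rootWt R i) t).im / (rootNormSq R i t + ε) * weightReg R k ε t : ℝ)))
      ∂Measure.addHaar = 0 := by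
  refine integral_eq_zero_of_hasDerivAt x (h := fun t => evalHom t f * (weightReg R k ε t : ℂ))
    ?_ ?_ ?_
  · exact (continuous_evalHom f).mul (Complex.continuous_ofReal.comp (continuous_weightReg hε))
  · refine ((continuous_const.mul (continuous_evalHom _)).mul
      (Complex.continuous_ofReal.comp (continuous_weightReg hε))).add
      (continuous_finsetSum _ fun i _ => continuous_const.mul ((continuous_evalHom f).mul
        (Complex.continuous_ofReal.comp ((continuous_im_div hε i).mul (continuous_weightReg hε)))))
  · intro t s
    refine ((hasDerivAt_evalHom f x t s).mul
      (HasDerivAt.ofReal_comp (hasDerivAt_weightReg (k := k) hε x t s))).congr_deriv ?_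
    congr 1
    push_cast
    rw [Finset.mul_sum, Finset.mul_sum]
    exact Finset.sum_congr rfl fun i _ => by ring

end IntegrationByParts

/-! ### Integration by parts for the weight function -/

section WeightedIntegral

open RootPairing TensorProduct MeasureTheory Filter Topology

open scoped ComplexConjugate

variable {ι M N : Type*} [AddCommGroup M] [Module ℝ M] [NormedAddCommGroup N] [NormedSpace ℝ N]
  {R : RootPairing ι ℝ M N} [R.IsCrystallographic]

/-- The regularisation of `(1 - e^{-α}) Im(e^α) / |1 - e^{-α}|²`. -/
noncomputable def quotReg (R : RootPairing ι ℝ M N) [R.IsCrystallographic] (ε : ℝ) (i : ι)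
    (t : Torus R) : ℂ :=
  (1 - expFun R (-rootWt R i) t) * ((expFun R (rootWt R i) t).im / (rootNormSq R i t + ε) : ℝ)

lemma continuous_quotReg [FiniteDimensional ℝ N] {ε : ℝ} (hε : 0 < ε) (i : ι) :
    Continuous (quotReg R ε i) :=
  (continuous_const.sub (continuous_expFun _)).mul
    (Complex.continuous_ofReal.comp (continuous_im_div hε i))

/-- The bound is uniform in `ε`, as is required for dominated convergence. -/
lemma norm_quotReg_le {ε : ℝ} (hε : 0 < ε) (i : ι) (t : Torus R) : ‖quotReg R ε i t‖ ≤ 1 := by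
  have h0 := rootNormSq_nonneg (R := R) i t
  have h1 : |(expFun R (rootWt R i) t).im| ≤ ‖1 - expFun R (-rootWt R i) t‖ := by
    have h2 := Complex.abs_im_le_norm (1 - expFun R (-rootWt R i) t)
    rw [expFun_neg] at h2 ⊢
    simpa using h2
  rw [quotReg, norm_mul, Complex.norm_real, norm_div, Real.norm_eq_abs,
    Real.norm_of_nonneg (by positivity : 0 ≤ rootNormSq R i t + ε), ← mul_div_assoc,
    div_le_one (by positivity)]
  have h3 : ‖1 - expFun R (-rootWt R i) t‖ * ‖1 - expFun R (-rootWt R i) t‖ = rootNormSq R i t := by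
    rw [rootNormSq, sq]
  nlinarith [mul_le_mul_of_nonneg_left h1 (norm_nonneg (1 - expFun R (-rootWt R i) t))]

variable [Fintype ι] {k : ι → ℝ}

/-- Where `1 - e^{-α} ≠ 0` the quotient tends to `i (1 + e^{-α}) / 2`. Where it vanishes so does the
weight function, since `k_α ≠ 0`. -/
lemma tendsto_quotReg_mul (hk0 : ∀ i, 0 ≤ k i) (i : ι) (t : Torus R) {e : ℕ → ℝ}
    (he : ∀ n, 0 < e n) (hlim : Tendsto e atTop (𝓝 0)) (hki : k i ≠ 0) :
    Tendsto (fun n => quotReg R (e n) i t * (weightReg R k (e n) t : ℂ)) atTop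
      (𝓝 (Complex.I / 2 * (1 + expFun R (-rootWt R i) t) * (weightFun R k t : ℂ))) := by
  have hδ := (Complex.continuous_ofReal.tendsto _).comp
    (tendsto_weightReg (R := R) (k := k) hk0 t he hlim)
  by_cases hu : rootNormSq R i t = 0
  · -- both the quotient and the limit weight vanish
    have h1 : 1 - expFun R (-rootWt R i) t = 0 := by
      rw [rootNormSq] at hu; simpa using hu
    have h2 : weightFun R k t = 0 := by
      rw [weightFun_eq_prod, Finset.prod_eq_zero (Finset.mem_univ i)]
      rw [hu, Real.zero_rpow (by simpa using hki)]
    simp [quotReg, h1, h2]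
  · refine Tendsto.mul ?_ hδ
    have h3 : Complex.I / 2 * (1 + expFun R (-rootWt R i) t) = (1 - expFun R (-rootWt R i) t) *
        ((expFun R (rootWt R i) t).im / (rootNormSq R i t + 0) : ℝ) := by
      have hu' : (rootNormSq R i t : ℂ) ≠ 0 := by exact_mod_cast hu
      have hmul := rootNormSq_eq_mul (R := R) i t
      have him : ((expFun R (rootWt R i) t).im : ℂ)
          = (expFun R (rootWt R i) t - expFun R (-rootWt R i) t) / (2 * Complex.I) := by
        rw [expFun_neg, Complex.im_eq_sub_conj]
      have hone : expFun R (-rootWt R i) t * expFun R (rootWt R i) t = 1 := by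
        rw [← expFun_add, neg_add_cancel, expFun_zero]
      rw [add_zero, Complex.ofReal_div, him, ← mul_div_assoc, eq_div_iff hu', hmul,
        ← mul_div_assoc, eq_div_iff (by simp)]
      generalize expFun R (-rootWt R i) t = a at hone ⊢
      generalize expFun R (rootWt R i) t = b at hone ⊢
      have hI := Complex.I_mul_I
      linear_combination (1 + a) * (1 - a) * (1 - b) * hI + (1 - a) * hone
    rw [h3]
    refine Tendsto.const_mul _ ((Complex.continuous_ofReal.tendsto _).comp ?_)
    exact tendsto_const_nhds.div (hlim.const_add _) (by simpa using hu)

variable [FiniteDimensional ℝ N] [R.IsRootSystem]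

/-- Against a function that is antisymmetric for `s_α`, only the antisymmetric part of `f`
contributes, which is divisible by `1 - e^{-α}`. -/
lemma integral_mul_eq_half (i : ι) (f : Laurent R) {g : Torus R → ℂ} (hg : Continuous g)
    (hanti : ∀ t, g (torusRefl R i t) = -g t) :
    ∫ t, evalHom t f * g t ∂Measure.addHaar = 1 / 2 *
      ∫ t, (1 - expFun R (-rootWt R i) t) * evalHom t (divDiff R i f) * g t ∂Measure.addHaar := by
  have h1 : ∀ t : Torus R, (1 - expFun R (-rootWt R i) t) * evalHom t (divDiff R i f) * g t
      = evalHom t f * g t + evalHom (torusRefl R i t) f * g (torusRefl R i t) := fun t => by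
    rw [hanti, evalHom_torusRefl, mul_neg, ← sub_eq_add_neg, ← sub_mul, ← map_sub, ← divDiff_spec]
    simp
  have hc : Continuous fun t : Torus R => evalHom t f * g t := (continuous_evalHom f).mul hg
  have hc' : Continuous fun t : Torus R => evalHom (torusRefl R i t) f * g (torusRefl R i t) :=
    hc.comp (continuous_torusRefl i)
  simp only [h1]
  rw [integral_add (integrable_of_continuous hc) (integrable_of_continuous hc'),
    integral_torusRefl i fun t => evalHom t f * g t]
  ring

/-- Integration by parts for the regularised weight, symmetrised by the reflections so that the
singularities at `ε = 0` cancel. -/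
lemma integral_weightReg_quotReg (hk : ∀ i j, k (R.reflectionPerm i j) = k j) {ε : ℝ} (hε : 0 < ε)
    (x : N) (f : Laurent R) :
    ∫ t, (Complex.I * evalHom t (partialXi R (1 ⊗ₜ x) f) * (weightReg R k ε t : ℂ) +
      ∑ i, ((k i * R.toLinearMap (R.root i) x : ℝ) : ℂ) * (1 / 2 *
        (evalHom t (divDiff R i f) * (quotReg R ε i t * weightReg R k ε t))))
      ∂Measure.addHaar = 0 := by
  have hw : Continuous fun t : Torus R => (weightReg R k ε t : ℂ) :=
    Complex.continuous_ofReal.comp (continuous_weightReg hε)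
  have hA : Continuous fun t : Torus R =>
      Complex.I * evalHom t (partialXi R (1 ⊗ₜ x) f) * (weightReg R k ε t : ℂ) :=
    (continuous_const.mul (continuous_evalHom _)).mul hw
  have hg : ∀ i, Continuous fun t : Torus R =>
      (((expFun R (rootWt R i) t).im / (rootNormSq R i t + ε) * weightReg R k ε t : ℝ) : ℂ) :=
    fun i => Complex.continuous_ofReal.comp ((continuous_im_div hε i).mul (continuous_weightReg hε))
  have hB : ∀ i, Continuous fun t : Torus R => ((k i * R.toLinearMap (R.root i) x : ℝ) : ℂ) *
      (evalHom t f *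
        ((expFun R (rootWt R i) t).im / (rootNormSq R i t + ε) * weightReg R k ε t : ℝ)) :=
    fun i => continuous_const.mul ((continuous_evalHom f).mul (hg i))
  have hC : ∀ i, Continuous fun t : Torus R => ((k i * R.toLinearMap (R.root i) x : ℝ) : ℂ) *
      (1 / 2 * (evalHom t (divDiff R i f) * (quotReg R ε i t * weightReg R k ε t))) := fun i =>
    continuous_const.mul (continuous_const.mul ((continuous_evalHom _).mul
      ((continuous_quotReg hε i).mul hw)))
  have key := integral_weightReg (k := k) hε x f
  rw [integral_add (integrable_of_continuous hA)
    (integrable_of_continuous (continuous_finsetSum _ fun i _ => hB i)),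
    integral_finsetSum _ fun i _ => integrable_of_continuous (hB i)] at key
  rw [integral_add (integrable_of_continuous hA)
    (integrable_of_continuous (continuous_finsetSum _ fun i _ => hC i)),
    integral_finsetSum _ fun i _ => integrable_of_continuous (hC i), ← key]
  congr 1
  refine Finset.sum_congr rfl fun i _ => ?_
  rw [integral_const_mul, integral_const_mul, integral_const_mul,
    integral_mul_eq_half i f (hg i) fun t => ?_]
  · congr 2
    refine integral_congr_ae (Eventually.of_forall fun t => ?_)
    simp only [quotReg]
    push_cast
    ring
  · have h1 : expFun R (rootWt R i) (torusRefl R i t) = conj (expFun R (rootWt R i) t) := by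
      rw [expFun_torusRefl, ← expFun_neg]
      congr 1
      exact Subtype.ext (R.reflection_apply_self i)
    rw [weightReg_torusRefl hk, rootNormSq_eq, rootNormSq_eq, h1]
    simp
    ring

/-- The integral over the torus of a Laurent polynomial against the weight function. -/
noncomputable def haarInt (R : RootPairing ι ℝ M N) [R.IsCrystallographic] [R.IsRootSystem]
    (k : ι → ℝ) (hk0 : ∀ i, 0 ≤ k i) : Laurent R →ₗ[ℂ] ℂ where
  toFun f := ∫ t : Torus R, evalHom t f * (weightFun R k t : ℂ) ∂Measure.addHaar
  map_add' f g := by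
    have hi : ∀ f : Laurent R, Integrable (fun t : Torus R => evalHom t f * (weightFun R k t : ℂ))
        Measure.addHaar := fun f => integrable_of_continuous ((continuous_evalHom f).mul
      (Complex.continuous_ofReal.comp (continuous_weightFun (R := R) hk0)))
    rw [← integral_add (hi f) (hi g)]
    exact integral_congr_ae (Eventually.of_forall fun t => by simp [add_mul])
  map_smul' c f := by
    rw [RingHom.id_apply, smul_eq_mul, ← integral_const_mul]
    exact integral_congr_ae (Eventually.of_forall fun t => by simp [mul_assoc])

lemma haarInt_apply (hk0 : ∀ i, 0 ≤ k i) (f : Laurent R) : haarInt R k hk0 f =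
    ∫ t : Torus R, evalHom t f * (weightFun R k t : ℂ) ∂Measure.addHaar := rfl

lemma haarInt_weylAct_ofIdx (hk : ∀ i j, k (R.reflectionPerm i j) = k j) (hk0 : ∀ i, 0 ≤ k i)
    (i : ι) (f : Laurent R) :
    haarInt R k hk0 (weylAct R (weylGroup.ofIdx R i) f) = haarInt R k hk0 f := by
  rw [haarInt_apply, haarInt_apply,
    ← integral_torusRefl i fun t => evalHom t f * (weightFun R k t : ℂ)]
  simp only [evalHom_torusRefl, weightFun_torusRefl hk]

/-- Integration by parts for the weight function, in which divided differences replace the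
logarithmic derivatives. -/
lemma haarInt_partialXi (hk : ∀ i j, k (R.reflectionPerm i j) = k j) (hk0 : ∀ i, 0 ≤ k i)
    (x : N) (f : Laurent R) :
    haarInt R k hk0 (partialXi R (1 ⊗ₜ x) f + (1 / 4 : ℂ) •
      ∑ i, ((k i : ℂ) * (R.toLinearMap (R.root i) x : ℂ)) •
        ((1 + mono (-rootWt R i)) * divDiff R i f)) = 0 := by
  set e : ℕ → ℝ := fun n => 1 / ((n : ℝ) + 1) with he
  have hepos : ∀ n, 0 < e n := fun n => by positivity
  have hele : ∀ n, e n ≤ 1 := fun n => by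
    rw [he, div_le_one (by positivity)]; linarith [Nat.cast_nonneg (α := ℝ) n]
  have hlim : Tendsto e atTop (𝓝 0) := tendsto_one_div_add_atTop_nhds_zero_nat
  set G : ℕ → Torus R → ℂ := fun n t =>
    Complex.I * evalHom t (partialXi R (1 ⊗ₜ x) f) * (weightReg R k (e n) t : ℂ) +
      ∑ i, ((k i * R.toLinearMap (R.root i) x : ℝ) : ℂ) * (1 / 2 *
        (evalHom t (divDiff R i f) * (quotReg R (e n) i t * weightReg R k (e n) t))) with hG
  set G0 : Torus R → ℂ := fun t =>
    Complex.I * evalHom t (partialXi R (1 ⊗ₜ x) f) * (weightFun R k t : ℂ) +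
      ∑ i, ((k i * R.toLinearMap (R.root i) x : ℝ) : ℂ) * (1 / 2 * (evalHom t (divDiff R i f) *
        (Complex.I / 2 * (1 + expFun R (-rootWt R i) t) * (weightFun R k t : ℂ)))) with hG0
  -- a bound of the regularised weight for `ε ≤ 1`, as `|1 - e^{-α}|² + ε ≤ 5`
  set C : ℝ := ∏ i, (5 : ℝ) ^ (k i / 2) with hC
  set bd : Torus R → ℝ := fun t => ‖evalHom t (partialXi R (1 ⊗ₜ x) f)‖ * C +
      ∑ i, ‖((k i * R.toLinearMap (R.root i) x : ℝ) : ℂ)‖ * (1 / 2 *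
        (‖evalHom t (divDiff R i f)‖ * (1 * C))) with hbd
  have hlimG : Tendsto (fun n => ∫ t, G n t ∂Measure.addHaar) atTop
      (𝓝 (∫ t, G0 t ∂Measure.addHaar)) := by
    refine tendsto_integral_of_dominated_convergence bd (fun n => ?_) ?_ (fun n => ?_) ?_
    · have hw : Continuous fun t : Torus R => (weightReg R k (e n) t : ℂ) :=
        Complex.continuous_ofReal.comp (continuous_weightReg (hepos n))
      refine Continuous.aestronglyMeasurable ?_
      exact ((continuous_const.mul (continuous_evalHom _)).mul hw).add
        (continuous_finsetSum _ fun i _ => continuous_const.mul (continuous_const.mul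
          ((continuous_evalHom _).mul ((continuous_quotReg (hepos n) i).mul hw))))
    · refine integrable_of_continuous ?_
      exact ((continuous_evalHom _).norm.mul continuous_const).add
        (continuous_finsetSum _ fun i _ => continuous_const.mul (continuous_const.mul
          ((continuous_evalHom _).norm.mul continuous_const)))
    · refine Eventually.of_forall fun t => ?_
      have hwle : ‖(weightReg R k (e n) t : ℂ)‖ ≤ C := by
        rw [Complex.norm_real, Real.norm_of_nonneg (weightReg_pos _ t).le]
        exact weightReg_le hk0 (hepos n) (hele n) t
      refine (norm_add_le _ _).trans (add_le_add ?_ ((norm_sum_le _ _).trans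
        (Finset.sum_le_sum fun i _ => ?_)))
      · rw [norm_mul, norm_mul, Complex.norm_I, one_mul]
        exact mul_le_mul_of_nonneg_left hwle (norm_nonneg _)
      · rw [norm_mul, norm_mul, norm_mul, norm_mul]
        have hhalf : ‖(1 / 2 : ℂ)‖ = 1 / 2 := by norm_num
        rw [hhalf]
        have hq := norm_quotReg_le (R := R) (hepos n) i t
        gcongr
    · refine Eventually.of_forall fun t => ?_
      refine ((((Complex.continuous_ofReal.tendsto _).comp
        (tendsto_weightReg (R := R) (k := k) hk0 t hepos hlim))).const_mul _).add
        (tendsto_finsetSum _ fun i _ => ?_)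
      by_cases hki : k i = 0
      · simp [hki]
      · exact (((tendsto_quotReg_mul hk0 i t hepos hlim hki).const_mul _).const_mul _).const_mul _
  have hzero : ∀ n, ∫ t, G n t ∂Measure.addHaar = 0 := fun n =>
    integral_weightReg_quotReg hk (hepos n) x f
  simp only [hzero] at hlimG
  have h0 : ∫ t, G0 t ∂Measure.addHaar = 0 := (tendsto_nhds_unique hlimG tendsto_const_nhds)
  have hfin : Complex.I * haarInt R k hk0 (partialXi R (1 ⊗ₜ x) f + (1 / 4 : ℂ) •
      ∑ i, ((k i : ℂ) * (R.toLinearMap (R.root i) x : ℂ)) •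
        ((1 + mono (-rootWt R i)) * divDiff R i f)) = 0 := by
    rw [← h0, haarInt_apply, ← integral_const_mul]
    refine integral_congr_ae (Eventually.of_forall fun t => ?_)
    simp only [hG0, map_add, map_smul, map_sum, map_mul, map_one, evalHom_mono, smul_eq_mul]
    push_cast
    rw [← mul_assoc, mul_add, add_mul, Finset.mul_sum, Finset.mul_sum, Finset.sum_mul]
    congr 1
    exact Finset.sum_congr rfl fun i _ => by ring
  exact (mul_eq_zero.mp hfin).resolve_left Complex.I_ne_zero

end WeightedIntegral

/-! ### Derivations and the Weyl group action on Laurent polynomials -/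

section LaurentOperators

open RootPairing TensorProduct

open scoped ComplexConjugate

variable {ι M N : Type*} [AddCommGroup M] [Module ℝ M] [NormedAddCommGroup N] [NormedSpace ℝ N]
  {R : RootPairing ι ℝ M N}

lemma partialXi_mono (ξ : ℂ ⊗[ℝ] N) (μ : weightLattice R) :
    partialXi R ξ (mono μ) = evalC R (μ : M) ξ • mono μ := linExt_mono R _ μ

lemma partialXi_mul (ξ : ℂ ⊗[ℝ] N) (f g : Laurent R) :
    partialXi R ξ (f * g) = partialXi R ξ f * g + f * partialXi R ξ g := by
  have h : (LinearMap.mul ℂ (Laurent R)).compr₂ (partialXi R ξ) =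
      LinearMap.mul ℂ (Laurent R) ∘ₗ partialXi R ξ +
        (LinearMap.mul ℂ (Laurent R)).compl₂ (partialXi R ξ) := by
    refine laurent_hom_ext fun μ => laurent_hom_ext fun ν => ?_
    change partialXi R ξ (mono μ * mono ν) =
      partialXi R ξ (mono μ) * mono ν + mono μ * partialXi R ξ (mono ν)
    rw [mono_mul_mono, partialXi_mono, partialXi_mono, partialXi_mono, smul_mul_assoc,
      mul_smul_comm, mono_mul_mono, ← add_smul, ← evalCHom_apply, ← evalCHom_apply,
      ← evalCHom_apply, AddSubgroup.coe_add, map_add]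
  exact LinearMap.congr_fun (LinearMap.congr_fun h f) g

variable [R.IsCrystallographic]

lemma weylAct_mul (w : R.weylGroup) (f g : Laurent R) :
    weylAct R w (f * g) = weylAct R w f * weylAct R w g := by
  have h : (LinearMap.mul ℂ (Laurent R)).compr₂ (weylAct R w) =
      (LinearMap.mul ℂ (Laurent R)).compl₁₂ (weylAct R w) (weylAct R w) := by
    refine laurent_hom_ext fun μ => laurent_hom_ext fun ν => ?_
    change weylAct R w (mono μ * mono ν) = weylAct R w (mono μ) * weylAct R w (mono ν)
    rw [mono_mul_mono, weylAct_mono, weylAct_mono, weylAct_mono, mono_mul_mono]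
    exact congrArg mono (Subtype.ext (weyl_smul_add w _ _))
  exact LinearMap.congr_fun (LinearMap.congr_fun h f) g

lemma weylAct_weylAct (v w : R.weylGroup) (f : Laurent R) :
    weylAct R v (weylAct R w f) = weylAct R (v * w) f := by
  refine LinearMap.congr_fun (laurent_hom_ext (f := weylAct R v ∘ₗ weylAct R w) fun μ => ?_) f
  rw [LinearMap.comp_apply, weylAct_mono, weylAct_mono, weylAct_mono, mul_smul]

lemma weylAct_one (f : Laurent R) : weylAct R 1 f = f := by
  refine LinearMap.congr_fun (laurent_hom_ext (g := LinearMap.id) fun μ => ?_) f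
  rw [weylAct_mono, one_smul, LinearMap.id_apply]

end LaurentOperators

/-! ### The Hermitian form and the symmetry of the Cherednik operators -/

section HermitianForm

open RootPairing TensorProduct MeasureTheory

open scoped ComplexConjugate

variable {ι M N : Type*} [AddCommGroup M] [Module ℝ M] [NormedAddCommGroup N] [NormedSpace ℝ N]
  {R : RootPairing ι ℝ M N}

lemma conjL_partialXi (x : N) (f : Laurent R) :
    conjL R (partialXi R (1 ⊗ₜ x) f) = -partialXi R (1 ⊗ₜ x) (conjL R f) := by
  refine laurent_induction (p := fun f => conjL R (partialXi R (1 ⊗ₜ x) f) =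
    -partialXi R (1 ⊗ₜ x) (conjL R f)) f (by simp) (fun μ => ?_) ?_ ?_
  · rw [partialXi_mono, conjL_smul, conjL_mono, partialXi_mono]
    simp
  · intro a b ha hb; rw [map_add, map_add, ha, hb, map_add, map_add]; ring
  · intro c a ha; rw [map_smul, conjL_smul, ha, conjL_smul, map_smul, smul_neg]

lemma mono_injective : Function.Injective (mono (R := R)) := fun μ ν h =>
  expFun_injective (funext fun t => by rw [← evalHom_mono, h, evalHom_mono])

variable [R.IsCrystallographic]

lemma conjL_weylAct (w : R.weylGroup) (f : Laurent R) :
    conjL R (weylAct R w f) = weylAct R w (conjL R f) := by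
  refine laurent_induction (p := fun f => conjL R (weylAct R w f) = weylAct R w (conjL R f)) f
    (by simp) (fun μ => ?_) ?_ ?_
  · rw [weylAct_mono, conjL_mono, conjL_mono, weylAct_mono, weight_smul_neg]
  · intro a b ha hb; rw [map_add, map_add, ha, hb, map_add, map_add]
  · intro c a ha; rw [map_smul, conjL_smul, ha, conjL_smul, map_smul]

lemma one_sub_mono_ne_zero (i : ι) : 1 - mono (-rootWt R i) ≠ 0 := fun h => by
  have h1 : mono (R := R) 0 = mono (-rootWt R i) := sub_eq_zero.mp h
  have h2 := congrArg Subtype.val (mono_injective h1)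
  exact R.ne_zero i (neg_eq_zero.mp h2.symm)

lemma rootWt_negIdx (i : ι) : rootWt R (negIdx R i) = -rootWt R i :=
  Subtype.ext (root_negIdx i)

/-- The operator `(1 + e^{-α}) (1 - e^{-α})⁻¹ (1 - s_α)` changes its sign with `α`. -/
lemma one_add_mono_mul_divDiff_negIdx (i : ι) (f : Laurent R) :
    (1 + mono (-rootWt R (negIdx R i))) * divDiff R (negIdx R i) f =
      -((1 + mono (-rootWt R i)) * divDiff R i f) := by
  have h1 := divDiff_spec R i f
  have h2 := divDiff_spec R (negIdx R i) f
  have h0 := one_sub_mono_ne_zero (R := R) (negIdx R i)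
  have hone : mono (-rootWt R i) * mono (-rootWt R (negIdx R i)) = 1 := by
    rw [mono_mul_mono, rootWt_negIdx, neg_neg, neg_add_cancel]; rfl
  rw [ofIdx_negIdx] at h2
  refine mul_left_cancel₀ h0 ?_
  linear_combination (1 + mono (-rootWt R (negIdx R i))) * (h2 - h1) - 2 * divDiff R i f * hone

variable [R.IsRootSystem] [Fintype ι] [FiniteDimensional ℝ N] {k : ι → ℝ}

lemma haarInt_weylAct (hk : ∀ i j, k (R.reflectionPerm i j) = k j) (hk0 : ∀ i, 0 ≤ k i)
    (w : R.weylGroup) (f : Laurent R) : haarInt R k hk0 (weylAct R w f) = haarInt R k hk0 f := by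
  obtain ⟨w, hw⟩ := w
  induction hw using weylGroup.induction generalizing f with
  | mem i => exact haarInt_weylAct_ofIdx hk hk0 i f
  | one => exact congrArg _ (weylAct_one f)
  | mul x y hx' hy' hx hy =>
    have h := weylAct_weylAct (R := R) ⟨x, hx'⟩ ⟨y, hy'⟩ f
    change haarInt R k hk0 (weylAct R (⟨x, hx'⟩ * ⟨y, hy'⟩) f) = _
    rw [← h, hx, hy]

/-- The Hermitian form `(f, g)_k` as a sesquilinear map. -/
noncomputable def formK (R : RootPairing ι ℝ M N) [R.IsCrystallographic] [R.IsRootSystem]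
    (k : ι → ℝ) (hk0 : ∀ i, 0 ≤ k i) : Laurent R →ₗ⋆[ℂ] Laurent R →ₗ[ℂ] ℂ :=
  LinearMap.mk₂'ₛₗ (starRingEnd ℂ) (RingHom.id ℂ) (fun f g => haarInt R k hk0 (conjL R f * g))
    (fun f f' g => by rw [map_add, add_mul, map_add])
    (fun c f g => by rw [conjL_smul, smul_mul_assoc, map_smul])
    (fun f g g' => by rw [mul_add, map_add])
    (fun c f g => by rw [mul_smul_comm, map_smul, RingHom.id_apply])

lemma formK_apply (hk0 : ∀ i, 0 ≤ k i) (f g : Laurent R) :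
    formK R k hk0 f g = haarInt R k hk0 (conjL R f * g) := rfl

lemma innerK_eq (hk0 : ∀ i, 0 ≤ k i) (f g : Laurent R) :
    innerK R k f g = formK R k hk0 f g := by
  rw [formK_apply, haarInt_apply, innerK]
  simp only [evalTorus_eq, map_mul, evalHom_conjL]

lemma formK_weylAct (hk : ∀ i j, k (R.reflectionPerm i j) = k j) (hk0 : ∀ i, 0 ≤ k i)
    (w : R.weylGroup) (f g : Laurent R) :
    formK R k hk0 (weylAct R w f) (weylAct R w g) = formK R k hk0 f g := by
  rw [formK_apply, conjL_weylAct, ← weylAct_mul, haarInt_weylAct hk, formK_apply]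

/-- The Hermitian form is positive definite: the weight function vanishes only where some
`1 - e^{-α}` does, and `ℂ[P]` has no zero divisors. -/
lemma isAnisotropic_formK (hk0 : ∀ i, 0 ≤ k i) : IsAnisotropic (formK R k hk0) where
  conj_symm f g := by
    rw [formK_apply, formK_apply, haarInt_apply, haarInt_apply, ← integral_conj]
    refine integral_congr_ae (Filter.Eventually.of_forall fun t => ?_)
    simp only [map_mul, evalHom_conjL, Complex.conj_conj, Complex.conj_ofReal]
    ring
  eq_zero f hf := by
    have := compactSpace_torus (R := R)
    by_contra hne
    have hprod : f * ∏ i, (1 - mono (-rootWt R i)) ≠ 0 :=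
      mul_ne_zero hne (Finset.prod_ne_zero_iff.mpr fun i _ => one_sub_mono_ne_zero i)
    obtain ⟨t, ht⟩ := exists_evalHom_ne_zero hprod
    rw [map_mul, map_prod, mul_ne_zero_iff, Finset.prod_ne_zero_iff] at ht
    have hcont : Continuous fun t : Torus R => ‖evalHom t f‖ ^ 2 * weightFun R k t :=
      ((continuous_evalHom f).norm.pow 2).mul (continuous_weightFun hk0)
    have hpos := hcont.integral_pos_of_hasCompactSupport_nonneg_nonzero (x := t)
      (μ := Measure.addHaar) (HasCompactSupport.of_compactSpace _)
      (fun s => mul_nonneg (sq_nonneg _) (weightFun_nonneg s)) ?_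
    · refine hpos.ne' ?_
      rw [formK_apply, haarInt_apply] at hf
      have h1 : ∀ t : Torus R, evalHom t (conjL R f * f) * (weightFun R k t : ℂ)
          = ((‖evalHom t f‖ ^ 2 * weightFun R k t : ℝ) : ℂ) := fun t => by
        rw [map_mul, evalHom_conjL, Complex.conj_mul']
        push_cast
        ring
      simp only [h1] at hf
      rw [integral_complex_ofReal] at hf
      exact_mod_cast hf
    · refine mul_ne_zero (pow_ne_zero 2 (norm_ne_zero_iff.mpr ht.1)) (Finset.prod_ne_zero_iff.mpr
        fun i hi => (Real.rpow_pos_of_pos (norm_pos_iff.mpr ?_) _).ne')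
      have := ht.2 i hi
      rwa [map_sub, map_one, evalHom_mono] at this

/-- The failure of a divided difference to be symmetric and its term in the integration by parts
cancel, since their combination is antisymmetric for the reflection. -/
lemma haarInt_divDiff (hk : ∀ i j, k (R.reflectionPerm i j) = k j) (hk0 : ∀ i, 0 ≤ k i) (i : ι)
    (f g : Laurent R) :
    2 * (haarInt R k hk0 (conjL R (divDiff R i f) * g) -
      haarInt R k hk0 (conjL R f * divDiff R i g)) +
      haarInt R k hk0 ((1 + mono (-rootWt R i)) * divDiff R i (conjL R f * g)) = 0 := by
  set s := weylAct R (weylGroup.ofIdx R i) with hs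
  have hss : ∀ h, s (s h) = h := fun h => by
    rw [hs, weylAct_weylAct, ofIdx_mul_self, weylAct_one]
  have hmul : ∀ a b, s (a * b) = s a * s b := weylAct_mul _
  have hone : s 1 = 1 := by
    change s (mono 0) = mono 0
    rw [hs, weylAct_mono]
    exact congrArg mono (Subtype.ext (smul_zero (weylGroup.ofIdx R i : R.Aut)))
  have hneg : s (mono (-rootWt R i)) = mono (rootWt R i) := by
    rw [hs, weylAct_mono, weight_smul_neg]
    exact congrArg mono (Subtype.ext (by
      change -(weylGroup.ofIdx R i • R.root i) = R.root i
      rw [← root_smul_idx]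
      change -R.root (negIdx R i) = R.root i
      rw [root_negIdx, neg_neg]))
  have hcon : ∀ h, conjL R (s h) = s (conjL R h) := conjL_weylAct _
  set A := conjL R f with hA
  set P := conjL R (divDiff R i f) with hP
  set Q := divDiff R i g with hQ
  set T := divDiff R i (A * g) with hT
  set e := mono (-rootWt R i) with he
  have h1 : (1 - mono (rootWt R i)) * P = A - s A := by
    have := congrArg (conjL R) (divDiff_spec R i f)
    rwa [map_mul, map_sub, map_one, conjL_mono, neg_neg, map_sub, hcon] at this
  have h2 : (1 - e) * Q = g - s g := divDiff_spec R i g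
  have h3 : (1 - e) * T = A * g - s A * s g := by rw [← hmul]; exact divDiff_spec R i (A * g)
  rw [← hneg] at h1
  have h1s := congrArg s h1
  have h2s := congrArg s h2
  have h3s := congrArg s h3
  rw [hmul, map_sub, map_sub, hone, hss, hss] at h1s
  rw [hmul, map_sub, map_sub, hone, hss] at h2s
  rw [hmul, map_sub, map_sub, hone, hmul, hmul, hss, hss] at h3s
  have hd : (1 - e) * (1 - s e) ≠ 0 := by
    refine mul_ne_zero (one_sub_mono_ne_zero i) ?_
    rw [hneg]
    have := one_sub_mono_ne_zero (R := R) (negIdx R i)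
    rwa [rootWt_negIdx, neg_neg] at this
  -- multiplied by `(1 - e^{-α}) (1 - e^α)`, the identity has no divided differences left in it
  have key : (2 * (P * g - A * Q) + (1 + e) * T) +
      (2 * (s P * s g - s A * s Q) + (1 + s e) * s T) = 0 := by
    refine (mul_eq_zero.mp ?_).resolve_left hd
    linear_combination 2 * (1 - e) * g * h1 - 2 * (1 - s e) * A * h2 + (1 + e) * (1 - s e) * h3 +
      2 * (1 - s e) * s g * h1s - 2 * (1 - e) * s A * h2s + (1 + s e) * (1 - e) * h3s
  have htwo : ∀ h : Laurent R, haarInt R k hk0 (2 * h) = 2 * haarInt R k hk0 h := fun h => by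
    rw [two_mul, map_add, two_mul]
  have hinv : ∀ h, haarInt R k hk0 (s h) = haarInt R k hk0 h := haarInt_weylAct_ofIdx hk hk0 i
  have := congrArg (haarInt R k hk0) key
  have hs2 : 2 * (s P * s g - s A * s Q) + (1 + s e) * s T =
      s (2 * (P * g - A * Q) + (1 + e) * T) := by
    rw [map_add, two_mul, two_mul, map_add, map_sub, hmul, hmul, hmul, map_add, hone]
  rw [hs2, map_add, hinv, map_add, htwo, map_sub, map_zero] at this
  linear_combination (1 / 2 : ℂ) * this

/-- The Cherednik operators of real vectors are symmetric. -/
lemma formK_cherednik (Δ : SimpleSystem R) (hk : ∀ i j, k (R.reflectionPerm i j) = k j)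
    (hk0 : ∀ i, 0 ≤ k i) (x : N) (f g : Laurent R) :
    formK R k hk0 (cherednik Δ k (1 ⊗ₜ x) f) g = formK R k hk0 f (cherednik Δ k (1 ⊗ₜ x) g) := by
  classical
  set J := haarInt R k hk0 with hJ
  set a : ι → ℂ := fun i => (k i : ℂ) * (R.toLinearMap (R.root i) x : ℂ) with ha
  set b : ι → ℂ := fun i => J ((1 + mono (-rootWt R i)) * divDiff R i (conjL R f * g)) with hb
  have hD : ∀ h : Laurent R, cherednik Δ k (1 ⊗ₜ x) h = partialXi R (1 ⊗ₜ x) h +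
      ∑ i, (if Δ.IsPos i then a i • divDiff R i h else 0) -
      (R.toLinearMap (rho Δ k) x : ℂ) • h := fun h => by
    rw [cherednik, LinearMap.sub_apply, LinearMap.add_apply, LinearMap.sum_apply]
    simp only [evalC_tmul, one_mul, LinearMap.smul_apply, LinearMap.id_apply]
    congr 2
    refine Finset.sum_congr rfl fun i _ => ?_
    split_ifs <;> rfl
  have hparts := haarInt_partialXi hk hk0 x (conjL R f * g)
  rw [map_add, map_smul, map_sum] at hparts
  simp only [map_smul, smul_eq_mul] at hparts
  -- the terms of `α` and `-α` agree, so that the sum over all roots in the integration by parts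
  -- becomes a sum over the positive ones
  have hhalf : ∑ i, (if Δ.IsPos i then a i * b i else 0) = (1 / 2 : ℝ) • ∑ i, a i * b i := by
    refine sum_isPos_eq_half _ fun i => ?_
    have h1 : a (negIdx R i) = -a i := by
      simp only [ha, root_negIdx, map_neg, LinearMap.neg_apply, Complex.ofReal_neg]
      rw [show k (negIdx R i) = k i from multiplicity_smul hk _ i]
      ring
    have h2 : b (negIdx R i) = -b i := by
      simp only [hb]
      rw [one_add_mono_mul_divDiff_negIdx, map_neg]
    rw [h1, h2, neg_mul_neg]
  have hterm : ∀ i, (if Δ.IsPos i then a i * J (conjL R (divDiff R i f) * g) else 0) -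
      (if Δ.IsPos i then a i * J (conjL R f * divDiff R i g) else 0) =
      -(1 / 2) * (if Δ.IsPos i then a i * b i else 0) := fun i => by
    have := haarInt_divDiff hk hk0 i f g
    split_ifs
    · linear_combination (a i / 2) * this
    · simp
  have hl : formK R k hk0 (cherednik Δ k (1 ⊗ₜ x) f) g =
      -J (partialXi R (1 ⊗ₜ x) (conjL R f) * g) +
      ∑ i, (if Δ.IsPos i then a i * J (conjL R (divDiff R i f) * g) else 0) -
      (R.toLinearMap (rho Δ k) x : ℂ) * J (conjL R f * g) := by
    rw [hD, formK_apply, map_sub, map_add, conjL_partialXi, map_sum, conjL_smul,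
      Complex.conj_ofReal, sub_mul, add_mul, neg_mul, smul_mul_assoc, Finset.sum_mul, map_sub,
      map_add, map_neg, map_sum, map_smul, smul_eq_mul]
    congr 2
    refine Finset.sum_congr rfl fun i _ => ?_
    split_ifs
    · rw [conjL_smul, smul_mul_assoc, map_smul, smul_eq_mul]
      have : conj (a i) = a i := by simp [ha]
      rw [this]
    · simp
  have hr : formK R k hk0 f (cherednik Δ k (1 ⊗ₜ x) g) =
      J (conjL R f * partialXi R (1 ⊗ₜ x) g) +
      ∑ i, (if Δ.IsPos i then a i * J (conjL R f * divDiff R i g) else 0) -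
      (R.toLinearMap (rho Δ k) x : ℂ) * J (conjL R f * g) := by
    rw [hD, formK_apply, mul_sub, mul_add, mul_smul_comm, Finset.mul_sum, map_sub, map_add, map_sum,
      map_smul, smul_eq_mul]
    congr 2
    refine Finset.sum_congr rfl fun i _ => ?_
    split_ifs
    · rw [mul_smul_comm, map_smul, smul_eq_mul]
    · simp
  have hsum := Finset.sum_congr (rfl : (Finset.univ : Finset ι) = _) fun i _ => hterm i
  rw [Finset.sum_sub_distrib, ← Finset.mul_sum, hhalf] at hsum
  rw [partialXi_mul, map_add] at hparts
  have hscal : ((1 / 2 : ℝ) • ∑ i, a i * b i : ℂ) = 1 / 2 * ∑ i, a i * b i := by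
    rw [Complex.real_smul]; norm_num
  rw [hscal] at hsum
  rw [hl, hr]
  linear_combination hsum - hparts

end HermitianForm

/-! ### Diagonal operators -/

section DiagonalOperators

variable {V J : Type*} [AddCommGroup V] [Module ℂ V]

/-- The algebra homomorphism which sends a family of scalars to the operator that is diagonal in the
given basis with these eigenvalues. -/
noncomputable def diagHom (b : Module.Basis J ℂ V) : (J → ℂ) →ₐ[ℂ] Module.End ℂ V :=
  AlgHom.ofLinearMap ((b.constr ℂ).toLinearMap ∘ₗ
      LinearMap.pi fun j => (LinearMap.proj j : (J → ℂ) →ₗ[ℂ] ℂ).smulRight (b j))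
    (b.ext fun j => by simp) (fun c d => b.ext fun j => by simp [mul_smul, smul_comm (c j)])

lemma diagHom_apply_basis (b : Module.Basis J ℂ V) (c : J → ℂ) (j : J) :
    diagHom b c (b j) = c j • b j := by simp [diagHom]

end DiagonalOperators

/-! ### Nonsymmetric polynomials -/

section NonsymmetricPolynomials

open RootPairing TensorProduct

variable {ι M N : Type*} [AddCommGroup M] [Module ℝ M] [NormedAddCommGroup N] [NormedSpace ℝ N]
  {R : RootPairing ι ℝ M N}

lemma linearIndependent_mono : LinearIndependent ℂ (mono (R := R)) := by
  have h := (Module.Basis.ofRepr (AddMonoidAlgebra.coeffLinearEquiv ℂ (S := ℂ)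
    (M := weightLattice R))).linearIndependent
  convert h using 1
  funext μ
  simp [mono]

lemma span_range_mono : Submodule.span ℂ (Set.range (mono (R := R))) = ⊤ := by
  rw [eq_top_iff]
  intro f _
  refine laurent_induction f (zero_mem _) (fun μ => Submodule.subset_span ⟨μ, rfl⟩)
    (fun _ _ => add_mem) (fun c _ => Submodule.smul_mem _ c)

lemma eq_of_forall_toLinearMap {m m' : M} (h : ∀ x, R.toLinearMap m x = R.toLinearMap m' x) :
    m = m' :=
  R.toPerfPair.injective (LinearMap.ext h)

variable [R.IsCrystallographic] [Fintype ι] {Δ : SimpleSystem R} {k : ι → ℝ}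

lemma cherednik_mono (ξ : ℂ ⊗[ℝ] N) (μ : weightLattice R) : cherednik Δ k ξ (mono μ) =
    evalC R (μ : M) ξ • mono μ + (∑ i, open Classical in
      if Δ.IsPos i then ((k i : ℂ) * evalC R (R.root i) ξ) • divDiff R i (mono μ) else 0)
    - evalC R (rho Δ k) ξ • mono μ := by
  rw [cherednik, LinearMap.sub_apply, LinearMap.add_apply, LinearMap.sum_apply, partialXi_mono]
  congr 2
  refine Finset.sum_congr rfl fun i _ => ?_
  split_ifs <;> rfl

lemma cherednik_add (ξ η : ℂ ⊗[ℝ] N) :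
    cherednik Δ k (ξ + η) = cherednik Δ k ξ + cherednik Δ k η := by
  refine laurent_hom_ext fun μ => ?_
  rw [LinearMap.add_apply, cherednik_mono, cherednik_mono, cherednik_mono]
  have h : ∀ i, (open Classical in if Δ.IsPos i then
      ((k i : ℂ) * evalC R (R.root i) (ξ + η)) • divDiff R i (mono μ) else 0) =
      (open Classical in if Δ.IsPos i then
        ((k i : ℂ) * evalC R (R.root i) ξ) • divDiff R i (mono μ) else 0) +
      (open Classical in if Δ.IsPos i then
        ((k i : ℂ) * evalC R (R.root i) η) • divDiff R i (mono μ) else 0) := fun i => by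
    split_ifs
    · rw [map_add, mul_add, add_smul]
    · simp
  rw [Finset.sum_congr rfl fun i _ => h i, Finset.sum_add_distrib]
  simp only [map_add, add_smul]
  abel

lemma cherednik_smul (z : ℂ) (ξ : ℂ ⊗[ℝ] N) :
    cherednik Δ k (z • ξ) = z • cherednik Δ k ξ := by
  refine laurent_hom_ext fun μ => ?_
  rw [LinearMap.smul_apply, cherednik_mono, cherednik_mono, smul_sub, smul_add, Finset.smul_sum]
  simp only [map_smul, smul_eq_mul, smul_ite, smul_zero, smul_smul, mul_left_comm z]

variable [R.IsRootSystem] [FiniteDimensional ℝ N] (hk : ∀ i j, k (R.reflectionPerm i j) = k j)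
  {hk0 : ∀ i, 0 ≤ k i} {E : weightLattice R → Laurent R}
  (hE : IsGramSchmidt (formK R k hk0) (weightLE Δ) mono E)

include hk hE

/-- The nonsymmetric polynomials diagonalise the Cherednik operators. -/
lemma cherednik_apply_eq_smul (ξ : ℂ ⊗[ℝ] N) (μ : weightLattice R) :
    cherednik Δ k ξ (E μ) = evalC R (spectral Δ k μ) ξ • E μ := by
  have hreal : ∀ x : N, cherednik Δ k (1 ⊗ₜ x) (E μ) =
      evalC R (spectral Δ k μ) (1 ⊗ₜ x) • E μ := fun x =>
    hE.apply_eq_smul (isAnisotropic_formK hk0) (fun _ _ _ => weightLE_trans)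
      (fun _ _ => weightLE_antisymm) (formK_cherednik Δ hk hk0 x)
      (fun ν => cherednik_mono_sub_mem (1 ⊗ₜ x) ν) μ
  induction ξ with
  | zero =>
    have h := hreal 0
    rwa [TensorProduct.tmul_zero] at h
  | tmul z x =>
    have hz : (z ⊗ₜ[ℝ] x : ℂ ⊗[ℝ] N) = z • (1 ⊗ₜ[ℝ] x) := by
      rw [TensorProduct.smul_tmul', smul_eq_mul, mul_one]
    rw [hz, cherednik_smul, LinearMap.smul_apply, hreal, map_smul, smul_assoc]
  | add ξ η h1 h2 => rw [cherednik_add, LinearMap.add_apply, h1, h2, map_add, add_smul]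

/-- Eigenvectors of the symmetric operators for distinct spectral parameters are orthogonal. -/
lemma nonsymmetric_orthogonal {μ ν : weightLattice R} (hne : μ ≠ ν) :
    formK R k hk0 (E μ) (E ν) = 0 := by
  obtain ⟨x, hx⟩ :
      ∃ x : N, R.toLinearMap (spectral Δ k μ) x ≠ R.toLinearMap (spectral Δ k ν) x := by
    by_contra! hcon
    exact hne (spectral_injective hk hk0 (eq_of_forall_toLinearMap hcon))
  have h := formK_cherednik Δ hk hk0 x (E μ) (E ν)
  rw [cherednik_apply_eq_smul hk hE, cherednik_apply_eq_smul hk hE, map_smulₛₗ, map_smul,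
    LinearMap.smul_apply, evalC_tmul, evalC_tmul, one_mul, one_mul, Complex.conj_ofReal,
    smul_eq_mul, smul_eq_mul] at h
  refine (mul_eq_zero.mp (?_ : ((R.toLinearMap (spectral Δ k μ) x : ℂ) -
    R.toLinearMap (spectral Δ k ν) x) * _ = 0)).resolve_left ?_
  · rw [sub_mul, h, sub_self]
  · exact sub_ne_zero.mpr (by exact_mod_cast hx)

omit hk in
lemma nonsymmetric_norm_ne_zero (μ : weightLattice R) : formK R k hk0 (E μ) (E μ) ≠ 0 :=
  fun h => hE.ne_zero linearIndependent_mono μ ((isAnisotropic_formK hk0).eq_zero _ h)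

omit hk in
lemma mono_mem_span_nonsymmetric (μ : weightLattice R) :
    mono μ ∈ Submodule.span ℂ (E '' {ν | weightLE Δ ν μ}) :=
  hE.base_mem_span weightLE_refl (fun _ _ _ => weightLE_trans) (fun _ _ => weightLE_antisymm)
    finite_setOf_weightLE μ

/-- The operators `q(D)`: since the Cherednik operators have a common eigenbasis, they can be
constructed as the diagonal operators with the values of `q` at the spectral parameters. -/
lemma exists_dunklHom :
    ∃ D : SymmetricAlgebra ℂ (ℂ ⊗[ℝ] N) →ₐ[ℂ] Module.End ℂ (Laurent R),
      (∀ ξ, D (SymmetricAlgebra.ι ℂ _ ξ) = cherednik Δ k ξ) ∧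
      ∀ q μ, D q (E μ) = polyEval R (spectral Δ k μ) q • E μ := by
  have hspan : ⊤ ≤ Submodule.span ℂ (Set.range E) := by
    rw [← span_range_mono, Submodule.span_le]
    rintro _ ⟨μ, rfl⟩
    exact Submodule.span_mono (Set.image_subset_range _ _) (mono_mem_span_nonsymmetric hE μ)
  set b := Module.Basis.mk (linearIndependent_of_orthogonal
    (fun _ _ => nonsymmetric_orthogonal hk hE) (nonsymmetric_norm_ne_zero hE)) hspan with hb
  have hbE : ∀ μ, b μ = E μ := fun μ => Module.Basis.mk_apply _ _ μ
  set D := (diagHom b).comp (AlgHom.pi fun μ => polyEval R (spectral Δ k μ)) with hD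
  have hDE : ∀ q μ, D q (E μ) = polyEval R (spectral Δ k μ) q • E μ := fun q μ => by
    rw [← hbE]; exact diagHom_apply_basis b _ μ
  refine ⟨D, fun ξ => b.ext fun μ => ?_, hDE⟩
  rw [hbE, hDE, cherednik_apply_eq_smul hk hE, polyEval, SymmetricAlgebra.lift_ι_apply]

end NonsymmetricPolynomials

/-! ### Invariant polynomials -/

section PolynomialInvariants

open RootPairing TensorProduct

variable {ι M N : Type*} [AddCommGroup M] [Module ℝ M] [NormedAddCommGroup N] [NormedSpace ℝ N]
  {R : RootPairing ι ℝ M N}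

lemma toLinearMap_coweightMap (w : R.weylGroup) (m : M) (x : N) :
    R.toLinearMap m ((w : R.Aut).toHom.coweightMap x) = R.toLinearMap (w • m) x :=
  (LinearMap.congr_fun (Hom.weight_coweight_transpose_apply R R x (w : R.Aut).toHom) m).symm

lemma evalC_baseChange_coweightMap (w : R.weylGroup) (m : M) (ξ : ℂ ⊗[ℝ] N) :
    evalC R m (LinearMap.baseChange ℂ (w : R.Aut).toHom.coweightMap ξ) = evalC R (w • m) ξ := by
  induction ξ with
  | zero => simp
  | tmul z x => rw [LinearMap.baseChange_tmul, evalC_tmul, evalC_tmul, toLinearMap_coweightMap]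
  | add x y hx hy => rw [map_add, map_add, map_add, hx, hy]

lemma polyEval_polyAct (w : R.weylGroup) (m : M) (q : SymmetricAlgebra ℂ (ℂ ⊗[ℝ] N)) :
    polyEval R m (polyAct R w q) = polyEval R (w⁻¹ • m) q := by
  have h : (polyEval R m).comp (polyAct R w) = polyEval R (w⁻¹ • m) := by
    refine SymmetricAlgebra.algHom_ext (LinearMap.ext fun ξ => ?_)
    change polyEval R m (polyAct R w (SymmetricAlgebra.ι ℂ _ ξ)) =
      polyEval R (w⁻¹ • m) (SymmetricAlgebra.ι ℂ _ ξ)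
    rw [polyAct, SymmetricAlgebra.lift_ι_apply, LinearMap.comp_apply, polyEval, polyEval,
      SymmetricAlgebra.lift_ι_apply, SymmetricAlgebra.lift_ι_apply, evalC_baseChange_coweightMap]
  exact DFunLike.congr_fun h q

lemma polyEval_smul {I : Set ι} {w : R.weylGroup} (hw : w ∈ parabolic R I)
    {q : SymmetricAlgebra ℂ (ℂ ⊗[ℝ] N)} (hq : q ∈ polyInvariants R I) (m : M) :
    polyEval R (w • m) q = polyEval R m q := by
  conv_rhs => rw [← hq w⁻¹ (inv_mem hw)]
  rw [polyEval_polyAct, inv_inv]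

lemma polyAct_polyAct (v w : R.weylGroup) (q : SymmetricAlgebra ℂ (ℂ ⊗[ℝ] N)) :
    polyAct R v (polyAct R w q) = polyAct R (v * w) q := by
  have hmap : ((v⁻¹ : R.weylGroup) : R.Aut).toHom.coweightMap ∘ₗ
      ((w⁻¹ : R.weylGroup) : R.Aut).toHom.coweightMap =
      (((v * w)⁻¹ : R.weylGroup) : R.Aut).toHom.coweightMap := by
    refine LinearMap.ext fun x => R.flip.toPerfPair.injective (LinearMap.ext fun m => ?_)
    change R.toLinearMap m (_) = R.toLinearMap m (_)
    rw [LinearMap.comp_apply, toLinearMap_coweightMap, toLinearMap_coweightMap,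
      toLinearMap_coweightMap, mul_inv_rev, mul_smul]
  have h : (polyAct R v).comp (polyAct R w) = polyAct R (v * w) := by
    refine SymmetricAlgebra.algHom_ext (LinearMap.ext fun ξ => ?_)
    change polyAct R v (polyAct R w (SymmetricAlgebra.ι ℂ _ ξ)) =
      polyAct R (v * w) (SymmetricAlgebra.ι ℂ _ ξ)
    rw [polyAct, polyAct, polyAct, SymmetricAlgebra.lift_ι_apply, LinearMap.comp_apply,
      SymmetricAlgebra.lift_ι_apply, SymmetricAlgebra.lift_ι_apply, LinearMap.comp_apply,
      LinearMap.comp_apply, ← hmap, LinearMap.baseChange_comp, LinearMap.comp_apply]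
  exact DFunLike.congr_fun h q

/-- Two points of `𝔞*` that are not in the same orbit of the parabolic subgroup are separated by an
invariant polynomial: the product of the conjugates of an affine linear function that vanishes at
the first point. -/
lemma exists_polyInvariants_polyEval_ne [R.IsRootSystem] [Finite ι] {I : Set ι} {a b : M}
    (hab : ∀ w ∈ parabolic R I, a ≠ w • b) :
    ∃ q ∈ polyInvariants R I, polyEval R a q ≠ polyEval R b q := by
  have := Fintype.ofFinite (parabolic R I)
  obtain ⟨x, hx⟩ := Module.Dual.exists_forall_ne_zero_of_forall_exists
    (fun w : parabolic R I => R.toLinearMap (a - (w : R.weylGroup)⁻¹ • b)) fun w => by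
      by_contra! hcon
      refine hab _ (inv_mem w.2) (sub_eq_zero.mp (eq_of_forall_toLinearMap (R := R) fun x => ?_))
      rw [hcon x, map_zero, LinearMap.zero_apply]
  set f : SymmetricAlgebra ℂ (ℂ ⊗[ℝ] N) := SymmetricAlgebra.ι ℂ _ (1 ⊗ₜ x) -
    algebraMap ℂ _ (R.toLinearMap a x : ℂ) with hf
  have hval : ∀ m, polyEval R m (∏ w : parabolic R I, polyAct R w f) =
      ∏ w : parabolic R I, ((R.toLinearMap ((w : R.weylGroup)⁻¹ • m) x : ℂ) -
        (R.toLinearMap a x : ℂ)) := fun m => by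
    rw [map_prod]
    refine Finset.prod_congr rfl fun w _ => ?_
    rw [polyEval_polyAct, hf, map_sub, AlgHom.commutes, polyEval, SymmetricAlgebra.lift_ι_apply,
      evalC_tmul, one_mul]
    rfl
  refine ⟨∏ w : parabolic R I, polyAct R w f, fun v hv => ?_, ?_⟩
  · rw [map_prod]
    simp only [polyAct_polyAct]
    exact Fintype.prod_bijective (fun w : parabolic R I => ⟨v, hv⟩ * w)
      (Group.mulLeft_bijective _) _ _ fun w => by rw [Subgroup.coe_mul]
  · have h0 : ∏ w : parabolic R I, ((R.toLinearMap ((w : R.weylGroup)⁻¹ • a) x : ℂ) -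
        (R.toLinearMap a x : ℂ)) = 0 := by
      refine Finset.prod_eq_zero (i := (1 : parabolic R I)) (Finset.mem_univ _) ?_
      rw [Subgroup.coe_one, inv_one, one_smul, sub_self]
    rw [hval, hval, h0]
    refine (Finset.prod_ne_zero_iff.mpr fun w _ => ?_).symm
    have h := hx w
    rw [map_sub, LinearMap.sub_apply, sub_ne_zero] at h
    exact sub_ne_zero.mpr (by exact_mod_cast h.symm)

end PolynomialInvariants

/-! ### Orbit sums -/

section OrbitSums

open RootPairing TensorProduct

variable {ι M N : Type*} [AddCommGroup M] [Module ℝ M] [NormedAddCommGroup N] [NormedSpace ℝ N]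
  {R : RootPairing ι ℝ M N}

/-- The coefficient of the monomial `e^μ`. -/
noncomputable def coeffAt (μ : weightLattice R) : Laurent R →ₗ[ℂ] ℂ :=
  Finsupp.lapply μ ∘ₗ (AddMonoidAlgebra.coeffLinearEquiv ℂ).toLinearMap

open Classical in
lemma coeffAt_mono (μ ν : weightLattice R) : coeffAt μ (mono ν) = if ν = μ then 1 else 0 := by
  simp [coeffAt, mono, Finsupp.single_apply]

lemma sum_coeffAt (f : Laurent R) :
    ∑ μ ∈ f.coeff.support, coeffAt μ f • mono μ = f := by
  conv_rhs => rw [← AddMonoidAlgebra.sum_coeff_single f]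
  refine Finset.sum_congr rfl fun μ _ => ?_
  simp [coeffAt, mono]

variable [R.IsCrystallographic] {I : Set ι}

lemma mem_invariants {f : Laurent R} :
    f ∈ invariants R I ↔ ∀ w ∈ parabolic R I, weylAct R w f = f := by
  simp [invariants, LinearMap.mem_eqLocus]

lemma coeffAt_weylAct (w : R.weylGroup) (μ : weightLattice R) (f : Laurent R) :
    coeffAt (w • μ) (weylAct R w f) = coeffAt μ f := by
  refine LinearMap.congr_fun (laurent_hom_ext (f := coeffAt (w • μ) ∘ₗ weylAct R w) fun ν => ?_) f
  classical
  rw [LinearMap.comp_apply, weylAct_mono, coeffAt_mono, coeffAt_mono]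
  simp

lemma smul_mem_orbitI {w : R.weylGroup} (hw : w ∈ parabolic R I) {μ ν : weightLattice R} :
    w • ν ∈ orbitI R I μ ↔ ν ∈ orbitI R I μ := by
  constructor
  · rintro ⟨v, hv, h⟩
    exact ⟨w⁻¹ * v, mul_mem (inv_mem hw) hv, by rw [mul_smul, h, inv_smul_smul]⟩
  · rintro ⟨v, hv, rfl⟩
    exact ⟨w * v, mul_mem hw hv, mul_smul w v μ⟩

variable [R.IsRootSystem] [Finite ι]

lemma orbitSum_mem_invariants (μ : weightLattice R) : orbitSum R I μ ∈ invariants R I := by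
  refine mem_invariants.mpr fun w hw => ?_
  rw [orbitSum, map_sum]
  refine Finset.sum_bij (fun ν _ => w • ν) (fun ν hν => ?_) (fun ν _ ν' _ h => ?_)
    (fun ν hν => ?_) (fun ν _ => weylAct_mono w ν)
  · rw [Set.Finite.mem_toFinset] at hν ⊢
    exact (smul_mem_orbitI hw).mpr hν
  · exact MulAction.injective w h
  · rw [Set.Finite.mem_toFinset] at hν
    refine ⟨w⁻¹ • ν, ?_, smul_inv_smul w ν⟩
    rw [Set.Finite.mem_toFinset]
    exact (smul_mem_orbitI (inv_mem hw)).mpr hν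

open Classical in
lemma coeffAt_orbitSum (μ ν : weightLattice R) :
    coeffAt μ (orbitSum R I ν) = if μ ∈ orbitI R I ν then 1 else 0 := by
  rw [orbitSum, map_sum]
  simp only [coeffAt_mono, Finset.sum_ite_eq', Set.Finite.mem_toFinset]

variable {Δ : SimpleSystem R} (hI : I ⊆ Δ.support)

include hI

lemma mem_orbitI_iff {μ : weightLattice R} (hμ : μ ∈ dominantI Δ I) (ν : weightLattice R) :
    ν ∈ orbitI R I μ ↔ domRepI Δ I ν = μ := by
  constructor
  · rintro ⟨w, hw, h⟩
    exact domRepI_eq hI hw hμ h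
  · rintro rfl
    exact exists_smul_domRepI Δ I ν

lemma linearIndependent_orbitSum :
    LinearIndependent ℂ fun μ : dominantI Δ I => orbitSum R I μ.1 := by
  classical
  rw [linearIndependent_iff]
  intro c hc
  ext μ
  have h := congrArg (coeffAt μ.1) hc
  rw [Finsupp.linearCombination_apply, Finsupp.sum, map_sum, map_zero] at h
  simp only [map_smul, coeffAt_orbitSum, smul_eq_mul] at h
  have hiff : ∀ ν : dominantI Δ I, (μ.1 ∈ orbitI R I ν.1) ↔ μ = ν := fun ν => by
    rw [mem_orbitI_iff hI ν.2, domRepI_eq hI (one_mem _) μ.2 (one_smul _ _), Subtype.coe_inj]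
  simpa [hiff] using h

lemma mem_span_orbitSum {f : Laurent R} (hf : f ∈ invariants R I) :
    f ∈ Submodule.span ℂ (Set.range fun μ : dominantI Δ I => orbitSum R I μ.1) := by
  classical
  rw [← sum_coeffAt f, ← Finset.sum_fiberwise_of_maps_to (t := f.coeff.support.image (domRepI Δ I))
    (g := domRepI Δ I) fun μ hμ => Finset.mem_image_of_mem _ hμ]
  have hcoeff : ∀ μ, coeffAt μ f = coeffAt (domRepI Δ I μ) f := fun μ => by
    obtain ⟨w, hw, h⟩ := exists_smul_domRepI Δ I μ
    conv_lhs => rw [← h, ← mem_invariants.mp hf w hw]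
    exact coeffAt_weylAct w _ f
  have hsupp : ∀ μ, μ ∈ f.coeff.support ↔ coeffAt μ f ≠ 0 := fun μ => Finsupp.mem_support_iff
  refine sum_mem fun d hd => ?_
  obtain ⟨μ, hμ, rfl⟩ := Finset.mem_image.mp hd
  have hd : domRepI Δ I μ ∈ dominantI Δ I := domRepI_isDomI Δ I μ
  have hsum : ∑ ν ∈ f.coeff.support with domRepI Δ I ν = domRepI Δ I μ, coeffAt ν f • mono ν =
      coeffAt μ f • orbitSum R I (domRepI Δ I μ) := by
    rw [orbitSum, Finset.smul_sum]
    refine Finset.sum_congr ?_ fun ν hν => ?_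
    · ext ν
      rw [Finset.mem_filter, Set.Finite.mem_toFinset, mem_orbitI_iff hI hd, and_iff_right_iff_imp]
      intro h
      rw [hsupp, hcoeff, h, ← hcoeff, ← hsupp]
      exact hμ
    · rw [Set.Finite.mem_toFinset, mem_orbitI_iff hI hd] at hν
      rw [hcoeff, hν, ← hcoeff]
  rw [hsum]
  exact Submodule.smul_mem _ _ (Submodule.subset_span ⟨⟨_, hd⟩, rfl⟩)

end OrbitSums

/-! ### Parabolic Jacobi polynomials -/

section ParabolicJacobiPolynomials

open RootPairing TensorProduct

open scoped ComplexConjugate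

variable {ι M N : Type*} [AddCommGroup M] [Module ℝ M] [NormedAddCommGroup N] [NormedSpace ℝ N]
  {R : RootPairing ι ℝ M N} [R.IsCrystallographic] [R.IsRootSystem] [Fintype ι]
  {Δ : SimpleSystem R} {I : Set ι}

lemma finite_setOf_weightLE_dominantI (lam : dominantI Δ I) :
    {μ : dominantI Δ I | weightLE Δ μ.1 lam.1}.Finite :=
  have h := (finite_setOf_weightLE (Δ := Δ) lam.1).preimage
    (f := Subtype.val (p := (· ∈ dominantI Δ I))) Subtype.val_injective.injOn
  h

variable [FiniteDimensional ℝ N] {k : ι → ℝ} {hk0 : ∀ i, 0 ≤ k i} {p : dominantI Δ I → Laurent R}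
  (hp : IsGramSchmidt (formK R k hk0) (fun μ ν : dominantI Δ I => weightLE Δ μ.1 ν.1)
    (fun μ => orbitSum R I μ.1) p)

include hp

lemma parabolic_mem_invariants (lam : dominantI Δ I) : p lam ∈ invariants R I := by
  refine Submodule.span_le.mpr ?_ (hp.mem_span_base (fun μ => weightLE_refl μ.1) lam)
  rintro _ ⟨μ, _, rfl⟩
  exact orbitSum_mem_invariants μ.1

/-- The defining properties of the Jacobi polynomial say that it is the Gram-Schmidt vector; two
polynomials with these properties differ by a combination of smaller orbit sums that is orthogonal
to itself. -/
lemma isJacobi_iff (lam : dominantI Δ I) (f : Laurent R) : IsJacobi Δ I k lam f ↔ f = p lam := by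
  classical
  set L := Submodule.span ℂ ((fun μ : dominantI Δ I => orbitSum R I μ.1) ''
    {μ | weightLE Δ μ.1 lam.1 ∧ μ ≠ lam}) with hL
  have hB := isAnisotropic_formK (R := R) hk0
  constructor
  · rintro ⟨⟨c, hc1, hc, rfl⟩, horth⟩
    set f := c.sum fun μ a => a • orbitSum R I μ.1 with hf
    have h1 : f - orbitSum R I lam.1 ∈ L := by
      have h2 : f - orbitSum R I lam.1 =
          Finsupp.linearCombination ℂ (fun μ : dominantI Δ I => orbitSum R I μ.1)
            (c - Finsupp.single lam 1) := by
        rw [map_sub, Finsupp.linearCombination_single, one_smul]; rfl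
      rw [h2]
      refine (Finsupp.mem_span_image_iff_linearCombination ℂ).mpr ⟨_, ?_, rfl⟩
      intro μ hμ
      have hμ0 := Finsupp.mem_support_iff.mp hμ
      rw [Finsupp.sub_apply] at hμ0
      have hne : μ ≠ lam := by
        rintro rfl
        exact hμ0 (by simp [hc1])
      rw [Finsupp.single_eq_of_ne hne, sub_zero] at hμ0
      exact ⟨hc μ hμ0, hne⟩
    have h3 : f - p lam ∈ L := by
      have := add_mem h1 (hp.sub_mem lam)
      rwa [sub_add_sub_cancel] at this
    have h4 : formK R k hk0 (f - p lam) (f - p lam) = 0 := by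
      rw [map_sub, hp.form_eq_zero h3, sub_zero]
      refine form_eq_zero_of_mem_span h3 ?_
      rintro _ ⟨μ, ⟨hμ, hne⟩, rfl⟩
      exact hB.symm_zero (by rw [← innerK_eq]; exact horth μ hμ hne)
    exact sub_eq_zero.mp (hB.eq_zero _ h4)
  · rintro rfl
    refine ⟨?_, fun μ hμ hne => ?_⟩
    · obtain ⟨c, hc, hcsum⟩ := (Finsupp.mem_span_image_iff_linearCombination ℂ).mp (hp.sub_mem lam)
      have hc0 : ∀ μ, c μ ≠ 0 → weightLE Δ μ.1 lam.1 ∧ μ ≠ lam := fun μ hμ =>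
        hc (Finsupp.mem_support_iff.mpr hμ)
      have hclam : c lam = 0 := by
        by_contra h
        exact (hc0 lam h).2 rfl
      refine ⟨Finsupp.single lam 1 - c, by simp [hclam], fun μ hμ => ?_, ?_⟩
      · by_cases hne : μ = lam
        · rw [hne]; exact weightLE_refl lam.1
        · rw [Finsupp.sub_apply, Finsupp.single_eq_of_ne hne, zero_sub, neg_ne_zero] at hμ
          exact (hc0 μ hμ).1
      · change p lam = Finsupp.linearCombination ℂ (fun μ : dominantI Δ I => orbitSum R I μ.1) _
        rw [map_sub, Finsupp.linearCombination_single, one_smul, hcsum, sub_sub_cancel]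
    · rw [innerK_eq hk0]
      exact hB.symm_zero (hp.orthogonal μ lam hμ hne)

/-- By invariance, orthogonality to an orbit sum is orthogonality to each of its monomials. -/
lemma formK_mono_parabolic (hk : ∀ i j, k (R.reflectionPerm i j) = k j) {lam : dominantI Δ I}
    {τ : weightLattice R} (hτ : weightLE Δ (domRepI Δ I τ) lam.1) (hne : domRepI Δ I τ ≠ lam.1) :
    formK R k hk0 (mono τ) (p lam) = 0 := by
  obtain ⟨w, hw, hwτ⟩ := exists_smul_domRepI Δ I τ
  set d := domRepI Δ I τ with hd
  have hinv : ∀ v ∈ parabolic R I, formK R k hk0 (mono (v • d)) (p lam) =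
      formK R k hk0 (mono d) (p lam) := fun v hv => by
    conv_lhs => rw [← mem_invariants.mp (parabolic_mem_invariants hp lam) v hv, ← weylAct_mono]
    exact formK_weylAct hk hk0 v _ _
  have h1 := hp.orthogonal ⟨d, domRepI_isDomI Δ I τ⟩ lam hτ fun h => hne (congrArg Subtype.val h)
  have h2 : formK R k hk0 (orbitSum R I d) (p lam) =
      (orbitI_finite R I d).toFinset.card • formK R k hk0 (mono d) (p lam) := by
    rw [orbitSum, map_sum, LinearMap.sum_apply, ← Finset.sum_const]
    refine Finset.sum_congr rfl fun ν hν => ?_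
    obtain ⟨v, hv, rfl⟩ := (Set.Finite.mem_toFinset _).mp hν
    exact hinv v hv
  have hcard : (orbitI_finite R I d).toFinset.card ≠ 0 :=
    Finset.card_ne_zero.mpr ⟨d, (Set.Finite.mem_toFinset _).mpr ⟨1, one_mem _, one_smul _ _⟩⟩
  have h3 : (orbitI_finite R I d).toFinset.card • formK R k hk0 (mono d) (p lam) = 0 := by
    rw [← h2]; exact h1
  rw [← hwτ, hinv w hw]
  exact (smul_eq_zero.mp h3).resolve_left hcard

variable (hI : I ⊆ Δ.support)

include hI

lemma span_parabolic : Submodule.span ℂ (Set.range p) = invariants R I := by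
  refine le_antisymm (Submodule.span_le.mpr ?_) fun f hf => ?_
  · rintro _ ⟨lam, rfl⟩
    exact parabolic_mem_invariants hp lam
  · refine Submodule.span_le.mpr ?_ (mem_span_orbitSum hI hf)
    rintro _ ⟨lam, rfl⟩
    exact Submodule.span_mono (Set.image_subset_range _ _) (hp.base_mem_span
      (fun μ => weightLE_refl μ.1) (fun _ _ _ => weightLE_trans)
      (fun _ _ h h' => Subtype.ext (weightLE_antisymm h h')) finite_setOf_weightLE_dominantI lam)

lemma parabolic_norm_ne_zero (lam : dominantI Δ I) : formK R k hk0 (p lam) (p lam) ≠ 0 :=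
  fun h => hp.ne_zero (linearIndependent_orbitSum hI) lam ((isAnisotropic_formK hk0).eq_zero _ h)

/-- The symmetry of diagonal operators with respect to an orthogonal family of eigenvectors. -/
lemma formK_apply_of_diagonal {T T' : Module.End ℂ (Laurent R)} {c c' : dominantI Δ I → ℂ}
    (horth : ∀ lam μ, lam ≠ μ → formK R k hk0 (p lam) (p μ) = 0)
    (hT : ∀ lam, T (p lam) = c lam • p lam) (hT' : ∀ lam, T' (p lam) = c' lam • p lam)
    (hc : ∀ lam, c' lam = conj (c lam)) {f g : Laurent R} (hf : f ∈ invariants R I)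
    (hg : g ∈ invariants R I) : formK R k hk0 (T f) g = formK R k hk0 f (T' g) := by
  rw [← span_parabolic hp hI] at hf hg
  induction hf using Submodule.span_induction with
  | zero => simp
  | add x y _ _ hx hy =>
    rw [map_add, map_add, map_add, LinearMap.add_apply, LinearMap.add_apply, hx, hy]
  | smul a x _ hx =>
    rw [map_smul, map_smulₛₗ, map_smulₛₗ, LinearMap.smul_apply, LinearMap.smul_apply, hx]
  | mem x hx =>
    obtain ⟨lam, rfl⟩ := hx
    induction hg using Submodule.span_induction with
    | zero => simp
    | add x y _ _ hx hy => rw [map_add, map_add, map_add, hx, hy]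
    | smul a x _ hx => rw [map_smul, map_smul, map_smul, hx]
    | mem x hx =>
      obtain ⟨μ, rfl⟩ := hx
      rw [hT, hT', map_smulₛₗ, LinearMap.smul_apply, map_smul]
      by_cases h : lam = μ
      · rw [h, hc]
      · rw [horth lam μ h, smul_zero, smul_zero]

variable (hk : ∀ i j, k (R.reflectionPerm i j) = k j)

include hk

variable {E : weightLattice R → Laurent R}
  (hE : IsGramSchmidt (formK R k hk0) (weightLE Δ) mono E)

include hE

/-- The polynomial `p_I(lam)` is a combination of the nonsymmetric polynomials whose labels are in
the orbit `W_I lam`. -/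
lemma parabolic_mem_span_nonsymmetric (lam : dominantI Δ I) :
    p lam ∈ Submodule.span ℂ (E '' {κ | domRepI Δ I κ = lam.1}) := by
  refine mem_span_of_orthogonal (fun _ _ => nonsymmetric_orthogonal hk hE)
    (nonsymmetric_norm_ne_zero hE) (s := {κ | weightLE Δ (domRepI Δ I κ) lam.1}) ?_
    fun κ hκ hne => ?_
  · refine Submodule.span_le.mpr ?_ (hp.mem_span_base (fun μ => weightLE_refl μ.1) lam)
    rintro _ ⟨μ, hμ, rfl⟩
    refine sum_mem fun τ hτ => ?_
    rw [Set.Finite.mem_toFinset, mem_orbitI_iff hI μ.2] at hτ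
    refine Submodule.span_mono (Set.image_mono fun κ hκ => ?_) (mono_mem_span_nonsymmetric hE τ)
    have h := weightLE_domRepI hI hκ
    rw [hτ] at h
    exact weightLE_trans h hμ
  · refine form_eq_zero_of_mem_span (hE.mem_span_base weightLE_refl κ) ?_
    rintro _ ⟨τ, hτ, rfl⟩
    have h := weightLE_domRepI hI hτ
    refine formK_mono_parabolic hp hk (weightLE_trans h hκ) fun heq => hne ?_
    exact weightLE_antisymm hκ (heq ▸ h)

/-- Polynomials `p_I` with distinct labels involve nonsymmetric polynomials with labels in disjoint
orbits. -/
lemma parabolic_orthogonal {lam μ : dominantI Δ I} (hne : lam ≠ μ) :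
    formK R k hk0 (p lam) (p μ) = 0 := by
  refine form_eq_zero_of_mem_span (parabolic_mem_span_nonsymmetric hp hI hk hE lam) ?_
  rintro _ ⟨κ, hκ, rfl⟩
  refine (isAnisotropic_formK hk0).symm_zero (form_eq_zero_of_mem_span
    (parabolic_mem_span_nonsymmetric hp hI hk hE μ) ?_)
  rintro _ ⟨τ, hτ, rfl⟩
  refine nonsymmetric_orthogonal hk hE fun h => hne (Subtype.ext ?_)
  rw [← hκ, ← hτ, h]

/-- The values at the spectral parameters of a polynomial that is invariant under the parabolic
subgroup are constant on the orbits, whence such polynomials give operators with eigenvectors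
`p_I`. -/
lemma apply_parabolic
    {D : SymmetricAlgebra ℂ (ℂ ⊗[ℝ] N) →ₐ[ℂ] Module.End ℂ (Laurent R)}
    (hD : ∀ q μ, D q (E μ) = polyEval R (spectral Δ k μ) q • E μ)
    {q : SymmetricAlgebra ℂ (ℂ ⊗[ℝ] N)} (hq : q ∈ polyInvariants R I) (lam : dominantI Δ I) :
    D q (p lam) = polyEval R (spectral Δ k lam.1) q • p lam := by
  have h := parabolic_mem_span_nonsymmetric hp hI hk hE lam
  refine Submodule.span_le (p := LinearMap.eqLocus (D q)
    (polyEval R (spectral Δ k lam.1) q • LinearMap.id)).mpr ?_ h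
  rintro _ ⟨κ, hκ, rfl⟩
  obtain ⟨w, hw, hwκ⟩ := exists_smul_domRepI Δ I κ
  rw [show domRepI Δ I κ = lam.1 from hκ] at hwκ
  obtain ⟨w', hw', hs⟩ := exists_spectral_smul (Δ := Δ) hk hI hw lam.1
  rw [hwκ] at hs
  change D q (E κ) = polyEval R (spectral Δ k lam.1) q • E κ
  rw [hD, hs, polyEval_smul hw' hq]

end ParabolicJacobiPolynomials

end ParabolicJacobi

open ParabolicJacobi TensorProduct in
theorem mainTheorem1 {ι M N : Type*} [Fintype ι] [AddCommGroup M] [Module ℝ M]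
    [NormedAddCommGroup N] [NormedSpace ℝ N] [FiniteDimensional ℝ N]
    (R : RootPairing ι ℝ M N) [R.IsRootSystem] [R.IsCrystallographic]
    (Δ : SimpleSystem R) (I : Set ι) (hI : I ⊆ Δ.support)
    (k : ι → ℝ) (hk_inv : ∀ i j, k (R.reflectionPerm i j) = k j) (hk_nonneg : ∀ i, 0 ≤ k i) :
    ∃ p : dominantI Δ I → Laurent R,
      -- the Jacobi polynomials exist and are unique
      (∀ lam f, IsJacobi Δ I k lam f ↔ f = p lam) ∧
      -- they are pairwise orthogonal
      (∀ lam μ, lam ≠ μ → innerK R k (p lam) (p μ) = 0) ∧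
      -- they form a basis of the space of invariants
      (∀ lam, innerK R k (p lam) (p lam) ≠ 0) ∧
      LinearIndependent ℂ p ∧ Submodule.span ℂ (Set.range p) = invariants R I ∧
      -- the Cherednik operators commute, so that `q ↦ q(D(k))` is defined on the symmetric algebra
      ∃ D : SymmetricAlgebra ℂ (ℂ ⊗[ℝ] N) →ₐ[ℂ] Module.End ℂ (Laurent R),
        (∀ ξ, D (SymmetricAlgebra.ι ℂ _ ξ) = cherednik Δ k ξ) ∧
        -- invariant `q` give operators on the space of invariants
        (∀ q ∈ polyInvariants R I, ∀ f ∈ invariants R I, D q f ∈ invariants R I) ∧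
        -- the adjoint for `q` is the operator for the complex conjugate of `q`;
        -- in particular, the operators for real `q` are symmetric
        (∀ q ∈ polyInvariants R I, ∀ q' ∈ polyInvariants R I,
          (∀ m : M, polyEval R m q' = (starRingEnd ℂ) (polyEval R m q)) →
          ∀ f ∈ invariants R I, ∀ g ∈ invariants R I,
            innerK R k (D q f) g = innerK R k f (D q' g)) ∧
        -- the Jacobi polynomials are eigenfunctions
        (∀ q ∈ polyInvariants R I, ∀ lam,
          D q (p lam) = polyEval R (spectral Δ k lam.1) q • p lam) ∧
        -- the eigenvalues separate the labels
        (∀ lam μ : dominantI Δ I, lam ≠ μ → ∃ q ∈ polyInvariants R I,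
          polyEval R (spectral Δ k lam.1) q ≠ polyEval R (spectral Δ k μ.1) q) := by
  have hB := isAnisotropic_formK (R := R) hk_nonneg
  obtain ⟨E, hE⟩ := exists_isGramSchmidt hB (r := weightLE Δ) finite_setOf_weightLE mono
  obtain ⟨p, hp⟩ := exists_isGramSchmidt hB
    (r := fun μ ν : dominantI Δ I => weightLE Δ μ.1 ν.1) finite_setOf_weightLE_dominantI
    fun μ => orbitSum R I μ.1
  obtain ⟨D, hD, hDE⟩ := exists_dunklHom hk_inv hE
  have horth : ∀ lam μ, lam ≠ μ → formK R k hk_nonneg (p lam) (p μ) = 0 := fun _ _ =>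
    parabolic_orthogonal hp hI hk_inv hE
  have heig : ∀ q ∈ polyInvariants R I, ∀ lam,
      D q (p lam) = polyEval R (spectral Δ k lam.1) q • p lam := fun q hq =>
    apply_parabolic hp hI hk_inv hE hDE hq
  refine ⟨p, isJacobi_iff hp, fun lam μ h => by rw [innerK_eq hk_nonneg, horth lam μ h],
    fun lam => by rw [innerK_eq hk_nonneg]; exact parabolic_norm_ne_zero hp hI lam,
    linearIndependent_of_orthogonal horth (parabolic_norm_ne_zero hp hI), span_parabolic hp hI,
    D, hD, fun q hq => ?_, fun q hq q' hq' hqq' f hf g hg => ?_, heig, fun lam μ hne => ?_⟩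
  · rw [← span_parabolic hp hI]
    intro f hf
    induction hf using Submodule.span_induction with
    | zero => rw [map_zero]; exact zero_mem _
    | add x y _ _ hx hy => rw [map_add]; exact add_mem hx hy
    | smul a x _ hx => rw [map_smul]; exact Submodule.smul_mem _ _ hx
    | mem x hx =>
      obtain ⟨lam, rfl⟩ := hx
      rw [heig q hq]
      exact Submodule.smul_mem _ _ (Submodule.subset_span ⟨lam, rfl⟩)
  · rw [innerK_eq hk_nonneg, innerK_eq hk_nonneg]
    exact formK_apply_of_diagonal hp hI horth (heig q hq) (heig q' hq') (fun lam => hqq' _) hf hg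
  · refine exists_polyInvariants_polyEval_ne fun w hw h => hne (Subtype.ext (Subtype.ext ?_))
    have h1 := smul_eq_of_smul_spectral_eq hk_inv hk_nonneg h.symm
    exact (eq_of_smul_eq_of_isDomI hI hw μ.2 lam.2 (congrArg Subtype.val h1)).symm
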